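/- \textbf{Setting.} Let $p,q,d\in\mathbb N$, $\gamma\in(0,1)$, let the state space be $\mathcal S=\mathbb R^p$ and let the action space $\mathcal A\subseteq\mathbb R^q$ be a measurable set of positive Lebesgue measure ($\mathcal A=\mathbb R^q$ is allowed). Let $\mathcal P$ be a transition kernel, $\rho$ an initial distribution, $r$ a measurable reward with $|r|\le R$ on $\mathcal S\times\mathcal A$, $\sigma>0$, and $\mu_\theta:\mathcal S\to\mathbb R^q$ measurable for each $\theta\in\mathbb R^d$. The Gaussian policy has the density $$\pi_\theta(a|s)=\frac{1}{Z_\theta(s)}\exp\Big(-\frac{\|\mu_\theta(s)-a\|^2}{2\sigma^2}\Big),\qquad Z_\theta(s)=\int_{\mathcal A}\exp\Big(-\frac{\|\mu_\theta(s)-a\|^2}{2\sigma^2}\Big)da,$$ with respect to Lebesgue measure on $\mathcal A$ (so $Z_\theta(s)=(2\pi\sigma^2)^{q/2}$ if $\mathcal A=\mathbb R^q$). Assume that $\theta\mapsto\mu_\theta(s)$ is $C^1$ and $l_\mu$-Lipschitz uniformly in $s$, and that $\log\pi_\theta(a|s)$ is twice differentiable in $\theta$ with $\|\nabla_\theta\log\pi_\theta(a|s)\|\le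 M_g$ and $\|\nabla^2_\theta\log\pi_\theta(a|s)\|\le M_h$ for all $\theta\in\mathbb R^d$, $s\in\mathcal S$, $a\in\mathcal A$, where $M_g,M_h>0$. Let $J(\theta)=\mathbb E_{\rho,\pi_\theta}[\sum_{t\ge0}\gamma^t r(s_t,a_t)]$, $J^\star=\sup_\theta J(\theta)$. For a trajectory $\tau=(s_0,a_0,\dots,s_{H-1},a_{H-1})$ let $$g(\tau,\theta)=\sum_{t=0}^{H-1}\Big(\sum_{h=t}^{H-1}\gamma^h r(s_h,a_h)\Big)\nabla_\theta\log\pi_\theta(a_t|s_t),\qquad w(\tau|\theta',\theta)=\prod_{h=0}^{H-1}\frac{\pi_{\theta'}(a_h|s_h)}{\pi_\theta(a_h|s_h)}.$$ \textbf{Algorithm (N-VR-PG).} Given $\theta_0$, $T\ge1$, $\alpha_0>0$, set $\alpha_t=\alpha_0T^{-2/3}$, $\eta_t=(2/(t+1))^{2/3}$, $H=\lceil(1-\gamma)^{-1}\log(T+1)\rceil$. Sample $\tau_0$ of length $H$ from $\pi_{\theta_0}$ and put $d_0=g(\tau_0,\theta_0)$; put $\theta_{t+1}=\theta_t+\alpha_t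 d_t/\|d_t\|$ (and $\theta_{t+1}=\theta_t$ if $d_t=0$); for $1\le t\le T-1$ sample, given the past, $\tau_t$ of length $H$ from $\pi_{\theta_t}$, and put $d_t=\eta_tg(\tau_t,\theta_t)+(1-\eta_t)\big(d_{t-1}+g(\tau_t,\theta_t)-w(\tau_t|\theta_{t-1},\theta_t)g(\tau_t,\theta_{t-1})\big)$. The output $\bar\theta_T$ is uniform on $\{\theta_1,\dots,\theta_T\}$. \textbf{Constants.} For $H\in\mathbb N$ and $\alpha>0$, $W=\exp(HM_g^2\alpha^2)$, $C_w=(2H^2M_g^2+HM_h)(W+1)$. Further $V=\frac{M_gR}{(1-\gamma)^{3/2}}$, $L_g=\frac{2M_g^2R}{(1-\gamma)^3}+\frac{M_hR}{(1-\gamma)^2}$, $G=\frac{M_gR}{(1-\gamma)^2}$. \textbf{Theorem.} (1) For all $H\ge1$, $\alpha>0$, $\theta\in\mathbb R^d$, $u\in\mathbb R^d\setminus\{0\}$, with $\theta'=\theta+\alpha u/\|u\|$ and $\tau$ a trajectory of length $H$ sampled from $\pi_{\theta'}$: $w(\tau|\theta,\theta')$ is square integrable, $\mathbb E[w(\tau|\theta,\theta')]=1$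 and $\operatorname{Var}[w(\tau|\theta,\theta')]\le C_w\alpha^2$. Likewise, along N-VR-PG, for $1\le t\le T-1$, $\mathbb E[w(\tau_t|\theta_{t-1},\theta_t)]=1$ and $\operatorname{Var}[w(\tau_t|\theta_{t-1},\theta_t)]\le C_w\alpha_{t-1}^2$, with $C_w$ taken for $\alpha=\alpha_0T^{-2/3}$. (2) $J$ is bounded above and differentiable, and there is an absolute constant $C$ such that, with $C_w$ taken for $\alpha=\alpha_0T^{-2/3}$, $$\mathbb E\|\nabla J(\bar\theta_T)\|\le C\Big(\frac{J^\star-\mathbb E[J(\theta_1)]}{\alpha_0T^{1/3}}+\frac{V+(L_g+G\,C_w^{1/2})\alpha_0}{T^{1/3}}\Big).$$ (3) If $\alpha_0=1-\gamma$, there is a constant $C$ depending only on $M_g,M_h,R$ such that for all $T\ge1$ $$\mathbb E\|\nabla J(\bar\theta_T)\|\le\frac{C\log(T+1)}{(1-\gamma)^2T^{1/3}}.$$ (4) Consequently, with $\alpha_0=1-\gamma$ and for a constant $C$ depending only on $M_g,M_h,R$, for every $\varepsilon\in(0,1)$ there is $T\ge1$, depending only on $M_g,M_h,R,\gamma,\varepsilon$,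 such that $\mathbb E\|\nabla J(\bar\theta_T)\|\le\varepsilon$ for every such problem and every $\theta_0$, with at most $T\le C(1-\gamma)^{-6}\varepsilon^{-3}\log^3\frac{2}{(1-\gamma)\varepsilon}$ trajectories and $TH\le C(1-\gamma)^{-7}\varepsilon^{-3}\log^4\frac{2}{(1-\gamma)\varepsilon}$ state-action samples, i.e. $\tilde O(\varepsilon^{-3})$ samples. -/

import Mathlib

open MeasureTheory ProbabilityTheory
open scoped ENNReal

noncomputable section

namespace GaussianPG

/-- The Euclidean space `ℝⁿ` with its standard inner product and norm. -/
abbrev E (n : ℕ) : Type := EuclideanSpace ℝ (Fin n)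

/-- A discounted decision problem with state space `ℝ^p` and actions in a measurable set
`actions ⊆ ℝ^q` of positive Lebesgue measure (`Set.univ`, i.e. all of `ℝ^q`, is allowed),
together with the data of a Gaussian policy class: the standard deviation `σ` and the mean
`mean θ s`, for a parameter `θ ∈ ℝ^d`. -/
structure Problem (p q d : ℕ) where
  /-- the action set -/
  actions : Set (E q)
  measurableSet_actions : MeasurableSet actions
  volume_actions_pos : 0 < volume actions
  /-- transition kernel -/
  trans : Kernel (E p × E q) (E p)
  isMarkov_trans : IsMarkovKernel trans
  /-- initial state distribution -/
  init : Measure (E p)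
  isProbability_init : IsProbabilityMeasure init
  /-- reward function -/
  reward : E p × E q → ℝ
  measurable_reward : Measurable reward
  /-- standard deviation of the policy -/
  σ : ℝ
  σ_pos : 0 < σ
  /-- mean of the policy -/
  mean : E d → E p → E q
  measurable_mean : ∀ θ, Measurable (mean θ)

/-- A trajectory `(s₀, a₀, …, s_{H-1}, a_{H-1})` of length `H`. -/
abbrev Traj (p q H : ℕ) : Type := Fin H → E p × E q

namespace Problem

variable {p q d : ℕ} (M : Problem p q d)

attribute [instance] Problem.isMarkov_trans Problem.isProbability_init

/-- The unnormalized Gaussian density `exp (-‖μ_θ(s) - a‖² / (2σ²))`. -/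
def weight (θ : E d) (s : E p) (a : E q) : ℝ :=
  Real.exp (-‖M.mean θ s - a‖ ^ 2 / (2 * M.σ ^ 2))

/-- The normalizing constant over the action set; it is `(2πσ²)^(q/2)` if `actions = Set.univ`. -/
def norma (θ : E d) (s : E p) : ℝ :=
  ∫ a in M.actions, M.weight θ s a

/-- The Gaussian policy `π_θ(a|s)`, a probability density with respect to the Lebesgue measure
on the action set. -/
def policy (θ : E d) (s : E p) (a : E q) : ℝ :=
  M.weight θ s a / M.norma θ s

/-- The policy `π_θ(·|s)` as a probability kernel from states to actions. -/
def policyKernel (θ : E d) : Kernel (E p) (E q) :=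
  Kernel.withDensity (Kernel.const (E p) (volume.restrict M.actions))
    (fun s a => ENNReal.ofReal (M.policy θ s a))

lemma integrable_weight (θ : E d) (s : E p) : Integrable (M.weight θ s) := by
  have h := (GaussianFourier.integrable_cexp_neg_mul_sq_norm_add (V := E q)
    (b := ((1 / (2 * M.σ ^ 2) : ℝ) : ℂ))
    (by rw [Complex.ofReal_re]; have := M.σ_pos; positivity) 0 0).norm
  have h2 : Integrable (fun a : E q => Real.exp (-‖a‖ ^ 2 / (2 * M.σ ^ 2))) := by
    refine h.congr (Filter.Eventually.of_forall fun a => ?_)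
    have e : -((1 / (2 * M.σ ^ 2) : ℝ) : ℂ) * (‖a‖ : ℂ) ^ 2 + 0 * ((inner ℝ (0 : E q) a : ℝ) : ℂ) =
        ((-‖a‖ ^ 2 / (2 * M.σ ^ 2) : ℝ) : ℂ) := by
      push_cast; ring
    change ‖Complex.exp (-((1 / (2 * M.σ ^ 2) : ℝ) : ℂ) * (‖a‖ : ℂ) ^ 2 +
      0 * ((inner ℝ (0 : E q) a : ℝ) : ℂ))‖ = _
    rw [e, ← Complex.ofReal_exp, Complex.norm_real, Real.norm_of_nonneg (Real.exp_pos _).le]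
  have h3 := h2.comp_sub_left (M.mean θ s)
  exact h3

lemma norma_pos (θ : E d) (s : E p) : 0 < M.norma θ s := by
  unfold norma
  rw [setIntegral_pos_iff_support_of_nonneg_ae]
  · have : Function.support (M.weight θ s) = Set.univ := by
      ext a; simp [weight, Real.exp_ne_zero]
    rw [this, Set.univ_inter]
    exact M.volume_actions_pos
  · exact Filter.Eventually.of_forall fun a => (Real.exp_pos _).le
  · exact (M.integrable_weight θ s).integrableOn

lemma measurable_weight (θ : E d) : Measurable (Function.uncurry (M.weight θ)) := by
  have := M.measurable_mean θ
  unfold weight Function.uncurry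
  fun_prop

lemma measurable_policy (θ : E d) : Measurable (Function.uncurry (M.policy θ)) := by
  have h1 := M.measurable_weight θ
  have h2 : StronglyMeasurable (M.norma θ) :=
    h1.stronglyMeasurable.integral_prod_right (ν := volume.restrict M.actions)
  exact h1.div (h2.measurable.comp measurable_fst)

instance isMarkov_policyKernel (θ : E d) : IsMarkovKernel (M.policyKernel θ) := by
  refine ⟨fun s => ⟨?_⟩⟩
  have hm : Measurable (Function.uncurry fun s a => ENNReal.ofReal (M.policy θ s a)) :=
    (M.measurable_policy θ).ennreal_ofReal
  have hZ := M.norma_pos θ s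
  rw [policyKernel, Kernel.withDensity_apply' _ hm, Kernel.const_apply, Measure.restrict_univ,
    ← ofReal_integral_eq_lintegral_ofReal]
  · simp only [policy]
    rw [integral_div]
    change ENNReal.ofReal (M.norma θ s / M.norma θ s) = 1
    rw [div_self hZ.ne', ENNReal.ofReal_one]
  · exact ((M.integrable_weight θ s).integrableOn (s := M.actions)).div_const _
  · exact Filter.Eventually.of_forall fun a => div_nonneg (Real.exp_pos _).le hZ.le

/-- The law of `(s₀, a₀)`: `s₀ ∼ init`, `a₀ ∼ π_θ(·|s₀)`. -/
def initLaw (θ : E d) : Measure (E p × E q) :=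
  M.init ⊗ₘ M.policyKernel θ

instance isProbability_initLaw (θ : E d) : IsProbabilityMeasure (M.initLaw θ) := by
  unfold initLaw; infer_instance

/-- One step of the state-action chain: `s' ∼ trans (s, a)`, then `a' ∼ π_θ(·|s')`. -/
def stepKernel (θ : E d) : Kernel (E p × E q) (E p × E q) :=
  M.trans ⊗ₖ Kernel.prodMkLeft (E p × E q) (M.policyKernel θ)

instance isMarkov_stepKernel (θ : E d) : IsMarkovKernel (M.stepKernel θ) := by
  unfold stepKernel; infer_instance

/-- `stepKernel`, as a function of the whole past `(s₀, a₀), …, (s_n, a_n)`. -/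
def stepKernelPast (θ : E d) (n : ℕ) :
    Kernel ((i : Finset.Iic n) → E p × E q) (E p × E q) :=
  (M.stepKernel θ).comap (fun x => x ⟨n, Finset.mem_Iic.2 le_rfl⟩) (measurable_pi_apply _)

instance isMarkov_stepKernelPast (θ : E d) (n : ℕ) : IsMarkovKernel (M.stepKernelPast θ n) := by
  unfold stepKernelPast; infer_instance

/-- The law of the chain `(s_t, a_t)_{t ∈ ℕ}` under the policy `π_θ`. -/
def pathLaw (θ : E d) : Measure (ℕ → E p × E q) :=
  Kernel.trajMeasure (X := fun _ => E p × E q) (M.initLaw θ) (M.stepKernelPast θ)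

/-- The law of a trajectory of length `H` under the policy `π_θ`. -/
def trajLaw (H : ℕ) (θ : E d) : Measure (Traj p q H) :=
  (M.pathLaw θ).map (fun z (h : Fin H) => z h)

/-- The expected return `J(θ) = 𝔼[∑_t γ^t r(s_t, a_t)]`. -/
def J (γ : ℝ) (θ : E d) : ℝ :=
  ∫ z, ∑' t : ℕ, γ ^ t * M.reward (z t) ∂(M.pathLaw θ)

/-- The optimal value `J⋆ = sup_θ J(θ)`. -/
def Jstar (γ : ℝ) : ℝ := ⨆ θ, M.J γ θ

/-- The score `∇_θ log π_θ(a|s)`. -/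
def score (θ : E d) (s : E p) (a : E q) : E d :=
  gradient (fun θ' => Real.log (M.policy θ' s a)) θ

/-- The truncated policy gradient estimate
`g(τ, θ) = ∑_{t<H} (∑_{h=t}^{H-1} γ^h r(s_h, a_h)) ∇ log π_θ(a_t|s_t)`. -/
def gradEst (γ : ℝ) {H : ℕ} (τ : Traj p q H) (θ : E d) : E d :=
  ∑ t : Fin H, (∑ h ∈ Finset.Ici t, γ ^ (h : ℕ) * M.reward (τ h)) •
    M.score θ (τ t).1 (τ t).2

/-- The importance sampling weight `w(τ|θ', θ) = ∏_h π_θ'(a_h|s_h) / π_θ(a_h|s_h)`. -/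
def isWeight {H : ℕ} (τ : Traj p q H) (θ' θ : E d) : ℝ :=
  ∏ h : Fin H, M.policy θ' (τ h).1 (τ h).2 / M.policy θ (τ h).1 (τ h).2

/-- The regularity assumption on the policy class: `θ ↦ μ_θ(s)` is continuously differentiable
and `lμ`-Lipschitz, uniformly in `s`; `log π_θ(a|s)` is twice differentiable in `θ`, with gradient
bounded by `Mg` and Hessian bounded (in spectral norm) by `Mh`, for all parameters, states and
actions. -/
structure Regular (lμ Mg Mh : ℝ) : Prop where
  contDiff_mean : ∀ s, ContDiff ℝ 1 (fun θ => M.mean θ s)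
  lipschitz_mean : ∀ s θ θ', ‖M.mean θ s - M.mean θ' s‖ ≤ lμ * ‖θ - θ'‖
  norm_score_le : ∀ θ s, ∀ a ∈ M.actions, ‖M.score θ s a‖ ≤ Mg
  differentiable_score : ∀ s, ∀ a ∈ M.actions, Differentiable ℝ (fun θ => M.score θ s a)
  norm_hessian_le : ∀ θ s, ∀ a ∈ M.actions, ‖fderiv ℝ (fun θ' => M.score θ' s a) θ‖ ≤ Mh

/-- The reward is bounded by `R` in absolute value. -/
def RewardBound (R : ℝ) : Prop := ∀ s, ∀ a ∈ M.actions, |M.reward (s, a)| ≤ R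

/-- The normalized step `θ + α d / ‖d‖`; it leaves `θ` unchanged if `d = 0`. -/
def normalizedStep (θ : E d) (α : ℝ) (dir : E d) : E d := θ + α • (‖dir‖⁻¹ • dir)

/-- The algorithm N-VR-PG as a function of the sampled trajectories `τ₀, τ₁, …`: the pair
`(θ_t, d_t)`. Here `θ_t` depends on `τ₀, …, τ_{t-1}` only, and `d_t` on `τ₀, …, τ_t`. -/
def nvrpg (γ : ℝ) {H : ℕ} (α η : ℕ → ℝ) (θ₀ : E d) (τ : ℕ → Traj p q H) : ℕ → E d × E d
  | 0 => (θ₀, M.gradEst γ (τ 0) θ₀)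
  | t + 1 =>
    let θ := (nvrpg γ α η θ₀ τ t).1
    let dir := (nvrpg γ α η θ₀ τ t).2
    let θ' := normalizedStep θ (α t) dir
    let v := M.gradEst γ (τ (t + 1)) θ' - M.isWeight (τ (t + 1)) θ θ' • M.gradEst γ (τ (t + 1)) θ
    (θ', η (t + 1) • M.gradEst γ (τ (t + 1)) θ' + (1 - η (t + 1)) • (dir + v))

/-- The iterate `θ_t` of N-VR-PG. -/
def iterate (γ : ℝ) {H : ℕ} (α η : ℕ → ℝ) (θ₀ : E d) (τ : ℕ → Traj p q H) (t : ℕ) : E d :=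
  (M.nvrpg γ α η θ₀ τ t).1

/-- `τ₀, …, τ_{T-1}` are the trajectories sampled by N-VR-PG: given `τ₀, …, τ_{t-1}`, the
trajectory `τ_t` is drawn from the law of a trajectory of length `H` under `π_{θ_t}`. -/
structure IsRun {Ω : Type*} [MeasurableSpace Ω] (P : Measure Ω) (γ : ℝ) {H : ℕ} (T : ℕ)
    (α η : ℕ → ℝ) (θ₀ : E d) (τ : ℕ → Ω → Traj p q H) : Prop where
  measurable : ∀ t < T, Measurable (τ t)
  law : ∀ t < T, ∀ (B : Set (Fin t → Traj p q H)) (C : Set (Traj p q H)),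
    MeasurableSet B → MeasurableSet C →
    P {ω | (fun i : Fin t => τ i ω) ∈ B ∧ τ t ω ∈ C} =
      ∫⁻ ω in {ω | (fun i : Fin t => τ i ω) ∈ B},
        M.trajLaw H (M.iterate γ α η θ₀ (fun n => τ n ω) t) C ∂P

end Problem

/-- The horizon `H = (1-γ)⁻¹ log (T+1)`, rounded up to an integer. -/
def horizon (γ : ℝ) (T : ℕ) : ℕ := ⌈(1 - γ)⁻¹ * Real.log (T + 1)⌉₊

/-- The constant stepsize `α_t = α₀ / T^(2/3)`. -/
def stepsize (α₀ : ℝ) (T : ℕ) : ℝ := α₀ / (T : ℝ) ^ ((2 : ℝ) / 3)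

/-- The momentum parameter `η_t = (2 / (t+1))^(2/3)`. -/
def momentum (t : ℕ) : ℝ := (2 / ((t : ℝ) + 1)) ^ ((2 : ℝ) / 3)

/-- The iterates of N-VR-PG with horizon, stepsizes and momentum as above. -/
def Problem.θ {p q d : ℕ} (M : Problem p q d) (γ α₀ : ℝ) (T : ℕ) (θ₀ : E d) {Ω : Type*}
    (τ : ℕ → Ω → Traj p q (horizon γ T)) (t : ℕ) (ω : Ω) : E d :=
  M.iterate γ (fun _ => stepsize α₀ T) momentum θ₀ (fun n => τ n ω) t

/-- `τ₀, …, τ_{T-1}` are sampled by N-VR-PG with horizon, stepsizes and momentum as above. -/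
def Problem.IsStandardRun {p q d : ℕ} (M : Problem p q d) (γ α₀ : ℝ) (T : ℕ) (θ₀ : E d)
    {Ω : Type*} [MeasurableSpace Ω] (P : Measure Ω)
    (τ : ℕ → Ω → Traj p q (horizon γ T)) : Prop :=
  M.IsRun P γ T (fun _ => stepsize α₀ T) momentum θ₀ τ

/-- The joint law of the run and of an independent index, uniform on `{1, …, T}`. -/
def outputLaw {Ω : Type*} [MeasurableSpace Ω] (P : Measure Ω) (T : ℕ) : Measure (Ω × ℕ) :=
  P.prod (uniformOn (Set.Icc 1 T))

/-- `𝔼 ‖∇J(θ̄_T)‖`, for `θ̄_T` drawn uniformly at random from the iterates `θ₁, …, θ_T`. -/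
def Problem.outputGradNorm {p q d : ℕ} (M : Problem p q d) (γ α₀ : ℝ) (T : ℕ) (θ₀ : E d)
    {Ω : Type*} [MeasurableSpace Ω] (P : Measure Ω)
    (τ : ℕ → Ω → Traj p q (horizon γ T)) : ℝ :=
  ∫ x, ‖gradient (M.J γ) (M.θ γ α₀ T θ₀ τ x.2 x.1)‖ ∂(outputLaw P T)

/-- `V = Mg R / (1-γ)^(3/2)`. -/
def constV (γ R Mg : ℝ) : ℝ := Mg * R / (1 - γ) ^ ((3 : ℝ) / 2)

/-- `L_g = 2 Mg² R / (1-γ)³ + Mh R / (1-γ)²`. -/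
def constLg (γ R Mg Mh : ℝ) : ℝ := 2 * Mg ^ 2 * R / (1 - γ) ^ 3 + Mh * R / (1 - γ) ^ 2

/-- `G = Mg R / (1-γ)²`. -/
def constG (γ R Mg : ℝ) : ℝ := Mg * R / (1 - γ) ^ 2

/-- `W = exp (H Mg² α²)`, which bounds the second moment of the weights for stepsize `α`. -/
def constW (H : ℕ) (Mg α : ℝ) : ℝ := Real.exp (H * Mg ^ 2 * α ^ 2)

/-- `C_w = (2 H² Mg² + H Mh) (W + 1)`. -/
def constCw (H : ℕ) (Mg Mh α : ℝ) : ℝ :=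
  (2 * (H : ℝ) ^ 2 * Mg ^ 2 + H * Mh) * (constW H Mg α + 1)

end GaussianPG

end

/-!
Over one step the ratio of the policies at parameters at distance `c / Mg` has mean `1` and, by the
bound on the score, takes values in `[e⁻ᶜ, eᶜ]`. Hence its second moment is at most `exp (c²)`, and
multiplying over the steps of a trajectory gives `𝔼[w²] ≤ W`, so that `Var w ≤ W - 1 ≤ C_w α²`.

The score is bounded, so expectations over trajectories can be differentiated by the likelihood
ratio formula, and scores of different steps are orthogonal. Consequently `J` has an
`L_g`-Lipschitz gradient, `g` is an unbiased estimate of the truncated gradient `∇J_H` with second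
moment at most `V²`, and the importance-weighted difference of two consecutive estimates is unbiased
with second moment of order `α²`, because the variance of the weight is. Since the trajectory
`τ_t` is drawn given the past, the error `e_t = d_t - ∇J_H(θ_t)` satisfies
`𝔼‖e_{t+1}‖² ≤ (1 - η_{t+1}) 𝔼‖e_t‖² + 2 η_{t+1}² V² + O(α²)`, and for `η_t = (2/(t+1))^(2/3)` and
`α = α₀ T^(-2/3)` this keeps `𝔼‖e_t‖²` of order `η_t`.

A normalized step increases `J` by at least `α (‖∇J‖ - 2 ‖d_t - ∇J‖) - O(α²)`. Summing over `t`
bounds the average of `𝔼‖∇J(θ_t)‖`; the choice of `H` makes the truncation bias negligible.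
-/

namespace GaussianPG

/-! ### Smoothness and measurability of the policy -/

section GaussianWeight

variable {V : Type*} [NormedAddCommGroup V]

/-- The unnormalized isotropic Gaussian density at `a` with mean `m` and standard deviation `σ`,
as a function of `m`. `Problem.weight θ s a` is its value at `m = μ_θ(s)`. -/
noncomputable def gaussianWeight (σ : ℝ) (m a : V) : ℝ := Real.exp (-‖m - a‖ ^ 2 / (2 * σ ^ 2))

lemma continuous_gaussianWeight (σ : ℝ) (m : V) : Continuous (gaussianWeight σ m) := by
  unfold gaussianWeight
  fun_prop

/-- The factor `‖m - a‖` is absorbed by half of the exponent, `u ≤ exp (u² / 4)`, and the other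
half dominates the Gaussian of twice the width around the nearby mean `m₀`. -/
lemma norm_sub_mul_gaussianWeight_le {σ δ : ℝ} (hσ : 0 < σ) {m m₀ : V} (hm : ‖m - m₀‖ ≤ δ) (a : V) :
    ‖m - a‖ * gaussianWeight σ m a ≤
      σ * Real.exp (δ ^ 2 / (4 * σ ^ 2)) * gaussianWeight (2 * σ) m₀ a := by
  set x := ‖m - a‖
  set y := ‖m₀ - a‖
  have hy : y ^ 2 ≤ 2 * x ^ 2 + 2 * δ ^ 2 := by
    have hyx : y ≤ x + δ := by
      calc y = ‖(m - a) - (m - m₀)‖ := by rw [sub_sub_sub_cancel_left]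
        _ ≤ x + δ := (norm_sub_le _ _).trans (by gcongr)
    nlinarith [sq_nonneg (x - δ), pow_le_pow_left₀ (norm_nonneg _) hyx 2]
  have habsorb : x ≤ σ * Real.exp (x ^ 2 / (4 * σ ^ 2)) := by
    have h := Real.add_one_le_exp ((x / (2 * σ)) ^ 2)
    rw [show (x / (2 * σ)) ^ 2 = x ^ 2 / (4 * σ ^ 2) by field_simp; ring] at h
    calc x = σ * (2 * (x / (2 * σ))) := by field_simp
      _ ≤ σ * (x ^ 2 / (4 * σ ^ 2) + 1) := by
        gcongr
        rw [show x ^ 2 / (4 * σ ^ 2) = (x / (2 * σ)) ^ 2 by field_simp; ring]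
        nlinarith [sq_nonneg (x / (2 * σ) - 1)]
      _ ≤ _ := by gcongr
  have hexponent : x ^ 2 / (4 * σ ^ 2) + -x ^ 2 / (2 * σ ^ 2) ≤
      δ ^ 2 / (4 * σ ^ 2) + -y ^ 2 / (2 * (2 * σ) ^ 2) := by
    rw [← sub_nonneg]
    calc 0 ≤ (2 * x ^ 2 + 2 * δ ^ 2 - y ^ 2) / (8 * σ ^ 2) :=
          div_nonneg (by linarith) (by positivity)
      _ = _ := by field_simp; ring
  calc x * gaussianWeight σ m a
      ≤ σ * Real.exp (x ^ 2 / (4 * σ ^ 2)) * Real.exp (-x ^ 2 / (2 * σ ^ 2)) :=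
        mul_le_mul_of_nonneg_right habsorb (Real.exp_pos _).le
    _ ≤ σ * Real.exp (δ ^ 2 / (4 * σ ^ 2) + -y ^ 2 / (2 * (2 * σ) ^ 2)) := by
        rw [mul_assoc, ← Real.exp_add]
        gcongr
    _ = _ := by rw [Real.exp_add, mul_assoc]; rfl

variable [InnerProductSpace ℝ V]

lemma integrable_gaussianWeight [FiniteDimensional ℝ V] [MeasurableSpace V] [BorelSpace V]
    {σ : ℝ} (hσ : 0 < σ) (m : V) : Integrable (gaussianWeight σ m) := by
  have hcentered : Integrable fun a : V => Real.exp (-(2 * σ ^ 2)⁻¹ * ‖a‖ ^ 2) := by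
    refine (GaussianFourier.integrable_cexp_neg_mul_sq_norm_add (V := V)
      (b := (((2 * σ ^ 2)⁻¹ : ℝ) : ℂ)) ?_ 0 0).norm.congr (.of_forall fun a => ?_)
    · rw [Complex.ofReal_re]
      positivity
    · simp [Complex.norm_exp, ← Complex.ofReal_pow]
  refine (hcentered.comp_sub_left m).congr (.of_forall fun a => ?_)
  simp only [gaussianWeight]
  congr 1
  ring

lemma hasFDerivAt_gaussianWeight {σ : ℝ} (hσ : σ ≠ 0) (m a : V) :
    HasFDerivAt (fun m => gaussianWeight σ m a)
      (-(gaussianWeight σ m a / σ ^ 2) • innerSL ℝ (m - a)) m := by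
  have h := (((hasFDerivAt_id m).sub_const a).norm_sq.const_mul (-(2 * σ ^ 2)⁻¹)).exp
  have hweight (m : V) : Real.exp (-(2 * σ ^ 2)⁻¹ * ‖id m - a‖ ^ 2) = gaussianWeight σ m a := by
    simp only [gaussianWeight, id]
    congr 1
    ring
  simp only [hweight] at h
  refine h.congr_fderiv ?_
  ext v
  simp only [_root_.smul_apply, ContinuousLinearMap.comp_apply,
    ContinuousLinearMap.id_apply, innerSL_apply_apply, smul_eq_mul, id, nsmul_eq_mul]
  push_cast
  field_simp

lemma differentiable_setIntegral_gaussianWeight [FiniteDimensional ℝ V] [MeasurableSpace V]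
    [BorelSpace V] {σ : ℝ} (hσ : 0 < σ) (A : Set V) :
    Differentiable ℝ fun m : V => ∫ a in A, gaussianWeight σ m a := by
  intro m₀
  refine (hasFDerivAt_integral_of_dominated_of_fderiv_le (𝕜 := ℝ) (s := Metric.ball m₀ 1)
    (F' := fun m a => -(gaussianWeight σ m a / σ ^ 2) • innerSL ℝ (m - a))
    (bound := fun a =>
      σ⁻¹ * Real.exp (1 ^ 2 / (4 * σ ^ 2)) * gaussianWeight (2 * σ) m₀ a)
    (Metric.ball_mem_nhds _ one_pos)
    (.of_forall fun m => (integrable_gaussianWeight hσ m).integrableOn.1)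
    (integrable_gaussianWeight hσ m₀).integrableOn ?_
    (.of_forall fun a m hm => ?_)
    ((integrable_gaussianWeight (by positivity) m₀).integrableOn.const_mul _)
    (.of_forall fun a m _ => hasFDerivAt_gaussianWeight hσ.ne' m a)).differentiableAt
  · have hweight := continuous_gaussianWeight σ m₀
    have hinner : Continuous fun a : V => innerSL ℝ (m₀ - a) := by fun_prop
    exact ((hweight.div_const _).neg.smul hinner).aestronglyMeasurable
  · have hm' : ‖m - m₀‖ ≤ 1 := by
      rw [← dist_eq_norm]
      exact (Metric.mem_ball.1 hm).le
    have hpos : 0 < gaussianWeight σ m a := Real.exp_pos _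
    calc ‖-(gaussianWeight σ m a / σ ^ 2) • innerSL ℝ (m - a)‖
        = (σ ^ 2)⁻¹ * (‖m - a‖ * gaussianWeight σ m a) := by
          rw [norm_smul, innerSL_apply_norm, norm_neg, Real.norm_of_nonneg (by positivity)]
          ring
      _ ≤ (σ ^ 2)⁻¹ * (σ * Real.exp (1 ^ 2 / (4 * σ ^ 2)) * gaussianWeight (2 * σ) m₀ a) :=
          mul_le_mul_of_nonneg_left (norm_sub_mul_gaussianWeight_le hσ hm' a) (by positivity)
      _ = _ := by field_simp

end GaussianWeight

/-- The difference quotients along the coordinate axes are jointly measurable. -/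
lemma measurable_gradient_of_measurable_uncurry {ι X : Type*} [Fintype ι] [MeasurableSpace X]
    {f : EuclideanSpace ℝ ι → X → ℝ} (hf : Measurable (Function.uncurry f))
    (hdiff : ∀ x, Differentiable ℝ fun θ => f θ x) :
    Measurable fun y : EuclideanSpace ℝ ι × X => gradient (fun θ => f θ y.2) y.1 := by
  classical
  have hcoord (i : ι) : Measurable fun y : EuclideanSpace ℝ ι × X =>
      gradient (fun θ => f θ y.2) y.1 i := by
    refine measurable_of_tendsto_metrizable
      (f := fun (n : ℕ) (y : EuclideanSpace ℝ ι × X) =>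
        (n : ℝ) * (f (y.1 + (n : ℝ)⁻¹ • EuclideanSpace.single i 1) y.2 - f y.1 y.2))
      (fun n => ?_) (tendsto_pi_nhds.2 fun y => ?_)
    · have hshift : Measurable fun y : EuclideanSpace ℝ ι × X =>
          f (y.1 + (n : ℝ)⁻¹ • EuclideanSpace.single i (1 : ℝ)) y.2 :=
        hf.comp (g := Function.uncurry f)
          (f := fun y : EuclideanSpace ℝ ι × X =>
            (y.1 + (n : ℝ)⁻¹ • EuclideanSpace.single i (1 : ℝ), y.2)) (by fun_prop)
      exact (hshift.sub hf).const_mul _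
    · have h := (hdiff y.2 y.1).hasGradientAt.hasFDerivAt.lim
        (EuclideanSpace.single i (1 : ℝ)) (c := fun n : ℕ => (n : ℝ)) (l := Filter.atTop)
        (by simpa using tendsto_natCast_atTop_atTop)
      simpa only [InnerProductSpace.toDual_apply_apply, EuclideanSpace.inner_single_right, one_mul,
        conj_trivial, smul_eq_mul] using h
  exact (WithLp.measurable_toLp 2 (ι → ℝ)).comp (measurable_pi_iff.2 hcoord)

namespace Problem

variable {p q d : ℕ}

section Policy

variable (M : Problem p q d)

lemma policy_pos (θ : E d) (s : E p) (a : E q) : 0 < M.policy θ s a :=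
  div_pos (Real.exp_pos _) (M.norma_pos θ s)

lemma exp_log_policy_sub (θ θ' : E d) (s : E p) (a : E q) :
    Real.exp (Real.log (M.policy θ s a) - Real.log (M.policy θ' s a)) =
      M.policy θ s a / M.policy θ' s a := by
  rw [Real.exp_sub, Real.exp_log (M.policy_pos _ _ _), Real.exp_log (M.policy_pos _ _ _)]

lemma nonempty_actions : M.actions.Nonempty :=
  nonempty_of_measure_ne_zero M.volume_actions_pos.ne'

end Policy

namespace Regular

variable {M : Problem p q d} {lμ Mg Mh : ℝ} (hM : M.Regular lμ Mg Mh)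

include hM

lemma Mg_nonneg : 0 ≤ Mg :=
  let ⟨a, ha⟩ := M.nonempty_actions
  (norm_nonneg _).trans (hM.norm_score_le 0 0 a ha)

lemma Mh_nonneg : 0 ≤ Mh :=
  let ⟨a, ha⟩ := M.nonempty_actions
  (norm_nonneg _).trans (hM.norm_hessian_le 0 0 a ha)

lemma differentiable_mean (s : E p) : Differentiable ℝ fun θ => M.mean θ s :=
  (hM.contDiff_mean s).differentiable one_ne_zero

lemma differentiable_policy (s : E p) (a : E q) : Differentiable ℝ fun θ => M.policy θ s a := by
  have hweight : Differentiable ℝ fun θ => M.weight θ s a := fun θ =>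
    (hasFDerivAt_gaussianWeight M.σ_pos.ne' _ a).differentiableAt.comp θ
      (hM.differentiable_mean s θ)
  have hnorma : Differentiable ℝ fun θ => M.norma θ s :=
    (differentiable_setIntegral_gaussianWeight M.σ_pos M.actions).comp (hM.differentiable_mean s)
  simp only [policy, div_eq_mul_inv]
  exact hweight.mul (hnorma.inv fun θ => (M.norma_pos θ s).ne')

lemma differentiable_log_policy (s : E p) (a : E q) :
    Differentiable ℝ fun θ => Real.log (M.policy θ s a) := fun θ =>
  (hM.differentiable_policy s a θ).log (M.policy_pos θ s a).ne'

lemma hasGradientAt_log_policy (s : E p) (a : E q) (θ : E d) :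
    HasGradientAt (fun θ => Real.log (M.policy θ s a)) (M.score θ s a) θ :=
  (hM.differentiable_log_policy s a θ).hasGradientAt

lemma measurable_policy : Measurable fun x : E d × E p × E q => M.policy x.1 x.2.1 x.2.2 := by
  have hmean : Measurable fun x : E d × E p => M.mean x.1 x.2 :=
    measurable_uncurry_of_continuous_of_measurable (u := M.mean)
      (fun s => (hM.contDiff_mean s).continuous) M.measurable_mean
  have hweight : Measurable fun x : (E d × E p) × E q => M.weight x.1.1 x.1.2 x.2 := by
    unfold weight
    fun_prop
  have hnorma : Measurable fun x : E d × E p => M.norma x.1 x.2 :=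
    (hweight.stronglyMeasurable.integral_prod_right (ν := volume.restrict M.actions)).measurable
  exact (hweight.div (hnorma.comp measurable_fst)).comp
    (f := fun x : E d × E p × E q => ((x.1, x.2.1), x.2.2)) (by fun_prop)

lemma measurable_score : Measurable fun x : E d × E p × E q => M.score x.1 x.2.1 x.2.2 :=
  measurable_gradient_of_measurable_uncurry
    (f := fun θ (x : E p × E q) => Real.log (M.policy θ x.1 x.2)) hM.measurable_policy.log
    fun x => hM.differentiable_log_policy x.1 x.2

lemma abs_log_policy_sub_le (s : E p) {a : E q} (ha : a ∈ M.actions) (θ θ' : E d) :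
    |Real.log (M.policy θ' s a) - Real.log (M.policy θ s a)| ≤ Mg * ‖θ' - θ‖ := by
  refine convex_univ.norm_image_sub_le_of_norm_hasFDerivWithin_le
    (fun x _ => (hM.hasGradientAt_log_policy s a x).hasFDerivAt.hasFDerivWithinAt)
    (fun x _ => ?_) (Set.mem_univ θ) (Set.mem_univ θ')
  rw [LinearIsometryEquiv.norm_map]
  exact hM.norm_score_le x s a ha

lemma norm_score_sub_le (s : E p) {a : E q} (ha : a ∈ M.actions) (θ θ' : E d) :
    ‖M.score θ' s a - M.score θ s a‖ ≤ Mh * ‖θ' - θ‖ :=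
  convex_univ.norm_image_sub_le_of_norm_fderiv_le
    (fun x _ => hM.differentiable_score s a ha x) (fun x _ => hM.norm_hessian_le x s a ha)
    (Set.mem_univ θ) (Set.mem_univ θ')

end Regular

end Problem

/-! ### Laws of trajectories and change of measure -/

lemma exp_add_exp_neg_le (x : ℝ) : Real.exp x + Real.exp (-x) ≤ Real.exp (x ^ 2) + 1 := by
  have hcosh := Real.cosh_le_exp_half_sq x
  have hsq : Real.exp (x ^ 2) = Real.exp (x ^ 2 / 2) ^ 2 := by
    rw [← Real.exp_nat_mul]
    congr 1
    push_cast
    ring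
  rw [Real.cosh_eq] at hcosh
  nlinarith [sq_nonneg (Real.exp (x ^ 2 / 2) - 1)]

/-- Bounding the square by the chord of the parabola over `[e⁻ᶜ, eᶜ]` makes the bound linear in
`f`, whose mean is known; this gives `𝔼[f²] ≤ eᶜ + e⁻ᶜ - 1`, quadratically close to `1`. -/
lemma lintegral_sq_le_of_mem_Icc_exp {Ω : Type*} [MeasurableSpace Ω] {P : Measure Ω}
    [IsProbabilityMeasure P] {f : Ω → ℝ} (hf : Measurable f) {c : ℝ}
    (hbound : ∀ᵐ ω ∂P, f ω ∈ Set.Icc (Real.exp (-c)) (Real.exp c))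
    (hmean : ∫⁻ ω, ENNReal.ofReal (f ω) ∂P = 1) :
    ∫⁻ ω, ENNReal.ofReal (f ω ^ 2) ∂P ≤ ENNReal.ofReal (Real.exp (c ^ 2)) := by
  have hchord : ∀ᵐ ω ∂P, ENNReal.ofReal (f ω ^ 2) + 1 ≤
      ENNReal.ofReal (Real.exp c + Real.exp (-c)) * ENNReal.ofReal (f ω) := by
    filter_upwards [hbound] with ω hω
    rw [← ENNReal.ofReal_one, ← ENNReal.ofReal_add (sq_nonneg _) zero_le_one,
      ← ENNReal.ofReal_mul (by positivity)]
    have hprod : Real.exp c * Real.exp (-c) = 1 := by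
      rw [← Real.exp_add, add_neg_cancel, Real.exp_zero]
    refine ENNReal.ofReal_le_ofReal ?_
    nlinarith [mul_nonneg (sub_nonneg.2 hω.1) (sub_nonneg.2 hω.2)]
  refine (ENNReal.add_le_add_iff_right ENNReal.one_ne_top).1 ?_
  calc ∫⁻ ω, ENNReal.ofReal (f ω ^ 2) ∂P + 1
      = ∫⁻ ω, (ENNReal.ofReal (f ω ^ 2) + 1) ∂P := by
        rw [lintegral_add_right _ measurable_const, lintegral_one, measure_univ]
    _ ≤ ENNReal.ofReal (Real.exp c + Real.exp (-c)) := by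
        refine (lintegral_mono_ae hchord).trans_eq ?_
        rw [lintegral_const_mul _ hf.ennreal_ofReal, hmean, mul_one]
    _ ≤ ENNReal.ofReal (Real.exp (c ^ 2)) + 1 := by
        rw [← ENNReal.ofReal_one, ← ENNReal.ofReal_add (Real.exp_pos _).le zero_le_one]
        exact ENNReal.ofReal_le_ofReal (exp_add_exp_neg_le c)

namespace Problem

section Law

variable {p q d : ℕ} (M : Problem p q d)

lemma policyKernel_apply (θ : E d) (s : E p) :
    M.policyKernel θ s =
      (volume.restrict M.actions).withDensity fun a => ENNReal.ofReal (M.policy θ s a) := by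
  rw [policyKernel, Kernel.withDensity_apply _ (M.measurable_policy θ).ennreal_ofReal,
    Kernel.const_apply]

lemma ae_policyKernel_mem_actions (θ : E d) (s : E p) :
    ∀ᵐ a ∂M.policyKernel θ s, a ∈ M.actions := by
  rw [policyKernel_apply]
  exact (withDensity_absolutelyContinuous _ _).ae_le (ae_restrict_mem M.measurableSet_actions)

/-- The likelihood ratio `π_θ'(a|s) / π_θ(a|s)` of a single state-action pair `(s, a)`. -/
noncomputable def policyRatio (θ' θ : E d) (x : E p × E q) : ℝ :=
  M.policy θ' x.1 x.2 / M.policy θ x.1 x.2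

lemma policyRatio_pos (θ' θ : E d) (x : E p × E q) : 0 < M.policyRatio θ' θ x :=
  div_pos (M.policy_pos ..) (M.policy_pos ..)

lemma measurable_policyRatio (θ' θ : E d) : Measurable (M.policyRatio θ' θ) :=
  (M.measurable_policy θ').div (M.measurable_policy θ)

lemma policyKernel_eq_withDensity (θ' θ : E d) :
    M.policyKernel θ' = (M.policyKernel θ).withDensity fun s a =>
      ENNReal.ofReal (M.policyRatio θ' θ (s, a)) := by
  have hratio := (M.measurable_policyRatio θ' θ).ennreal_ofReal
  ext1 s
  have hratio' : Measurable fun a => ENNReal.ofReal (M.policyRatio θ' θ (s, a)) :=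
    hratio.comp measurable_prodMk_left
  have hpolicy : Measurable fun a => ENNReal.ofReal (M.policy θ s a) :=
    (M.measurable_policy θ).of_uncurry_left.ennreal_ofReal
  have hmul : (fun a => ENNReal.ofReal (M.policy θ' s a)) =
      (fun a => ENNReal.ofReal (M.policy θ s a)) *
        fun a => ENNReal.ofReal (M.policyRatio θ' θ (s, a)) := by
    funext a
    rw [Pi.mul_apply, ← ENNReal.ofReal_mul (M.policy_pos _ _ _).le, policyRatio,
      mul_div_cancel₀ _ (M.policy_pos _ _ _).ne']
  rw [Kernel.withDensity_apply _ hratio, policyKernel_apply, policyKernel_apply, hmul,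
    withDensity_mul _ hpolicy hratio']

/-- The conditional law of the state `s_n` given a trajectory of length `n`. -/
noncomputable def nextStateKernel : (n : ℕ) → Kernel (Traj p q n) (E p)
  | 0 => Kernel.const _ M.init
  | n + 1 => M.trans.comap (fun τ => τ (Fin.last n)) (measurable_pi_apply _)

instance isMarkov_nextStateKernel (n : ℕ) : IsMarkovKernel (M.nextStateKernel n) := by
  cases n <;> unfold nextStateKernel <;> infer_instance

/-- The conditional law of the pair `(s_n, a_n)` given a trajectory of length `n`, if the action
follows `π_θ`. -/
noncomputable def nextKernel (θ : E d) (n : ℕ) : Kernel (Traj p q n) (E p × E q) :=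
  M.nextStateKernel n ⊗ₖ Kernel.prodMkLeft _ (M.policyKernel θ)

instance isMarkov_nextKernel (θ : E d) (n : ℕ) : IsMarkovKernel (M.nextKernel θ n) := by
  unfold nextKernel
  infer_instance

lemma nextKernel_apply (θ : E d) {n : ℕ} (τ : Traj p q n) :
    M.nextKernel θ n τ = M.nextStateKernel n τ ⊗ₘ M.policyKernel θ := by
  rw [nextKernel, Kernel.compProd_apply_eq_compProd_sectR]
  rfl

lemma nextKernel_zero (θ : E d) : M.nextKernel θ 0 = Kernel.const _ (M.initLaw θ) := by
  ext1 τ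
  rw [nextKernel_apply]
  rfl

lemma nextKernel_succ (θ : E d) (n : ℕ) :
    M.nextKernel θ (n + 1) =
      (M.stepKernel θ).comap (fun τ => τ (Fin.last n)) (measurable_pi_apply _) := by
  ext1 τ
  rw [nextKernel_apply, Kernel.comap_apply, stepKernel, Kernel.compProd_apply_eq_compProd_sectR]
  rfl

lemma nextKernel_eq_withDensity (θ' θ : E d) {n : ℕ} (τ : Traj p q n) :
    M.nextKernel θ' n τ =
      (M.nextKernel θ n τ).withDensity fun x => ENNReal.ofReal (M.policyRatio θ' θ x) := by
  have hkernel := M.policyKernel_eq_withDensity θ' θ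
  have : IsSFiniteKernel ((M.policyKernel θ).withDensity fun s a =>
      ENNReal.ofReal (M.policyRatio θ' θ (s, a))) := hkernel ▸ inferInstance
  rw [nextKernel_apply, nextKernel_apply, hkernel,
    Measure.compProd_withDensity (M.measurable_policyRatio θ' θ).ennreal_ofReal]

lemma ae_nextKernel_mem_actions (θ : E d) {n : ℕ} (τ : Traj p q n) :
    ∀ᵐ x ∂M.nextKernel θ n τ, x.2 ∈ M.actions := by
  rw [nextKernel_apply]
  exact (Measure.ae_compProd_iff (measurable_snd M.measurableSet_actions)).2
    (.of_forall (M.ae_policyKernel_mem_actions θ))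

instance isProbability_pathLaw (θ : E d) : IsProbabilityMeasure (M.pathLaw θ) := by
  unfold pathLaw
  infer_instance

lemma measurable_restrict_path (n : ℕ) :
    Measurable fun (z : ℕ → E p × E q) (h : Fin n) => z h :=
  measurable_pi_lambda _ fun _ => measurable_pi_apply _

instance isProbability_trajLaw (n : ℕ) (θ : E d) : IsProbabilityMeasure (M.trajLaw n θ) :=
  Measure.isProbabilityMeasure_map (measurable_restrict_path n).aemeasurable

lemma trajLaw_zero (θ : E d) : M.trajLaw 0 θ = Measure.dirac default := by
  have hrestrict : (fun (z : ℕ → E p × E q) (h : Fin 0) => z h) = fun _ => default :=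
    Subsingleton.elim _ _
  rw [trajLaw, hrestrict, Measure.map_const, measure_univ, one_smul]

lemma pathLaw_map_zero (θ : E d) : (M.pathLaw θ).map (fun z => z 0) = M.initLaw θ := by
  have hrestrict : (fun z : ℕ → E p × E q => z 0) =
      (fun y : (i : Finset.Iic 0) → E p × E q => y ⟨0, by simp⟩) ∘
        Preorder.frestrictLe (π := fun _ => E p × E q) 0 := rfl
  rw [pathLaw, Kernel.trajMeasure, hrestrict,
    ← Measure.map_map (measurable_pi_apply _) (by fun_prop), Measure.map_comp _ _ (by fun_prop),
    Kernel.traj_map_frestrictLe, Kernel.partialTraj_self, Measure.id_comp,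
    Measure.map_map (measurable_pi_apply _) (by fun_prop)]
  exact Measure.map_id

lemma pathLaw_map_restrict_prodMk (θ : E d) (n : ℕ) :
    (M.pathLaw θ).map (fun z => ((fun h : Fin n => z h), z n)) =
      M.trajLaw n θ ⊗ₘ M.nextKernel θ n := by
  cases n with
  | zero =>
    rw [nextKernel_zero, Measure.compProd_const, trajLaw_zero, Measure.dirac_prod,
      ← M.pathLaw_map_zero, Measure.map_map (by fun_prop) (by fun_prop)]
    congr 1 with z : 1
    exact Prod.ext (Subsingleton.elim _ _) rfl
  | succ n =>
    let toTraj (y : (i : Finset.Iic n) → E p × E q) : Traj p q (n + 1) := fun i =>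
      y ⟨i, Finset.mem_Iic.2 (Nat.lt_succ_iff.1 i.2)⟩
    have htoTraj : Measurable toTraj := measurable_pi_lambda _ fun _ => measurable_pi_apply _
    have hlaw : M.trajLaw (n + 1) θ =
        ((M.pathLaw θ).map (Preorder.frestrictLe (π := fun _ => E p × E q) n)).map toTraj := by
      rw [Measure.map_map htoTraj (by fun_prop)]
      rfl
    have hpair : (fun z : ℕ → E p × E q => ((fun h : Fin (n + 1) => z h), z (n + 1))) =
        Prod.map toTraj id ∘
          fun z => (Preorder.frestrictLe (π := fun _ => E p × E q) n z, z (n + 1)) := rfl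
    rw [hpair, ← Measure.map_map (htoTraj.prodMap measurable_id) (by fun_prop), hlaw, pathLaw,
      ← Kernel.map_frestrictLe_trajMeasure_compProd_eq_map_trajMeasure]
    have : IsProbabilityMeasure ((Kernel.trajMeasure (X := fun _ => E p × E q) (M.initLaw θ)
        (M.stepKernelPast θ)).map (Preorder.frestrictLe (π := fun _ => E p × E q) n)) :=
      Measure.isProbabilityMeasure_map (by fun_prop)
    ext S hS
    rw [Measure.map_apply (htoTraj.prodMap measurable_id) hS, Measure.compProd_apply hS,
      Measure.compProd_apply (htoTraj.prodMap measurable_id hS),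
      lintegral_map (Kernel.measurable_kernel_prodMk_left hS) htoTraj, nextKernel_succ]
    rfl

/-- A trajectory continued by a state-action pair. -/
def extend {n : ℕ} (τ : Traj p q n) (x : E p × E q) : Traj p q (n + 1) :=
  Fin.snoc (α := fun _ => E p × E q) τ x

@[simp] lemma extend_castSucc {n : ℕ} (τ : Traj p q n) (x : E p × E q) (i : Fin n) :
    extend τ x i.castSucc = τ i := Fin.snoc_castSucc ..

@[simp] lemma extend_last {n : ℕ} (τ : Traj p q n) (x : E p × E q) :
    extend τ x (Fin.last n) = x := Fin.snoc_last ..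

lemma measurable_extend (n : ℕ) :
    Measurable fun y : Traj p q n × E p × E q => extend y.1 y.2 := by
  refine measurable_pi_lambda _ fun i => ?_
  refine Fin.lastCases ?_ (fun i => ?_) i
  · simpa only [extend_last] using measurable_snd
  · simp only [extend_castSucc]
    exact (measurable_pi_apply i).comp measurable_fst

lemma trajLaw_succ (θ : E d) (n : ℕ) :
    M.trajLaw (n + 1) θ =
      (M.trajLaw n θ ⊗ₘ M.nextKernel θ n).map fun y => extend y.1 y.2 := by
  rw [← pathLaw_map_restrict_prodMk, Measure.map_map (measurable_extend n)
    ((measurable_restrict_path n).prodMk (measurable_pi_apply n)), trajLaw]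
  congr 1 with z i : 2
  refine Fin.lastCases ?_ (fun i => ?_) i <;> simp

lemma lintegral_trajLaw_succ (θ : E d) (n : ℕ) {F : Traj p q (n + 1) → ℝ≥0∞}
    (hF : Measurable F) :
    ∫⁻ τ, F τ ∂M.trajLaw (n + 1) θ =
      ∫⁻ τ, ∫⁻ x, F (extend τ x) ∂M.nextKernel θ n τ ∂M.trajLaw n θ := by
  rw [trajLaw_succ, lintegral_map hF (measurable_extend n)]
  exact Measure.lintegral_compProd (hF.comp (measurable_extend n))

lemma integral_trajLaw {F : Type*} [NormedAddCommGroup F] [NormedSpace ℝ F] {n : ℕ} (θ : E d)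
    {f : Traj p q n → F} (hf : AEStronglyMeasurable f (M.trajLaw n θ)) :
    ∫ τ, f τ ∂M.trajLaw n θ = ∫ z, f (fun h => z h) ∂M.pathLaw θ :=
  integral_map (measurable_restrict_path n).aemeasurable hf

lemma ae_pathLaw_mem_actions (θ : E d) : ∀ᵐ z ∂M.pathLaw θ, ∀ t, (z t).2 ∈ M.actions := by
  refine ae_all_iff.2 fun t => ?_
  have hpair : ∀ᵐ y ∂(M.pathLaw θ).map (fun z => ((fun h : Fin t => z h), z t)),
      y.2.2 ∈ M.actions := by
    rw [pathLaw_map_restrict_prodMk]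
    exact (Measure.ae_compProd_iff ((measurable_snd.comp measurable_snd)
      M.measurableSet_actions)).2 (.of_forall fun τ => M.ae_nextKernel_mem_actions θ τ)
  exact ae_of_ae_map
    ((measurable_restrict_path t).prodMk (measurable_pi_apply t)).aemeasurable hpair

/-- A trajectory all of whose actions lie in the action set. Only for such trajectories does
`Regular` bound the scores. -/
def Admissible {n : ℕ} (τ : Traj p q n) : Prop := ∀ h, (τ h).2 ∈ M.actions

lemma ae_admissible (n : ℕ) (θ : E d) : ∀ᵐ τ ∂M.trajLaw n θ, M.Admissible τ := by
  have hmeas : MeasurableSet {τ : Traj p q n | M.Admissible τ} := by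
    simp only [Admissible, Set.ofPred_forall]
    exact MeasurableSet.iInter fun h => (measurable_pi_apply h).snd M.measurableSet_actions
  rw [trajLaw, ae_map_iff (measurable_restrict_path n).aemeasurable hmeas]
  filter_upwards [M.ae_pathLaw_mem_actions θ] with z hz h using hz h

lemma isWeight_extend {n : ℕ} (τ : Traj p q n) (x : E p × E q) (θ' θ : E d) :
    M.isWeight (extend τ x) θ' θ = M.isWeight τ θ' θ * M.policyRatio θ' θ x := by
  simp only [isWeight, policyRatio, Fin.prod_univ_castSucc, extend_castSucc, extend_last]

lemma isWeight_pos {n : ℕ} (τ : Traj p q n) (θ' θ : E d) : 0 < M.isWeight τ θ' θ :=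
  Finset.prod_pos fun _ _ => M.policyRatio_pos _ _ _

lemma isWeight_self {n : ℕ} (τ : Traj p q n) (θ : E d) : M.isWeight τ θ θ = 1 :=
  Finset.prod_eq_one fun _ _ => div_self (M.policy_pos _ _ _).ne'

lemma measurable_isWeight {n : ℕ} (θ' θ : E d) :
    Measurable fun τ : Traj p q n => M.isWeight τ θ' θ :=
  Finset.measurable_prod _ fun i _ =>
    (M.measurable_policyRatio θ' θ).comp (measurable_pi_apply i)

lemma trajLaw_eq_withDensity (n : ℕ) (θ θ' : E d) :
    M.trajLaw n θ = (M.trajLaw n θ').withDensity fun τ => ENNReal.ofReal (M.isWeight τ θ θ') := by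
  have hweight (n : ℕ) := (M.measurable_isWeight (n := n) θ θ').ennreal_ofReal
  induction n with
  | zero => simp [trajLaw_zero, isWeight]
  | succ n ih =>
    refine Measure.ext_of_lintegral _ fun F hF => ?_
    have hext : Measurable fun y : Traj p q n × E p × E q => F (extend y.1 y.2) :=
      hF.comp (measurable_extend n)
    rw [lintegral_withDensity_eq_lintegral_mul _ (hweight _) hF, M.lintegral_trajLaw_succ _ _ hF,
      M.lintegral_trajLaw_succ _ _ ((hweight _).mul hF), ih,
      lintegral_withDensity_eq_lintegral_mul _ (hweight n) hext.lintegral_kernel_prod_right']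
    refine lintegral_congr fun τ => ?_
    have hratio := (M.measurable_policyRatio θ θ').ennreal_ofReal
    have hnext : Measurable fun x => F (extend τ x) := hext.comp measurable_prodMk_left
    rw [Pi.mul_apply, M.nextKernel_eq_withDensity θ θ',
      lintegral_withDensity_eq_lintegral_mul _ hratio hnext,
      ← lintegral_const_mul _ (hratio.mul hnext)]
    refine lintegral_congr fun x => ?_
    simp only [Pi.mul_apply, isWeight_extend, ENNReal.ofReal_mul (M.isWeight_pos _ _ _).le,
      mul_assoc]

lemma integral_trajLaw_eq_integral_isWeight_smul {F : Type*} [NormedAddCommGroup F]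
    [NormedSpace ℝ F] (n : ℕ) (θ θ' : E d) (f : Traj p q n → F) :
    ∫ τ, f τ ∂M.trajLaw n θ = ∫ τ, M.isWeight τ θ θ' • f τ ∂M.trajLaw n θ' := by
  rw [M.trajLaw_eq_withDensity n θ θ', integral_withDensity_eq_integral_toReal_smul
    (M.measurable_isWeight θ θ').ennreal_ofReal (.of_forall fun _ => ENNReal.ofReal_lt_top)]
  simp only [ENNReal.toReal_ofReal (M.isWeight_pos _ _ _).le]

lemma integral_isWeight (n : ℕ) (θ θ' : E d) :
    ∫ τ, M.isWeight τ θ θ' ∂M.trajLaw n θ' = 1 := by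
  simpa using (M.integral_trajLaw_eq_integral_isWeight_smul n θ θ' fun _ => (1 : ℝ)).symm

lemma integrable_isWeight (n : ℕ) (θ θ' : E d) :
    Integrable (fun τ => M.isWeight τ θ θ') (M.trajLaw n θ') :=
  .of_integral_ne_zero (by rw [M.integral_isWeight n θ θ']; exact one_ne_zero)

end Law

namespace Regular

variable {p q d : ℕ} {M : Problem p q d} {lμ Mg Mh : ℝ} (hM : M.Regular lμ Mg Mh)

include hM

lemma measurable_isWeight {n : ℕ} :
    Measurable fun y : Traj p q n × E d × E d => M.isWeight y.1 y.2.1 y.2.2 := by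
  refine Finset.measurable_prod _ fun i _ => ?_
  have hnum := hM.measurable_policy.comp
    (f := fun y : Traj p q n × E d × E d => (y.2.1, y.1 i)) (by fun_prop)
  have hden := hM.measurable_policy.comp
    (f := fun y : Traj p q n × E d × E d => (y.2.2, y.1 i)) (by fun_prop)
  exact hnum.div hden

lemma policyRatio_mem_Icc (θ θ' : E d) {x : E p × E q} (hx : x.2 ∈ M.actions) :
    M.policyRatio θ θ' x ∈
      Set.Icc (Real.exp (-(Mg * ‖θ - θ'‖))) (Real.exp (Mg * ‖θ - θ'‖)) := by
  have hlog := abs_le.1 (hM.abs_log_policy_sub_le x.1 hx θ' θ)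
  rw [policyRatio, ← exp_log_policy_sub]
  exact ⟨Real.exp_le_exp.2 hlog.1, Real.exp_le_exp.2 hlog.2⟩

lemma lintegral_sq_policyRatio_le (θ θ' : E d) {n : ℕ} (τ : Traj p q n) :
    ∫⁻ x, ENNReal.ofReal (M.policyRatio θ θ' x ^ 2) ∂M.nextKernel θ' n τ ≤
      ENNReal.ofReal (Real.exp ((Mg * ‖θ - θ'‖) ^ 2)) := by
  refine lintegral_sq_le_of_mem_Icc_exp (M.measurable_policyRatio θ θ')
    ((M.ae_nextKernel_mem_actions θ' τ).mono fun x hx => hM.policyRatio_mem_Icc θ θ' hx) ?_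
  rw [← setLIntegral_univ, ← withDensity_apply _ .univ, ← nextKernel_eq_withDensity, measure_univ]

lemma lintegral_sq_isWeight_le (n : ℕ) (θ θ' : E d) :
    ∫⁻ τ, ENNReal.ofReal (M.isWeight τ θ θ' ^ 2) ∂M.trajLaw n θ' ≤
      ENNReal.ofReal (Real.exp (n * Mg ^ 2 * ‖θ - θ'‖ ^ 2)) := by
  have hweight (n : ℕ) : Measurable fun τ : Traj p q n => ENNReal.ofReal (M.isWeight τ θ θ' ^ 2) :=
    ((M.measurable_isWeight θ θ').pow_const 2).ennreal_ofReal
  induction n with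
  | zero => simp [isWeight]
  | succ n ih =>
    rw [M.lintegral_trajLaw_succ _ _ (hweight _)]
    calc ∫⁻ τ, ∫⁻ x, ENNReal.ofReal (M.isWeight (extend τ x) θ θ' ^ 2) ∂M.nextKernel θ' n τ
          ∂M.trajLaw n θ'
        ≤ ∫⁻ τ, ENNReal.ofReal (M.isWeight τ θ θ' ^ 2) *
            ENNReal.ofReal (Real.exp ((Mg * ‖θ - θ'‖) ^ 2)) ∂M.trajLaw n θ' := by
          refine lintegral_mono fun τ => ?_
          simp only [isWeight_extend, mul_pow _ (M.policyRatio _ _ _),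
            ENNReal.ofReal_mul (sq_nonneg (M.isWeight τ θ θ'))]
          rw [lintegral_const_mul _ ((M.measurable_policyRatio θ θ').pow_const 2).ennreal_ofReal]
          gcongr
          exact hM.lintegral_sq_policyRatio_le θ θ' τ
      _ ≤ ENNReal.ofReal (Real.exp (n * Mg ^ 2 * ‖θ - θ'‖ ^ 2)) *
            ENNReal.ofReal (Real.exp ((Mg * ‖θ - θ'‖) ^ 2)) := by
          rw [lintegral_mul_const _ (hweight n)]
          gcongr
      _ = _ := by
          rw [← ENNReal.ofReal_mul (Real.exp_pos _).le, ← Real.exp_add]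
          congr 2
          push_cast
          ring

end Regular

end Problem

/-! ### Variance of the importance weights -/

lemma constW_sub_one_le {H : ℕ} {Mg Mh : ℝ} (hMh : 0 ≤ Mh) (α : ℝ) :
    constW H Mg α - 1 ≤ constCw H Mg Mh α * α ^ 2 := by
  unfold constCw constW
  set x := (H : ℝ) * Mg ^ 2 * α ^ 2 with hx
  have _ : 0 ≤ x := by positivity
  have hexp : Real.exp x - 1 ≤ x * Real.exp x := by
    have h := mul_le_mul_of_nonneg_right (Real.add_one_le_exp (-x)) (Real.exp_pos x).le
    rw [← Real.exp_add, neg_add_cancel, Real.exp_zero] at h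
    linarith
  have hx_le : x ≤ (2 * (H : ℝ) ^ 2 * Mg ^ 2 + H * Mh) * α ^ 2 := by
    have hH : (H : ℝ) ≤ 2 * (H : ℝ) ^ 2 := by
      have : (H : ℝ) ≤ (H : ℝ) ^ 2 := by exact_mod_cast Nat.le_self_pow two_ne_zero H
      linarith [sq_nonneg (H : ℝ)]
    calc x ≤ 2 * (H : ℝ) ^ 2 * Mg ^ 2 * α ^ 2 := by rw [hx]; gcongr
      _ ≤ _ := by gcongr; exact le_add_of_nonneg_right (by positivity)
  calc Real.exp x - 1 ≤ x * Real.exp x := hexp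
    _ ≤ ((2 * (H : ℝ) ^ 2 * Mg ^ 2 + H * Mh) * α ^ 2) * (Real.exp x + 1) := by
        gcongr
        exact le_add_of_nonneg_right zero_le_one
    _ = _ := by ring

lemma constCw_nonneg (H : ℕ) {Mg Mh : ℝ} (hMh : 0 ≤ Mh) (α : ℝ) : 0 ≤ constCw H Mg Mh α := by
  unfold constCw constW
  positivity

section SecondMoment

variable {Ω : Type*} [MeasurableSpace Ω] {P : Measure Ω} {w : Ω → ℝ} {c : ℝ}

lemma memLp_two_of_lintegral_sq_le (hw : AEMeasurable w P)
    (hsq : ∫⁻ ω, ENNReal.ofReal (w ω ^ 2) ∂P ≤ ENNReal.ofReal c) : MemLp w 2 P := by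
  rw [memLp_two_iff_integrable_sq hw.aestronglyMeasurable]
  refine ⟨(hw.pow_const 2).aestronglyMeasurable, ?_⟩
  rw [hasFiniteIntegral_iff_ofReal (.of_forall fun _ => sq_nonneg _)]
  exact hsq.trans_lt ENNReal.ofReal_lt_top

lemma integral_sq_le_of_lintegral_sq_le (hw : AEMeasurable w P) (hc : 0 ≤ c)
    (hsq : ∫⁻ ω, ENNReal.ofReal (w ω ^ 2) ∂P ≤ ENNReal.ofReal c) : ∫ ω, w ω ^ 2 ∂P ≤ c := by
  rw [integral_eq_lintegral_of_nonneg_ae (.of_forall fun _ => sq_nonneg _)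
    (hw.pow_const 2).aestronglyMeasurable]
  exact ENNReal.toReal_le_of_le_ofReal hc hsq

lemma variance_le_of_lintegral_sq_le [IsProbabilityMeasure P] (hw : AEMeasurable w P)
    (hc : 0 ≤ c) (hsq : ∫⁻ ω, ENNReal.ofReal (w ω ^ 2) ∂P ≤ ENNReal.ofReal c)
    (hmean : ∫ ω, w ω ∂P = 1) : variance w P ≤ c - 1 := by
  rw [variance_eq_sub (memLp_two_of_lintegral_sq_le hw hsq), hmean, one_pow]
  exact sub_le_sub_right (integral_sq_le_of_lintegral_sq_le hw hc hsq) 1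

end SecondMoment

lemma Problem.Regular.isWeight_moments {p q d : ℕ} {M : Problem p q d} {lμ Mg Mh : ℝ}
    (hM : M.Regular lμ Mg Mh) (H : ℕ) {θ θ' : E d} {α : ℝ} (hα : ‖θ - θ'‖ ≤ α) :
    MemLp (fun τ => M.isWeight τ θ θ') 2 (M.trajLaw H θ') ∧
      ∫ τ, M.isWeight τ θ θ' ∂(M.trajLaw H θ') = 1 ∧
      variance (fun τ => M.isWeight τ θ θ') (M.trajLaw H θ') ≤ constCw H Mg Mh α * α ^ 2 := by
  have hmeas := (M.measurable_isWeight (n := H) θ θ').aemeasurable (μ := M.trajLaw H θ')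
  have hsq : ∫⁻ τ, ENNReal.ofReal (M.isWeight τ θ θ' ^ 2) ∂M.trajLaw H θ' ≤
      ENNReal.ofReal (constW H Mg α) :=
    (hM.lintegral_sq_isWeight_le H θ θ').trans
      (ENNReal.ofReal_le_ofReal (by unfold constW; gcongr))
  have hmean := M.integral_isWeight H θ θ'
  exact ⟨memLp_two_of_lintegral_sq_le hmeas hsq, hmean,
    (variance_le_of_lintegral_sq_le hmeas (Real.exp_pos _).le hsq hmean).trans
      (constW_sub_one_le hM.Mh_nonneg α)⟩

/-! ### Derivatives of expectations with respect to the policy parameter -/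

lemma abs_exp_sub_one_le_mul (x : ℝ) : |Real.exp x - 1| ≤ |x| * (1 + Real.exp x) := by
  have hlower := Real.add_one_le_exp x
  have hupper : Real.exp x - 1 ≤ x * Real.exp x := by
    have h := mul_le_mul_of_nonneg_right (Real.add_one_le_exp (-x)) (Real.exp_pos x).le
    rw [← Real.exp_add, neg_add_cancel, Real.exp_zero] at h
    linarith
  have hmul : |x| * Real.exp x = |x * Real.exp x| := by rw [abs_mul, Real.abs_exp]
  rw [mul_add, mul_one, hmul]
  have hx := neg_abs_le x
  have hxe := le_abs_self (x * Real.exp x)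
  exact abs_le.2 ⟨by linarith [abs_nonneg (x * Real.exp x)], by linarith [abs_nonneg x]⟩

lemma integral_norm_add_sq_of_integral_inner_eq_zero {Ω F : Type*} [MeasurableSpace Ω]
    {P : Measure Ω} [NormedAddCommGroup F] [InnerProductSpace ℝ F] {X Y : Ω → F}
    (hX : MemLp X 2 P) (hY : MemLp Y 2 P) (horth : ∫ ω, inner ℝ (X ω) (Y ω) ∂P = 0) :
    ∫ ω, ‖X ω + Y ω‖ ^ 2 ∂P = ∫ ω, ‖X ω‖ ^ 2 ∂P + ∫ ω, ‖Y ω‖ ^ 2 ∂P := by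
  have hX_sq := hX.integrable_norm_pow two_ne_zero
  have hY_sq := hY.integrable_norm_pow two_ne_zero
  have hinner : Integrable (fun ω => inner ℝ (X ω) (Y ω)) P :=
    (hX_sq.add hY_sq).mono' (hX.1.inner hY.1) (.of_forall fun ω => by
      have h := norm_inner_le_norm (𝕜 := ℝ) (X ω) (Y ω)
      simp only [Pi.add_apply]
      nlinarith [sq_nonneg (‖X ω‖ - ‖Y ω‖), sq_nonneg ‖X ω‖, sq_nonneg ‖Y ω‖])
  simp only [norm_add_sq_real]
  rw [integral_add (hX_sq.fun_add (hinner.const_mul 2)) hY_sq,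
    integral_add hX_sq (hinner.const_mul 2), integral_const_mul, horth, mul_zero, add_zero]

lemma hasGradientAt_integral_of_dominated {Ω V : Type*} [MeasurableSpace Ω] {P : Measure Ω}
    [NormedAddCommGroup V] [InnerProductSpace ℝ V] [CompleteSpace V] {f : V → Ω → ℝ}
    {f' : V → Ω → V} {x₀ : V} {s : Set V} {bound : Ω → ℝ} (hs : s ∈ nhds x₀)
    (hf_meas : ∀ᶠ x in nhds x₀, AEStronglyMeasurable (f x) P) (hf_int : Integrable (f x₀) P)
    (hf'_meas : AEStronglyMeasurable (f' x₀) P)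
    (hf'_bound : ∀ᵐ ω ∂P, ∀ x ∈ s, ‖f' x ω‖ ≤ bound ω) (hbound : Integrable bound P)
    (hf' : ∀ᵐ ω ∂P, ∀ x ∈ s, HasGradientAt (fun x => f x ω) (f' x ω) x) :
    HasGradientAt (fun x => ∫ ω, f x ω ∂P) (∫ ω, f' x₀ ω ∂P) x₀ := by
  have hf'_int : Integrable (f' x₀) P :=
    hbound.mono' hf'_meas (hf'_bound.mono fun ω h => h x₀ (mem_of_mem_nhds hs))
  have hdual_meas : AEStronglyMeasurable (fun ω => InnerProductSpace.toDual ℝ V (f' x₀ ω)) P :=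
    (InnerProductSpace.toDual ℝ V).continuous.comp_aestronglyMeasurable hf'_meas
  have hdual_int : Integrable (fun ω => InnerProductSpace.toDual ℝ V (f' x₀ ω)) P :=
    hf'_int.norm.mono' hdual_meas (.of_forall fun ω => (LinearIsometryEquiv.norm_map _ _).le)
  have hdual : InnerProductSpace.toDual ℝ V (∫ ω, f' x₀ ω ∂P) =
      ∫ ω, InnerProductSpace.toDual ℝ V (f' x₀ ω) ∂P := by
    ext v
    simp only [ContinuousLinearMap.integral_apply hdual_int, InnerProductSpace.toDual_apply_apply,
      real_inner_comm v, ← integral_inner hf'_int]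
  rw [hasGradientAt_iff_hasFDerivAt, hdual]
  refine hasFDerivAt_integral_of_dominated_of_fderiv_le
    (F' := fun x ω => InnerProductSpace.toDual ℝ V (f' x ω)) hs hf_meas hf_int hdual_meas ?_ hbound
    (hf'.mono fun ω h x hx => (h x hx).hasFDerivAt)
  filter_upwards [hf'_bound] with ω h x hx
  rw [LinearIsometryEquiv.norm_map]
  exact h x hx

namespace Problem

variable {p q d : ℕ}

section ScoreSum

variable (M : Problem p q d)

/-- The score `∑ₕ ∇ log π_θ(aₕ|sₕ)` of a trajectory: the gradient of its log-likelihood. -/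
noncomputable def scoreSum {n : ℕ} (τ : Traj p q n) (θ : E d) : E d :=
  ∑ h, M.score θ (τ h).1 (τ h).2

/-- The score of the first `n` steps of an infinite path. -/
noncomputable def pathScore (n : ℕ) (z : ℕ → E p × E q) (θ : E d) : E d :=
  M.scoreSum (fun h : Fin n => z h) θ

lemma pathScore_zero (z : ℕ → E p × E q) (θ : E d) : M.pathScore 0 z θ = 0 :=
  Fin.sum_univ_zero (fun h : Fin 0 => M.score θ (z h).1 (z h).2)

lemma pathScore_succ (n : ℕ) (z : ℕ → E p × E q) (θ : E d) :
    M.pathScore (n + 1) z θ = M.pathScore n z θ + M.score θ (z n).1 (z n).2 :=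
  Fin.sum_univ_castSucc _

lemma isWeight_eq_exp_sum_log {n : ℕ} (τ : Traj p q n) (θ θ' : E d) :
    M.isWeight τ θ θ' = Real.exp (∑ h, (Real.log (M.policy θ (τ h).1 (τ h).2) -
      Real.log (M.policy θ' (τ h).1 (τ h).2))) := by
  simp only [Real.exp_sum, exp_log_policy_sub]
  rfl

lemma memLp_trajLaw_of_bound {F : Type*} [NormedAddCommGroup F] {n : ℕ} {θ : E d}
    {f : Traj p q n → F} (hf : AEStronglyMeasurable f (M.trajLaw n θ)) {B : ℝ}
    (hB : ∀ τ, M.Admissible τ → ‖f τ‖ ≤ B) (r : ℝ≥0∞) : MemLp f r (M.trajLaw n θ) :=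
  .of_bound hf B ((M.ae_admissible n θ).mono hB)

lemma memLp_pathLaw_of_bound {F : Type*} [NormedAddCommGroup F] {θ : E d}
    {f : (ℕ → E p × E q) → F} (hf : AEStronglyMeasurable f (M.pathLaw θ)) {B : ℝ}
    (hB : ∀ z : ℕ → E p × E q, (∀ t, (z t).2 ∈ M.actions) → ‖f z‖ ≤ B) (r : ℝ≥0∞) :
    MemLp f r (M.pathLaw θ) :=
  .of_bound hf B ((M.ae_pathLaw_mem_actions θ).mono hB)

lemma integrable_smul_restrict_path {F : Type*} [NormedAddCommGroup F] [NormedSpace ℝ F] {n : ℕ}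
    {Y : Traj p q n → ℝ} (hY : Measurable Y) {B : ℝ} (hB : ∀ τ, M.Admissible τ → |Y τ| ≤ B)
    {θ : E d} {f : (ℕ → E p × E q) → F} (hf : Integrable f (M.pathLaw θ)) :
    Integrable (fun z => Y (fun h => z h) • f z) (M.pathLaw θ) :=
  (hf.smul_of_top_right (M.memLp_pathLaw_of_bound
    (hY.comp (measurable_restrict_path n)).aestronglyMeasurable
    (fun _ hz => hB _ fun h => hz h) ⊤) :)

end ScoreSum

namespace Regular

variable {M : Problem p q d} {lμ Mg Mh : ℝ} (hM : M.Regular lμ Mg Mh)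

include hM

lemma measurable_scoreSum {n : ℕ} (θ : E d) : Measurable fun τ : Traj p q n => M.scoreSum τ θ :=
  Finset.measurable_fun_sum _ fun h _ =>
    hM.measurable_score.comp (f := fun τ : Traj p q n => (θ, τ h)) (by fun_prop)

section Admissible

variable {n : ℕ} {τ : Traj p q n} (hτ : M.Admissible τ)

include hτ

lemma norm_scoreSum_le (θ : E d) : ‖M.scoreSum τ θ‖ ≤ n * Mg := by
  simpa [scoreSum] using norm_sum_le_of_le Finset.univ fun h _ => hM.norm_score_le θ _ _ (hτ h)

lemma norm_scoreSum_sub_le (θ θ' : E d) :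
    ‖M.scoreSum τ θ - M.scoreSum τ θ'‖ ≤ n * (Mh * ‖θ - θ'‖) := by
  unfold scoreSum
  rw [← Finset.sum_sub_distrib]
  simpa using norm_sum_le_of_le Finset.univ fun h _ => hM.norm_score_sub_le _ (hτ h) θ' θ

lemma abs_sum_log_policy_sub_le (θ θ' : E d) :
    |∑ h, (Real.log (M.policy θ (τ h).1 (τ h).2) - Real.log (M.policy θ' (τ h).1 (τ h).2))| ≤
      n * (Mg * ‖θ - θ'‖) := by
  refine (Finset.abs_sum_le_sum_abs _ _).trans ?_
  simpa using Finset.sum_le_sum fun h (_ : h ∈ Finset.univ) =>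
    hM.abs_log_policy_sub_le (τ h).1 (hτ h) θ' θ

lemma isWeight_le_exp (θ θ' : E d) : M.isWeight τ θ θ' ≤ Real.exp (n * (Mg * ‖θ - θ'‖)) := by
  rw [isWeight_eq_exp_sum_log]
  exact Real.exp_le_exp.2 ((le_abs_self _).trans (hM.abs_sum_log_policy_sub_le hτ θ θ'))

lemma abs_isWeight_sub_one_le (θ θ' : E d) :
    |M.isWeight τ θ θ' - 1| ≤ n * (Mg * ‖θ - θ'‖) * (1 + M.isWeight τ θ θ') := by
  rw [isWeight_eq_exp_sum_log]
  exact (abs_exp_sub_one_le_mul _).trans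
    (mul_le_mul_of_nonneg_right (hM.abs_sum_log_policy_sub_le hτ θ θ') (by positivity))

lemma norm_isWeight_smul_scoreSum_le {θ θ' : E d} (hθ : ‖θ - θ'‖ ≤ 1) :
    ‖M.isWeight τ θ θ' • M.scoreSum τ θ‖ ≤ Real.exp (n * Mg) * (n * Mg) := by
  have hMg := hM.Mg_nonneg
  rw [norm_smul, Real.norm_of_nonneg (M.isWeight_pos τ θ θ').le]
  have hweight : M.isWeight τ θ θ' ≤ Real.exp (n * Mg) :=
    (hM.isWeight_le_exp hτ θ θ').trans (Real.exp_le_exp.2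
      (mul_le_mul_of_nonneg_left (mul_le_of_le_one_right hMg hθ) n.cast_nonneg))
  exact mul_le_mul hweight (hM.norm_scoreSum_le hτ θ) (norm_nonneg _) (Real.exp_pos _).le

lemma norm_scoreSum_sub_isWeight_smul_scoreSum_le (θ θ' : E d) :
    ‖M.scoreSum τ θ - M.isWeight τ θ' θ • M.scoreSum τ θ'‖ ≤
      n * (Mh * ‖θ - θ'‖) + (n * Mg) ^ 2 * ‖θ - θ'‖ * (1 + M.isWeight τ θ' θ) := by
  have hweight := hM.abs_isWeight_sub_one_le hτ θ' θ
  rw [norm_sub_rev] at hweight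
  calc ‖M.scoreSum τ θ - M.isWeight τ θ' θ • M.scoreSum τ θ'‖
      = ‖(M.scoreSum τ θ - M.scoreSum τ θ') -
          (M.isWeight τ θ' θ - 1) • M.scoreSum τ θ'‖ := by
        congr 1
        module
    _ ≤ n * (Mh * ‖θ - θ'‖) + (n * (Mg * ‖θ - θ'‖) * (1 + M.isWeight τ θ' θ)) * (n * Mg) := by
        refine (norm_sub_le _ _).trans (add_le_add (hM.norm_scoreSum_sub_le hτ θ θ') ?_)
        rw [norm_smul]
        exact mul_le_mul hweight (hM.norm_scoreSum_le hτ θ') (norm_nonneg _)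
          ((abs_nonneg _).trans hweight)
    _ = _ := by ring

end Admissible

lemma hasGradientAt_isWeight {n : ℕ} (τ : Traj p q n) (θ θ' : E d) :
    HasGradientAt (fun θ => M.isWeight τ θ θ') (M.isWeight τ θ θ' • M.scoreSum τ θ) θ := by
  have h := (HasFDerivAt.fun_sum (u := Finset.univ) fun h _ =>
    (hM.hasGradientAt_log_policy (τ h).1 (τ h).2 θ).hasFDerivAt.sub_const
      (Real.log (M.policy θ' (τ h).1 (τ h).2))).exp
  simp only [← isWeight_eq_exp_sum_log] at h
  rw [hasGradientAt_iff_hasFDerivAt, map_smul, scoreSum, map_sum]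
  exact h

lemma memLp_scoreSum {n : ℕ} (θ : E d) (r : ℝ≥0∞) :
    MemLp (fun τ => M.scoreSum τ θ) r (M.trajLaw n θ) :=
  M.memLp_trajLaw_of_bound (hM.measurable_scoreSum θ).aestronglyMeasurable
    (fun _ hτ => hM.norm_scoreSum_le hτ θ) r

section BoundedFunctional

variable {n : ℕ} {Y : Traj p q n → ℝ} (hY : Measurable Y) {B : ℝ}
  (hB : ∀ τ, M.Admissible τ → |Y τ| ≤ B)

include hY hB

lemma integrable_smul_scoreSum (θ : E d) :
    Integrable (fun τ => Y τ • M.scoreSum τ θ) (M.trajLaw n θ) :=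
  ((hM.memLp_scoreSum θ 1).integrable le_rfl).smul_of_top_right
    (M.memLp_trajLaw_of_bound hY.aestronglyMeasurable hB ⊤)

lemma hasGradientAt_integral_trajLaw (θ₀ : E d) :
    HasGradientAt (fun θ => ∫ τ, Y τ ∂M.trajLaw n θ)
      (∫ τ, Y τ • M.scoreSum τ θ₀ ∂M.trajLaw n θ₀) θ₀ := by
  have hweight (θ : E d) : Measurable fun τ : Traj p q n => M.isWeight τ θ θ₀ :=
    M.measurable_isWeight θ θ₀
  have hdiff := hasGradientAt_integral_of_dominated (P := M.trajLaw n θ₀)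
    (f := fun θ τ => M.isWeight τ θ θ₀ * Y τ)
    (f' := fun θ τ => Y τ • M.isWeight τ θ θ₀ • M.scoreSum τ θ)
    (bound := fun _ => B * (Real.exp (n * Mg) * (n * Mg)))
    (Metric.closedBall_mem_nhds θ₀ one_pos)
    (.of_forall fun θ => ((hweight θ).mul hY).aestronglyMeasurable) ?_
    (hY.smul ((hweight θ₀).smul (hM.measurable_scoreSum θ₀))).aestronglyMeasurable ?_
    (integrable_const _) ?_
  · simpa only [M.integral_trajLaw_eq_integral_isWeight_smul n _ θ₀ Y, smul_eq_mul, isWeight_self,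
      one_smul] using hdiff
  · simp only [isWeight_self, one_mul]
    exact (M.memLp_trajLaw_of_bound hY.aestronglyMeasurable hB 1).integrable le_rfl
  · filter_upwards [M.ae_admissible n θ₀] with τ hτ θ hθ
    rw [norm_smul]
    exact mul_le_mul (hB τ hτ)
      (hM.norm_isWeight_smul_scoreSum_le hτ (mem_closedBall_iff_norm.1 hθ)) (norm_nonneg _)
      ((abs_nonneg _).trans (hB τ hτ))
  · refine .of_forall fun τ θ _ => ?_
    rw [hasGradientAt_iff_hasFDerivAt, map_smul]
    exact (hM.hasGradientAt_isWeight τ θ θ₀).hasFDerivAt.mul_const (Y τ)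

lemma hasGradientAt_integral_pathLaw (θ₀ : E d) :
    HasGradientAt (fun θ => ∫ z, Y (fun h => z h) ∂M.pathLaw θ)
      (∫ z, Y (fun h => z h) • M.pathScore n z θ₀ ∂M.pathLaw θ₀) θ₀ := by
  have hdiff := hM.hasGradientAt_integral_trajLaw hY hB θ₀
  simp only [M.integral_trajLaw _ hY.aestronglyMeasurable,
    M.integral_trajLaw θ₀ (hY.fun_smul (hM.measurable_scoreSum θ₀)).aestronglyMeasurable] at hdiff
  exact hdiff

lemma norm_integral_smul_scoreSum_sub_le (θ θ' : E d) :
    ‖∫ τ, Y τ • M.scoreSum τ θ ∂M.trajLaw n θ - ∫ τ, Y τ • M.scoreSum τ θ' ∂M.trajLaw n θ'‖ ≤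
      B * (2 * n ^ 2 * Mg ^ 2 + n * Mh) * ‖θ - θ'‖ := by
  have hweight := M.integrable_isWeight n θ' θ
  have hint : Integrable (fun τ => M.isWeight τ θ' θ • Y τ • M.scoreSum τ θ') (M.trajLaw n θ) := by
    refine hweight.smul_of_top_left (M.memLp_trajLaw_of_bound (B := B * (n * Mg))
      (hY.fun_smul (hM.measurable_scoreSum θ')).aestronglyMeasurable (fun τ hτ => ?_) ⊤)
    rw [norm_smul]
    exact mul_le_mul (hB τ hτ) (hM.norm_scoreSum_le hτ θ') (norm_nonneg _)
      ((abs_nonneg _).trans (hB τ hτ))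
  have hdom : ∀ᵐ τ ∂M.trajLaw n θ,
      ‖Y τ • M.scoreSum τ θ - M.isWeight τ θ' θ • Y τ • M.scoreSum τ θ'‖ ≤
        B * (n * (Mh * ‖θ - θ'‖) + (n * Mg) ^ 2 * ‖θ - θ'‖ * (1 + M.isWeight τ θ' θ)) := by
    filter_upwards [M.ae_admissible n θ] with τ hτ
    rw [smul_comm _ (Y τ), ← smul_sub, norm_smul]
    exact mul_le_mul (hB τ hτ) (hM.norm_scoreSum_sub_isWeight_smul_scoreSum_le hτ θ θ')
      (norm_nonneg _) ((abs_nonneg _).trans (hB τ hτ))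
  have hone_add := (integrable_const (1 : ℝ)).fun_add hweight
  have hbound := ((integrable_const (n * (Mh * ‖θ - θ'‖))).fun_add
    (hone_add.const_mul ((n * Mg) ^ 2 * ‖θ - θ'‖))).const_mul B
  rw [M.integral_trajLaw_eq_integral_isWeight_smul n θ' θ,
    ← integral_sub (hM.integrable_smul_scoreSum hY hB θ) hint]
  refine (norm_integral_le_of_norm_le hbound hdom).trans_eq ?_
  rw [integral_const_mul, integral_add (integrable_const _) (hone_add.const_mul _),
    integral_const_mul ((n * Mg) ^ 2 * ‖θ - θ'‖), integral_add (integrable_const _) hweight,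
    M.integral_isWeight]
  simp only [integral_const, probReal_univ, smul_eq_mul, one_mul]
  ring

end BoundedFunctional

lemma measurable_score_path (t : ℕ) (θ : E d) :
    Measurable fun z : ℕ → E p × E q => M.score θ (z t).1 (z t).2 :=
  hM.measurable_score.comp (f := fun z : ℕ → E p × E q => (θ, z t)) (by fun_prop)

lemma measurable_pathScore (n : ℕ) (θ : E d) : Measurable fun z => M.pathScore n z θ :=
  (hM.measurable_scoreSum θ).comp (measurable_restrict_path n)

lemma memLp_score_path (t : ℕ) (θ : E d) (r : ℝ≥0∞) :
    MemLp (fun z => M.score θ (z t).1 (z t).2) r (M.pathLaw θ) :=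
  M.memLp_pathLaw_of_bound (hM.measurable_score_path t θ).aestronglyMeasurable
    (fun _ hz => hM.norm_score_le _ _ _ (hz t)) r

lemma memLp_pathScore (n : ℕ) (θ : E d) (r : ℝ≥0∞) :
    MemLp (fun z => M.pathScore n z θ) r (M.pathLaw θ) :=
  M.memLp_pathLaw_of_bound (hM.measurable_pathScore n θ).aestronglyMeasurable
    (fun _ hz => hM.norm_scoreSum_le (fun h => hz h) θ) r

/-- The expectation of `Y` does not depend on whether it is taken over `n` or `n + 1` steps, so its
gradient is `𝔼[Y • pathScore n]` as well as `𝔼[Y • pathScore (n + 1)]`. -/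
lemma integral_smul_score_eq_zero {n : ℕ} {Y : Traj p q n → ℝ} (hY : Measurable Y) {B : ℝ}
    (hB : ∀ τ, M.Admissible τ → |Y τ| ≤ B) (θ : E d) :
    ∫ z, Y (fun h => z h) • M.score θ (z n).1 (z n).2 ∂M.pathLaw θ = 0 := by
  have hY' : Measurable fun τ : Traj p q (n + 1) => Y fun h => τ h.castSucc :=
    hY.comp (measurable_pi_lambda _ fun _ => measurable_pi_apply _)
  have hgrad := hM.hasGradientAt_integral_pathLaw hY hB θ
  have hgrad' := hM.hasGradientAt_integral_pathLaw hY' (fun τ hτ => hB _ fun h => hτ h.castSucc) θ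
  simp only [Fin.val_castSucc] at hgrad'
  have hsplit : ∫ z, Y (fun h => z h) • M.pathScore (n + 1) z θ ∂M.pathLaw θ =
      ∫ z, Y (fun h => z h) • M.pathScore n z θ ∂M.pathLaw θ +
        ∫ z, Y (fun h => z h) • M.score θ (z n).1 (z n).2 ∂M.pathLaw θ := by
    simp only [pathScore_succ, smul_add]
    exact integral_add
      (M.integrable_smul_restrict_path hY hB ((hM.memLp_pathScore n θ 1).integrable le_rfl))
      (M.integrable_smul_restrict_path hY hB ((hM.memLp_score_path n θ 1).integrable le_rfl))
  exact left_eq_add.1 ((hgrad.unique hgrad').trans hsplit)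

lemma integral_inner_score_eq_zero {n : ℕ} {Y : Traj p q n → E d} (hY : Measurable Y) {B : ℝ}
    (hB : ∀ τ, M.Admissible τ → ‖Y τ‖ ≤ B) (θ : E d) :
    ∫ z, inner ℝ (Y fun h => z h) (M.score θ (z n).1 (z n).2) ∂M.pathLaw θ = 0 := by
  have hYi (i : Fin d) : Measurable fun τ => Y τ i :=
    (PiLp.continuous_apply 2 _ i).measurable.comp hY
  have hYi_le (i : Fin d) (τ : Traj p q n) (hτ : M.Admissible τ) : |Y τ i| ≤ B :=
    (PiLp.norm_apply_le _ i).trans (hB τ hτ)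
  have hint (i : Fin d) :
      Integrable (fun z => Y (fun h => z h) i • M.score θ (z n).1 (z n).2) (M.pathLaw θ) :=
    M.integrable_smul_restrict_path (hYi i) (hYi_le i)
      ((hM.memLp_score_path n θ 1).integrable le_rfl)
  have hcoord (i : Fin d) :
      ∫ z, EuclideanSpace.proj (𝕜 := ℝ) i (Y (fun h => z h) i • M.score θ (z n).1 (z n).2)
        ∂M.pathLaw θ = 0 := by
    rw [ContinuousLinearMap.integral_comp_comm _ (hint i),
      hM.integral_smul_score_eq_zero (hYi i) (hYi_le i), map_zero]
  calc ∫ z, inner ℝ (Y fun h => z h) (M.score θ (z n).1 (z n).2) ∂M.pathLaw θ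
      = ∫ z, ∑ i, EuclideanSpace.proj (𝕜 := ℝ) i (Y (fun h => z h) i • M.score θ (z n).1 (z n).2)
          ∂M.pathLaw θ := by simp [PiLp.inner_apply, mul_comm]
    _ = 0 := by
      rw [integral_finsetSum _ fun i _ => ContinuousLinearMap.integrable_comp _ (hint i)]
      exact Finset.sum_eq_zero fun i _ => hcoord i

/-- The scores of successive steps are orthogonal, hence a bound linear rather than quadratic in
the number of steps. -/
lemma integral_norm_sq_pathScore_le (n : ℕ) (θ : E d) :
    ∫ z, ‖M.pathScore n z θ‖ ^ 2 ∂M.pathLaw θ ≤ n * Mg ^ 2 := by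
  induction n with
  | zero => simp [pathScore_zero]
  | succ n ih =>
    have hscore : ∫ z, ‖M.score θ (z n).1 (z n).2‖ ^ 2 ∂M.pathLaw θ ≤ Mg ^ 2 := by
      refine (integral_mono_ae ((hM.memLp_score_path n θ 2).integrable_norm_pow two_ne_zero)
        (integrable_const (Mg ^ 2)) ((M.ae_pathLaw_mem_actions θ).mono fun z hz => ?_)).trans_eq
        (by simp)
      exact pow_le_pow_left₀ (norm_nonneg _) (hM.norm_score_le _ _ _ (hz n)) 2
    simp only [pathScore_succ]
    rw [integral_norm_add_sq_of_integral_inner_eq_zero (hM.memLp_pathScore n θ 2)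
      (hM.memLp_score_path n θ 2) (hM.integral_inner_score_eq_zero (hM.measurable_scoreSum θ)
        (fun τ hτ => hM.norm_scoreSum_le hτ θ) θ)]
    push_cast
    linarith

end Regular

end Problem

section GeometricSeries

variable {γ : ℝ} (hγ₀ : 0 ≤ γ) (hγ₁ : γ < 1)

include hγ₀ hγ₁

lemma sum_geometric_le (s : Finset ℕ) : ∑ h ∈ s, γ ^ h ≤ (1 - γ)⁻¹ :=
  sum_le_hasSum s (fun _ _ => by positivity) (hasSum_geometric_of_lt_one hγ₀ hγ₁)

lemma hasSum_geometric_mul_succ : HasSum (fun h : ℕ => γ ^ h * (h + 1)) (1 / (1 - γ) ^ 2) := by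
  simpa [mul_comm] using
    hasSum_choose_mul_geometric_of_norm_lt_one 1 (r := γ) (by rwa [Real.norm_of_nonneg hγ₀])

lemma sum_geometric_mul_succ_le (s : Finset ℕ) :
    ∑ h ∈ s, γ ^ h * ((h : ℝ) + 1) ≤ 1 / (1 - γ) ^ 2 :=
  sum_le_hasSum s (fun _ _ => by positivity) (hasSum_geometric_mul_succ hγ₀ hγ₁)

lemma hasSum_geometric_mul_succ_mul_add_two :
    HasSum (fun h : ℕ => γ ^ h * ((h + 1) * (h + 2))) (2 / (1 - γ) ^ 3) := by
  have hsum := (hasSum_choose_mul_geometric_of_norm_lt_one 2 (r := γ)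
    (by rwa [Real.norm_of_nonneg hγ₀])).mul_left 2
  rw [mul_one_div] at hsum
  refine hsum.congr_fun fun h => ?_
  rw [Nat.cast_choose_two]
  push_cast
  ring

lemma sq_sum_geometric_mul_le (s : Finset ℕ) (x : ℕ → ℝ) :
    (∑ h ∈ s, γ ^ h * x h) ^ 2 ≤ (1 - γ)⁻¹ * ∑ h ∈ s, γ ^ h * x h ^ 2 :=
  (Finset.sum_sq_le_sum_mul_sum_of_sq_le_mul _ (fun h _ => pow_nonneg hγ₀ h)
    (fun h _ => by positivity) fun h _ => le_of_eq (by ring)).trans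
    (mul_le_mul_of_nonneg_right (sum_geometric_le hγ₀ hγ₁ s)
      (Finset.sum_nonneg fun h _ => by positivity))

end GeometricSeries

lemma sqrt_add_le_sqrt_add_sqrt {a b : ℝ} (ha : 0 ≤ a) (hb : 0 ≤ b) : √(a + b) ≤ √a + √b :=
  Real.sqrt_le_iff.2 ⟨by positivity, by
    rw [add_sq, Real.sq_sqrt ha, Real.sq_sqrt hb]
    linarith [mul_nonneg (Real.sqrt_nonneg a) (Real.sqrt_nonneg b)]⟩

lemma sqrt_le_half_mul_add_inv {a c : ℝ} (hc : 0 < c) (ha : 0 ≤ a) : √a ≤ (c * a + c⁻¹) / 2 := by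
  have hsq : c * a + c⁻¹ - 2 * √a = (c * √a - 1) ^ 2 / c := by
    field_simp
    rw [sub_sq, mul_pow, Real.sq_sqrt ha]
    ring
  linarith [div_nonneg (sq_nonneg (c * √a - 1)) hc.le]

lemma sqrt_one_sub_pos {γ : ℝ} (hγ₁ : γ < 1) : 0 < √(1 - γ) := Real.sqrt_pos.2 (sub_pos.2 hγ₁)

lemma sq_sqrt_one_sub {γ : ℝ} (hγ₁ : γ < 1) : √(1 - γ) ^ 2 = 1 - γ :=
  Real.sq_sqrt (sub_pos.2 hγ₁).le

section GeometricSqrt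

variable {γ : ℝ} (hγ₀ : 0 ≤ γ) (hγ₁ : γ < 1)

include hγ₀ hγ₁

/-- The majorant is the AM-GM bound for `√(h + 1)`, balanced so that both of its terms have the
same sum. -/
lemma hasSum_geometric_sqrt_majorant :
    HasSum (fun h : ℕ => γ ^ h * ((√(1 - γ) * (h + 1) + (√(1 - γ))⁻¹) / 2))
      (1 / √(1 - γ) ^ 3) := by
  have hsqrt := sqrt_one_sub_pos hγ₁
  have hsum := ((hasSum_geometric_mul_succ hγ₀ hγ₁).mul_left (√(1 - γ) / 2)).add
    ((hasSum_geometric_of_lt_one hγ₀ hγ₁).mul_left ((√(1 - γ))⁻¹ / 2))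
  have hvalue : √(1 - γ) / 2 * (1 / (1 - γ) ^ 2) + (√(1 - γ))⁻¹ / 2 * (1 - γ)⁻¹ =
      1 / √(1 - γ) ^ 3 := by
    nth_rewrite 2 4 [← sq_sqrt_one_sub hγ₁]
    field_simp
    norm_num
  rw [hvalue] at hsum
  exact hsum.congr_fun fun h => by ring

lemma geometric_mul_sqrt_le_majorant (h : ℕ) :
    γ ^ h * √(h + 1) ≤ γ ^ h * ((√(1 - γ) * (h + 1) + (√(1 - γ))⁻¹) / 2) :=
  mul_le_mul_of_nonneg_left (sqrt_le_half_mul_add_inv (sqrt_one_sub_pos hγ₁) (by positivity))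
    (pow_nonneg hγ₀ h)

lemma summable_geometric_mul_sqrt : Summable fun h : ℕ => γ ^ h * √(h + 1) :=
  .of_nonneg_of_le (fun _ => by positivity) (geometric_mul_sqrt_le_majorant hγ₀ hγ₁)
    (hasSum_geometric_sqrt_majorant hγ₀ hγ₁).summable

lemma tsum_geometric_mul_sqrt_le : ∑' h : ℕ, γ ^ h * √(h + 1) ≤ 1 / √(1 - γ) ^ 3 :=
  (hasSum_geometric_sqrt_majorant hγ₀ hγ₁).tsum_eq ▸
    (summable_geometric_mul_sqrt hγ₀ hγ₁).tsum_le_tsum (geometric_mul_sqrt_le_majorant hγ₀ hγ₁)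
      (hasSum_geometric_sqrt_majorant hγ₀ hγ₁).summable

end GeometricSqrt

lemma constV_eq_div_sqrt_pow {γ : ℝ} (hγ₁ : γ < 1) (R Mg : ℝ) :
    constV γ R Mg = Mg * R / √(1 - γ) ^ 3 := by
  rw [constV, Real.sqrt_eq_rpow, ← Real.rpow_natCast, ← Real.rpow_mul (sub_pos.2 hγ₁).le]
  norm_num

lemma constV_nonneg {γ R Mg : ℝ} (hR : 0 ≤ R) (hMg : 0 ≤ Mg) (hγ₁ : γ < 1) :
    0 ≤ constV γ R Mg := by
  have := sub_pos.2 hγ₁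
  unfold constV
  positivity

lemma constLg_nonneg {γ R Mh : ℝ} (Mg : ℝ) (hR : 0 ≤ R) (hMh : 0 ≤ Mh) (hγ₁ : γ < 1) :
    0 ≤ constLg γ R Mg Mh := by
  have := sub_pos.2 hγ₁
  unfold constLg
  positivity

lemma constG_nonneg {R Mg : ℝ} (γ : ℝ) (hR : 0 ≤ R) (hMg : 0 ≤ Mg) : 0 ≤ constG γ R Mg := by
  unfold constG
  positivity

lemma integral_le_sqrt_integral_sq {Ω : Type*} [MeasurableSpace Ω] {P : Measure Ω}
    [IsProbabilityMeasure P] {X : Ω → ℝ} (hX : MemLp X 2 P) :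
    ∫ ω, X ω ∂P ≤ √(∫ ω, X ω ^ 2 ∂P) := by
  have hvar := variance_nonneg X P
  rw [variance_eq_sub hX] at hvar
  exact Real.le_sqrt_of_sq_le (by simpa using hvar)

namespace Problem

variable {p q d : ℕ}

section Definitions

variable (M : Problem p q d)

/-- The expected reward in step `h` under the policy `π_θ`. -/
noncomputable def stepReward (h : ℕ) (θ : E d) : ℝ := ∫ z, M.reward (z h) ∂M.pathLaw θ

/-- The gradient of the expected reward in step `h`, as given by the likelihood ratio formula. -/
noncomputable def stepGrad (h : ℕ) (θ : E d) : E d :=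
  ∫ z, M.reward (z h) • M.pathScore (h + 1) z θ ∂M.pathLaw θ

/-- The gradient of the expected return. -/
noncomputable def gradJ (γ : ℝ) (θ : E d) : E d := ∑' h : ℕ, γ ^ h • M.stepGrad h θ

/-- The gradient of the expected return truncated after `H` steps. -/
noncomputable def gradJTrunc (γ : ℝ) (H : ℕ) (θ : E d) : E d :=
  ∑ h ∈ Finset.range H, γ ^ h • M.stepGrad h θ

lemma measurable_reward_path (h : ℕ) :
    Measurable fun z : ℕ → E p × E q => M.reward (z h) :=
  M.measurable_reward.comp (measurable_pi_apply h)

lemma measurable_reward_last (h : ℕ) :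
    Measurable fun τ : Traj p q (h + 1) => M.reward (τ (Fin.last h)) :=
  M.measurable_reward.comp (measurable_pi_apply _)

lemma gradEst_eq_sum_Iic {H : ℕ} (γ : ℝ) (τ : Traj p q H) (θ : E d) :
    M.gradEst γ τ θ = ∑ h : Fin H, (γ ^ (h : ℕ) * M.reward (τ h)) •
      ∑ t ∈ Finset.Iic h, M.score θ (τ t).1 (τ t).2 := by
  simp only [gradEst, Finset.sum_smul, Finset.smul_sum]
  exact Finset.sum_comm' fun x y => by simp

lemma pathScore_eq_sum_range (n : ℕ) (z : ℕ → E p × E q) (θ : E d) :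
    M.pathScore n z θ = ∑ t ∈ Finset.range n, M.score θ (z t).1 (z t).2 :=
  (Finset.sum_range fun t => M.score θ (z t).1 (z t).2).symm

lemma gradEst_restrict_path (γ : ℝ) (H : ℕ) (z : ℕ → E p × E q) (θ : E d) :
    M.gradEst γ (fun h : Fin H => z h) θ =
      ∑ h ∈ Finset.range H, γ ^ h • M.reward (z h) • M.pathScore (h + 1) z θ := by
  rw [gradEst_eq_sum_Iic, Finset.sum_range]
  refine Finset.sum_congr rfl fun h _ => ?_
  rw [pathScore_eq_sum_range, Nat.range_succ_eq_Iic, ← Fin.map_valEmbedding_Iic, Finset.sum_map,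
    smul_smul]
  rfl

end Definitions

variable {M : Problem p q d} {lμ Mg Mh R γ : ℝ}

namespace RewardBound

variable (hR : M.RewardBound R)

include hR

lemma nonneg : 0 ≤ R :=
  M.nonempty_actions.elim fun a ha => (abs_nonneg _).trans (hR 0 a ha)

lemma abs_reward_le {x : E p × E q} (hx : x.2 ∈ M.actions) : |M.reward x| ≤ R := hR x.1 x.2 hx

lemma integrable_reward_path (h : ℕ) (θ : E d) :
    Integrable (fun z => M.reward (z h)) (M.pathLaw θ) :=
  (M.memLp_pathLaw_of_bound (M.measurable_reward_path h).aestronglyMeasurable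
    (fun _ hz => hR.abs_reward_le (hz h)) 1).integrable le_rfl

lemma integral_abs_reward_le (h : ℕ) (θ : E d) : ∫ z, |M.reward (z h)| ∂M.pathLaw θ ≤ R :=
  (integral_mono_ae (hR.integrable_reward_path h θ).abs (integrable_const R)
    ((M.ae_pathLaw_mem_actions θ).mono fun _ hz => hR.abs_reward_le (hz h))).trans_eq (by simp)

lemma norm_sum_discounted_smul_sum_Iic_le (hγ₀ : 0 ≤ γ) (hγ₁ : γ < 1) {H : ℕ} {τ : Traj p q H}
    (hτ : M.Admissible τ) {v : Fin H → E d} {B : ℝ} (hv : ∀ t, ‖v t‖ ≤ B) (hB : 0 ≤ B) :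
    ‖∑ h : Fin H, (γ ^ (h : ℕ) * M.reward (τ h)) • ∑ t ∈ Finset.Iic h, v t‖ ≤
      B * R / (1 - γ) ^ 2 := by
  have hterm (h : Fin H) : ‖(γ ^ (h : ℕ) * M.reward (τ h)) • ∑ t ∈ Finset.Iic h, v t‖ ≤
      B * R * (γ ^ (h : ℕ) * (h + 1)) := by
    have hreward : ‖M.reward (τ h)‖ ≤ R := hR.abs_reward_le (hτ h)
    have hR₀ := hR.nonneg
    have hinner : ‖∑ t ∈ Finset.Iic h, v t‖ ≤ (h + 1) * B := by
      simpa using norm_sum_le_of_le (Finset.Iic h) fun t _ => hv t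
    rw [norm_smul, norm_mul, Real.norm_of_nonneg (pow_nonneg hγ₀ _)]
    calc γ ^ (h : ℕ) * ‖M.reward (τ h)‖ * ‖∑ t ∈ Finset.Iic h, v t‖
        ≤ γ ^ (h : ℕ) * R * ((h + 1) * B) := by gcongr
      _ = _ := by ring
  refine (norm_sum_le_of_le _ fun h _ => hterm h).trans ?_
  rw [← Finset.mul_sum, ← Finset.sum_range fun h : ℕ => γ ^ h * ((h : ℝ) + 1), ← mul_one_div]
  exact mul_le_mul_of_nonneg_left (sum_geometric_mul_succ_le hγ₀ hγ₁ _)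
    (mul_nonneg hB hR.nonneg)

lemma norm_sq_gradEst_restrict_path_le (hγ₀ : 0 ≤ γ) (hγ₁ : γ < 1) (H : ℕ) {z : ℕ → E p × E q}
    (hz : ∀ t, (z t).2 ∈ M.actions) (θ : E d) :
    ‖M.gradEst γ (fun h : Fin H => z h) θ‖ ^ 2 ≤
      R ^ 2 * (1 - γ)⁻¹ * ∑ h ∈ Finset.range H, γ ^ h * ‖M.pathScore (h + 1) z θ‖ ^ 2 := by
  have hsum : ‖M.gradEst γ (fun h : Fin H => z h) θ‖ ≤
      R * ∑ h ∈ Finset.range H, γ ^ h * ‖M.pathScore (h + 1) z θ‖ := by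
    rw [gradEst_restrict_path, Finset.mul_sum]
    refine norm_sum_le_of_le _ fun h _ => ?_
    rw [norm_smul, norm_smul, Real.norm_of_nonneg (pow_nonneg hγ₀ _), mul_left_comm]
    exact mul_le_mul_of_nonneg_right (hR.abs_reward_le (hz h)) (by positivity)
  refine (pow_le_pow_left₀ (norm_nonneg _) hsum 2).trans ?_
  rw [mul_pow, mul_assoc]
  exact mul_le_mul_of_nonneg_left (sq_sum_geometric_mul_le hγ₀ hγ₁ _ _) (sq_nonneg R)

lemma hasSum_J (hγ₀ : 0 ≤ γ) (hγ₁ : γ < 1) (θ : E d) :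
    HasSum (fun h => γ ^ h * M.stepReward h θ) (M.J γ θ) := by
  have hsum := hasSum_integral_of_summable_integral_norm (μ := M.pathLaw θ)
    (F := fun (t : ℕ) (z : ℕ → E p × E q) => γ ^ t * M.reward (z t))
    (fun t => (hR.integrable_reward_path t θ).const_mul _) ?_
  · simp only [integral_const_mul] at hsum
    exact hsum
  · refine .of_nonneg_of_le (fun t => integral_nonneg fun z => norm_nonneg _) (fun t => ?_)
      ((summable_geometric_of_lt_one hγ₀ hγ₁).mul_right R)
    simp only [norm_mul, integral_const_mul, Real.norm_eq_abs, abs_of_nonneg (pow_nonneg hγ₀ t)]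
    exact mul_le_mul_of_nonneg_left (hR.integral_abs_reward_le t θ) (pow_nonneg hγ₀ t)

lemma abs_J_le (hγ₀ : 0 ≤ γ) (hγ₁ : γ < 1) (θ : E d) : |M.J γ θ| ≤ (1 - γ)⁻¹ * R := by
  refine (hR.hasSum_J hγ₀ hγ₁ θ).norm_le_of_bounded
    ((hasSum_geometric_of_lt_one hγ₀ hγ₁).mul_right R) fun h => ?_
  rw [norm_mul, Real.norm_of_nonneg (pow_nonneg hγ₀ h)]
  exact mul_le_mul_of_nonneg_left
    (abs_integral_le_integral_abs.trans (hR.integral_abs_reward_le h θ)) (pow_nonneg hγ₀ h)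

lemma bddAbove_range_J (hγ₀ : 0 ≤ γ) (hγ₁ : γ < 1) : BddAbove (Set.range (M.J γ)) :=
  ⟨(1 - γ)⁻¹ * R, Set.forall_mem_range.2 fun θ => (le_abs_self _).trans (hR.abs_J_le hγ₀ hγ₁ θ)⟩

end RewardBound

namespace Regular

variable (hM : M.Regular lμ Mg Mh)

section PathScore

include hM

lemma integral_norm_pathScore_le (n : ℕ) (θ : E d) :
    ∫ z, ‖M.pathScore n z θ‖ ∂M.pathLaw θ ≤ Mg * √n := by
  refine (integral_le_sqrt_integral_sq (hM.memLp_pathScore n θ 2).norm).trans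
    ((Real.sqrt_le_sqrt (hM.integral_norm_sq_pathScore_le n θ)).trans_eq ?_)
  rw [Real.sqrt_mul n.cast_nonneg, Real.sqrt_sq hM.Mg_nonneg, mul_comm]

lemma measurable_gradEst {H : ℕ} :
    Measurable fun y : Traj p q H × E d => M.gradEst γ y.1 y.2 := by
  refine Finset.measurable_fun_sum _ fun t _ => Measurable.fun_smul ?_ ?_
  · exact Finset.measurable_fun_sum _ fun h _ => (M.measurable_reward.comp
      ((measurable_pi_apply h).comp measurable_fst)).const_mul _
  · exact hM.measurable_score.comp (f := fun y : Traj p q H × E d => (y.2, y.1 t)) (by fun_prop)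

lemma measurable_gradEst_left {H : ℕ} (θ : E d) :
    Measurable fun τ : Traj p q H => M.gradEst γ τ θ :=
  hM.measurable_gradEst.comp (f := fun τ => (τ, θ)) (by fun_prop)

end PathScore

variable (hR : M.RewardBound R)

include hM hR

lemma hasGradientAt_stepReward (h : ℕ) (θ : E d) :
    HasGradientAt (M.stepReward h) (M.stepGrad h θ) θ :=
  hM.hasGradientAt_integral_pathLaw (M.measurable_reward_last h)
    (fun _ hτ => hR.abs_reward_le (hτ _)) θ

lemma norm_stepGrad_sub_le (h : ℕ) (θ θ' : E d) :
    ‖M.stepGrad h θ - M.stepGrad h θ'‖ ≤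
      R * (2 * ((h : ℝ) + 1) ^ 2 * Mg ^ 2 + (h + 1) * Mh) * ‖θ - θ'‖ := by
  have hstep (θ : E d) : M.stepGrad h θ =
      ∫ τ, M.reward (τ (Fin.last h)) • M.scoreSum τ θ ∂M.trajLaw (h + 1) θ :=
    (M.integral_trajLaw θ ((M.measurable_reward_last h).fun_smul
      (hM.measurable_scoreSum θ)).aestronglyMeasurable).symm
  rw [hstep, hstep]
  exact_mod_cast hM.norm_integral_smul_scoreSum_sub_le (M.measurable_reward_last h)
    (fun _ hτ => hR.abs_reward_le (hτ _)) θ θ'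

lemma integrable_reward_smul_pathScore (h : ℕ) (θ : E d) :
    Integrable (fun z => M.reward (z h) • M.pathScore (h + 1) z θ) (M.pathLaw θ) :=
  M.integrable_smul_restrict_path (M.measurable_reward_last h)
    (fun _ hτ => hR.abs_reward_le (hτ _)) ((hM.memLp_pathScore _ θ 1).integrable le_rfl)

lemma norm_stepGrad_le (h : ℕ) (θ : E d) : ‖M.stepGrad h θ‖ ≤ R * Mg * √(h + 1) := by
  have hbound : ∀ᵐ z ∂M.pathLaw θ, ‖M.reward (z h) • M.pathScore (h + 1) z θ‖ ≤
      R * ‖M.pathScore (h + 1) z θ‖ := by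
    filter_upwards [M.ae_pathLaw_mem_actions θ] with z hz
    rw [norm_smul]
    exact mul_le_mul_of_nonneg_right (hR.abs_reward_le (hz h)) (norm_nonneg _)
  refine (norm_integral_le_of_norm_le
    (((hM.memLp_pathScore _ θ 1).integrable le_rfl).norm.const_mul R) hbound).trans ?_
  rw [integral_const_mul, mul_assoc]
  exact_mod_cast mul_le_mul_of_nonneg_left (hM.integral_norm_pathScore_le (h + 1) θ) hR.nonneg

section Discounted

variable (hγ₀ : 0 ≤ γ) (hγ₁ : γ < 1)

include hγ₀

lemma norm_pow_smul_stepGrad_le (h : ℕ) (θ : E d) :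
    ‖γ ^ h • M.stepGrad h θ‖ ≤ R * Mg * (γ ^ h * √(h + 1)) := by
  rw [norm_smul, Real.norm_of_nonneg (pow_nonneg hγ₀ h), mul_left_comm]
  exact mul_le_mul_of_nonneg_left (hM.norm_stepGrad_le hR h θ) (pow_nonneg hγ₀ h)

include hγ₁

lemma summable_pow_smul_stepGrad (θ : E d) : Summable fun h => γ ^ h • M.stepGrad h θ :=
  .of_norm_bounded ((summable_geometric_mul_sqrt hγ₀ hγ₁).mul_left (R * Mg))
    fun h => hM.norm_pow_smul_stepGrad_le hR hγ₀ h θ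

lemma hasGradientAt_J (θ : E d) : HasGradientAt (M.J γ) (M.gradJ γ θ) θ := by
  have hJ : M.J γ = fun θ => ∑' h : ℕ, γ ^ h * M.stepReward h θ :=
    funext fun θ => (hR.hasSum_J hγ₀ hγ₁ θ).tsum_eq.symm
  have hderiv := hasFDerivAt_tsum (𝕜 := ℝ)
    (f := fun (h : ℕ) θ => γ ^ h * M.stepReward h θ)
    (f' := fun (h : ℕ) θ => InnerProductSpace.toDual ℝ (E d) (γ ^ h • M.stepGrad h θ))
    ((summable_geometric_mul_sqrt hγ₀ hγ₁).mul_left (R * Mg))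
    (fun h θ => ?_) (fun h θ => ?_) (hR.hasSum_J hγ₀ hγ₁ θ).summable θ
  · rw [hasGradientAt_iff_hasFDerivAt, hJ, gradJ,
      ← ((hM.summable_pow_smul_stepGrad hR hγ₀ hγ₁ θ).hasSum.map
        (InnerProductSpace.toDual ℝ (E d)) (LinearIsometryEquiv.continuous _)).tsum_eq]
    exact hderiv
  · rw [map_smul]
    exact (hM.hasGradientAt_stepReward hR h θ).hasFDerivAt.const_mul (γ ^ h)
  · rw [LinearIsometryEquiv.norm_map]
    exact hM.norm_pow_smul_stepGrad_le hR hγ₀ h θ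

lemma gradient_J (θ : E d) : gradient (M.J γ) θ = M.gradJ γ θ :=
  (hM.hasGradientAt_J hR hγ₀ hγ₁ θ).gradient

lemma norm_gradJ_le (θ : E d) : ‖M.gradJ γ θ‖ ≤ constV γ R Mg := by
  refine (tsum_of_norm_bounded ((summable_geometric_mul_sqrt hγ₀ hγ₁).hasSum.mul_left (R * Mg))
    fun h => hM.norm_pow_smul_stepGrad_le hR hγ₀ h θ).trans ?_
  rw [constV_eq_div_sqrt_pow hγ₁, mul_comm Mg, ← mul_one_div]
  exact mul_le_mul_of_nonneg_left (tsum_geometric_mul_sqrt_le hγ₀ hγ₁)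
    (mul_nonneg hR.nonneg hM.Mg_nonneg)

lemma norm_gradJ_sub_le (θ θ' : E d) :
    ‖M.gradJ γ θ - M.gradJ γ θ'‖ ≤ 2 * constLg γ R Mg Mh * ‖θ - θ'‖ := by
  have hR₀ := hR.nonneg
  have hMh := hM.Mh_nonneg
  have hsum := hM.summable_pow_smul_stepGrad hR hγ₀ hγ₁
  have hmajorant := (((hasSum_geometric_mul_succ_mul_add_two hγ₀ hγ₁).mul_left
    (2 * R * Mg ^ 2)).add ((hasSum_geometric_mul_succ hγ₀ hγ₁).mul_left (R * Mh))).mul_right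
      ‖θ - θ'‖
  rw [gradJ, gradJ, ← (hsum θ).tsum_sub (hsum θ')]
  refine (tsum_of_norm_bounded hmajorant fun h => ?_).trans
    (mul_le_mul_of_nonneg_right ?_ (norm_nonneg _))
  · rw [← smul_sub, norm_smul, Real.norm_of_nonneg (pow_nonneg hγ₀ h)]
    calc γ ^ h * ‖M.stepGrad h θ - M.stepGrad h θ'‖
        ≤ γ ^ h * (R * (2 * ((h : ℝ) + 1) ^ 2 * Mg ^ 2 + (h + 1) * Mh) * ‖θ - θ'‖) :=
          mul_le_mul_of_nonneg_left (hM.norm_stepGrad_sub_le hR h θ θ') (pow_nonneg hγ₀ h)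
      _ ≤ γ ^ h * (R * (2 * (((h : ℝ) + 1) * (h + 2)) * Mg ^ 2 + (h + 1) * Mh) * ‖θ - θ'‖) := by
          gcongr
          nlinarith [(h.cast_nonneg : (0 : ℝ) ≤ h)]
      _ = _ := by ring
  · calc 2 * R * Mg ^ 2 * (2 / (1 - γ) ^ 3) + R * Mh * (1 / (1 - γ) ^ 2)
        ≤ 2 * R * Mg ^ 2 * (2 / (1 - γ) ^ 3) + 2 * (R * Mh * (1 / (1 - γ) ^ 2)) := by
          linarith [show 0 ≤ R * Mh * (1 / (1 - γ) ^ 2) by positivity]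
      _ = _ := by
          unfold constLg
          ring

lemma le_J (θ θ' : E d) :
    M.J γ θ + inner ℝ (M.gradJ γ θ) (θ' - θ) - 2 * constLg γ R Mg Mh * ‖θ' - θ‖ ^ 2 ≤
      M.J γ θ' := by
  have hL := constLg_nonneg Mg hR.nonneg hM.Mh_nonneg hγ₁
  have htaylor := Convex.norm_image_sub_le_of_norm_hasFDerivWithin_le' (𝕜 := ℝ) (f := M.J γ)
    (f' := fun x => InnerProductSpace.toDual ℝ (E d) (M.gradJ γ x))
    (φ := InnerProductSpace.toDual ℝ (E d) (M.gradJ γ θ)) (s := segment ℝ θ θ')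
    (C := 2 * constLg γ R Mg Mh * ‖θ' - θ‖)
    (fun x _ => (hM.hasGradientAt_J hR hγ₀ hγ₁ x).hasFDerivAt.hasFDerivWithinAt)
    (fun x hx => ?_) (convex_segment _ _) (left_mem_segment ℝ θ θ') (right_mem_segment ℝ θ θ')
  · have hlower := (abs_le.1 htaylor).1
    rw [InnerProductSpace.toDual_apply_apply] at hlower
    linarith
  · rw [← map_sub, LinearIsometryEquiv.norm_map]
    exact (hM.norm_gradJ_sub_le hR hγ₀ hγ₁ x θ).trans
      (mul_le_mul_of_nonneg_left (norm_sub_le_of_mem_segment hx) (by positivity))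

lemma norm_gradJ_sub_gradJTrunc_le (H : ℕ) (θ : E d) :
    ‖M.gradJ γ θ - M.gradJTrunc γ H θ‖ ≤ constV γ R Mg * (γ ^ H * (√((1 - γ) * H) + 1)) := by
  have hR₀ := hR.nonneg
  have hMg := hM.Mg_nonneg
  have hsum := hM.summable_pow_smul_stepGrad hR hγ₀ hγ₁ θ
  have hmajorant := (((hasSum_geometric_of_lt_one hγ₀ hγ₁).mul_left √H).add
    (summable_geometric_mul_sqrt hγ₀ hγ₁).hasSum).mul_left (R * Mg * γ ^ H)
  rw [gradJ, ← hsum.sum_add_tsum_nat_add H, gradJTrunc, add_sub_cancel_left]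
  refine (tsum_of_norm_bounded hmajorant fun k => ?_).trans ?_
  · have hsqrt : √((k + H : ℕ) + 1) ≤ √H + √(k + 1) := by
      rw [Nat.cast_add, add_comm (k : ℝ), add_assoc]
      exact sqrt_add_le_sqrt_add_sqrt H.cast_nonneg (by positivity)
    calc ‖γ ^ (k + H) • M.stepGrad (k + H) θ‖
        ≤ R * Mg * (γ ^ (k + H) * √((k + H : ℕ) + 1)) :=
          hM.norm_pow_smul_stepGrad_le hR hγ₀ _ θ
      _ ≤ R * Mg * (γ ^ (k + H) * (√H + √(k + 1))) := by gcongr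
      _ = _ := by ring
  · have hsqrt := sqrt_one_sub_pos hγ₁
    calc R * Mg * γ ^ H * (√H * (1 - γ)⁻¹ + ∑' k : ℕ, γ ^ k * √(k + 1))
        ≤ R * Mg * γ ^ H * (√H * (√(1 - γ) ^ 2)⁻¹ + 1 / √(1 - γ) ^ 3) := by
          rw [sq_sqrt_one_sub hγ₁]
          gcongr
          exact tsum_geometric_mul_sqrt_le hγ₀ hγ₁
      _ = _ := by
          rw [constV_eq_div_sqrt_pow hγ₁, Real.sqrt_mul (sub_pos.2 hγ₁).le]
          field_simp

lemma norm_gradEst_le {H : ℕ} {τ : Traj p q H} (hτ : M.Admissible τ) (θ : E d) :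
    ‖M.gradEst γ τ θ‖ ≤ constG γ R Mg := by
  rw [gradEst_eq_sum_Iic]
  exact hR.norm_sum_discounted_smul_sum_Iic_le hγ₀ hγ₁ hτ
    (fun t => hM.norm_score_le _ _ _ (hτ t)) hM.Mg_nonneg

lemma norm_gradEst_sub_le {H : ℕ} {τ : Traj p q H} (hτ : M.Admissible τ) (θ θ' : E d) :
    ‖M.gradEst γ τ θ - M.gradEst γ τ θ'‖ ≤ Mh * R / (1 - γ) ^ 2 * ‖θ - θ'‖ := by
  rw [gradEst_eq_sum_Iic, gradEst_eq_sum_Iic, ← Finset.sum_sub_distrib]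
  simp only [← smul_sub, ← Finset.sum_sub_distrib]
  refine (hR.norm_sum_discounted_smul_sum_Iic_le hγ₀ hγ₁ hτ
    (fun t => hM.norm_score_sub_le _ (hτ t) θ' θ)
    (mul_nonneg hM.Mh_nonneg (norm_nonneg _))).trans_eq ?_
  ring

end Discounted

lemma integral_gradEst (H : ℕ) (θ : E d) :
    ∫ τ, M.gradEst γ τ θ ∂M.trajLaw H θ = M.gradJTrunc γ H θ := by
  rw [M.integral_trajLaw θ (hM.measurable_gradEst_left θ).aestronglyMeasurable]
  simp only [gradEst_restrict_path]
  rw [integral_finsetSum _ fun h _ =>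
    (hM.integrable_reward_smul_pathScore hR h θ).fun_smul (γ ^ h)]
  simp only [integral_smul, gradJTrunc, stepGrad]

omit hR in
lemma sum_geometric_mul_integral_norm_sq_pathScore_le (hγ₀ : 0 ≤ γ) (hγ₁ : γ < 1) (H : ℕ)
    (θ : E d) :
    ∑ h ∈ Finset.range H, γ ^ h * ∫ z, ‖M.pathScore (h + 1) z θ‖ ^ 2 ∂M.pathLaw θ ≤
      Mg ^ 2 / (1 - γ) ^ 2 := by
  calc ∑ h ∈ Finset.range H, γ ^ h * ∫ z, ‖M.pathScore (h + 1) z θ‖ ^ 2 ∂M.pathLaw θ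
      ≤ ∑ h ∈ Finset.range H, γ ^ h * (((h : ℝ) + 1) * Mg ^ 2) :=
        Finset.sum_le_sum fun h _ => mul_le_mul_of_nonneg_left
          (by exact_mod_cast hM.integral_norm_sq_pathScore_le (h + 1) θ) (pow_nonneg hγ₀ h)
    _ = Mg ^ 2 * ∑ h ∈ Finset.range H, γ ^ h * ((h : ℝ) + 1) := by
        rw [Finset.mul_sum]
        exact Finset.sum_congr rfl fun h _ => by ring
    _ ≤ _ := by
        rw [← mul_one_div]
        exact mul_le_mul_of_nonneg_left (sum_geometric_mul_succ_le hγ₀ hγ₁ _) (sq_nonneg _)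

lemma integral_norm_sq_gradEst_le (hγ₀ : 0 ≤ γ) (hγ₁ : γ < 1) (H : ℕ) (θ : E d) :
    ∫ τ, ‖M.gradEst γ τ θ‖ ^ 2 ∂M.trajLaw H θ ≤ constV γ R Mg ^ 2 := by
  have hint (h : ℕ) : Integrable (fun z => γ ^ h * ‖M.pathScore (h + 1) z θ‖ ^ 2) (M.pathLaw θ) :=
    ((hM.memLp_pathScore _ θ 2).integrable_norm_pow two_ne_zero).const_mul _
  have hsqrt := sqrt_one_sub_pos hγ₁
  rw [M.integral_trajLaw θ ((hM.measurable_gradEst_left θ).norm.pow_const 2).aestronglyMeasurable]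
  calc ∫ z, ‖M.gradEst γ (fun h : Fin H => z h) θ‖ ^ 2 ∂M.pathLaw θ
      ≤ ∫ z, R ^ 2 * (1 - γ)⁻¹ * ∑ h ∈ Finset.range H, γ ^ h * ‖M.pathScore (h + 1) z θ‖ ^ 2
          ∂M.pathLaw θ :=
        integral_mono_of_nonneg (.of_forall fun _ => by positivity)
          ((integrable_finsetSum _ fun h _ => hint h).const_mul _)
          ((M.ae_pathLaw_mem_actions θ).mono fun _ hz =>
            hR.norm_sq_gradEst_restrict_path_le hγ₀ hγ₁ H hz θ)
    _ ≤ R ^ 2 * (1 - γ)⁻¹ * (Mg ^ 2 / (1 - γ) ^ 2) := by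
        rw [integral_const_mul, integral_finsetSum _ fun h _ => hint h]
        simp only [integral_const_mul]
        exact mul_le_mul_of_nonneg_left
          (hM.sum_geometric_mul_integral_norm_sq_pathScore_le hγ₀ hγ₁ H θ)
          (mul_nonneg (sq_nonneg R) (inv_nonneg.2 (sub_pos.2 hγ₁).le))
    _ = constV γ R Mg ^ 2 := by
        rw [constV_eq_div_sqrt_pow hγ₁, ← sq_sqrt_one_sub hγ₁, Real.sqrt_sq hsqrt.le]
        field_simp

end Regular

end Problem

section SquareIntegrable

variable {Ω F : Type*} [MeasurableSpace Ω] {P : Measure Ω} [NormedAddCommGroup F] {X Y : Ω → F}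

lemma norm_add_sq_le_two_mul (x y : F) : ‖x + y‖ ^ 2 ≤ 2 * ‖x‖ ^ 2 + 2 * ‖y‖ ^ 2 := by
  rw [← mul_add]
  exact (pow_le_pow_left₀ (norm_nonneg _) (norm_add_le x y) 2).trans (add_sq_le (a := ‖x‖))

lemma integral_norm_add_sq_le_two_mul (hX : MemLp X 2 P) (hY : MemLp Y 2 P) :
    ∫ ω, ‖X ω + Y ω‖ ^ 2 ∂P ≤ 2 * ∫ ω, ‖X ω‖ ^ 2 ∂P + 2 * ∫ ω, ‖Y ω‖ ^ 2 ∂P := by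
  have hX_sq := (hX.integrable_norm_pow two_ne_zero).const_mul 2
  have hY_sq := (hY.integrable_norm_pow two_ne_zero).const_mul 2
  rw [← integral_const_mul, ← integral_const_mul, ← integral_add hX_sq hY_sq]
  exact integral_mono ((hX.add hY).integrable_norm_pow two_ne_zero) (hX_sq.add hY_sq)
    fun ω => norm_add_sq_le_two_mul (X ω) (Y ω)

lemma integral_norm_sq_add_sub_integral_le [IsProbabilityMeasure P] [InnerProductSpace ℝ F]
    [CompleteSpace F] (hX : MemLp X 2 P) (c : F) :
    ∫ ω, ‖c + (X ω - ∫ ω', X ω' ∂P)‖ ^ 2 ∂P ≤ ‖c‖ ^ 2 + ∫ ω, ‖X ω‖ ^ 2 ∂P := by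
  have hX₁ : Integrable X P := hX.integrable one_le_two
  set m := ∫ ω', X ω' ∂P
  have hinner : Integrable (fun ω => 2 * inner ℝ (c - m) (X ω)) P :=
    (hX₁.const_inner _).const_mul 2
  have hc : ‖c‖ ^ 2 = ‖c - m‖ ^ 2 + 2 * inner ℝ (c - m) m + ‖m‖ ^ 2 := by
    rw [← norm_add_sq_real, sub_add_cancel]
  calc ∫ ω, ‖c + (X ω - m)‖ ^ 2 ∂P
      = ∫ ω, (‖c - m‖ ^ 2 + 2 * inner ℝ (c - m) (X ω) + ‖X ω‖ ^ 2) ∂P := by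
        simp only [← norm_add_sq_real, ← sub_add_eq_add_sub, add_sub]
    _ = ‖c - m‖ ^ 2 + 2 * inner ℝ (c - m) m + ∫ ω, ‖X ω‖ ^ 2 ∂P := by
        rw [integral_add ((integrable_const _).fun_add hinner)
            (hX.integrable_norm_pow two_ne_zero), integral_add (integrable_const _) hinner,
          integral_const_mul, integral_inner hX₁, integral_const, probReal_univ, one_smul]
    _ ≤ ‖c‖ ^ 2 + ∫ ω, ‖X ω‖ ^ 2 ∂P := by linarith [sq_nonneg ‖m‖]

end SquareIntegrable

/-- The factor of `α ^ 2` in the bound on the second moment of `gradDiff`, when the variance of the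
importance weight is at most `Cw * α ^ 2`. -/
noncomputable def diffConst (γ R Mg Mh Cw : ℝ) : ℝ :=
  2 * (Mh * R / (1 - γ) ^ 2) ^ 2 + 2 * (constG γ R Mg ^ 2 * Cw)

namespace Problem

variable {p q d : ℕ}

section Definitions

variable (M : Problem p q d)

/-- The importance-weighted difference `g(τ, θ') - w(τ|θ, θ') g(τ, θ)`, which for `τ` drawn under
`θ'` is an unbiased estimate of the change from `θ` to `θ'` of the truncated gradient. -/
noncomputable def gradDiff (γ : ℝ) {H : ℕ} (τ : Traj p q H) (θ θ' : E d) : E d :=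
  M.gradEst γ τ θ' - M.isWeight τ θ θ' • M.gradEst γ τ θ

/-- The part of the new direction which depends on the sampled trajectory. -/
noncomputable def dirNoise (γ η : ℝ) {H : ℕ} (τ : Traj p q H) (θ θ' : E d) : E d :=
  η • M.gradEst γ τ θ' + (1 - η) • M.gradDiff γ τ θ θ'

lemma gradDiff_eq_add (γ : ℝ) {H : ℕ} (τ : Traj p q H) (θ θ' : E d) :
    M.gradDiff γ τ θ θ' =
      (M.gradEst γ τ θ' - M.gradEst γ τ θ) + (1 - M.isWeight τ θ θ') • M.gradEst γ τ θ := by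
  unfold gradDiff
  module

/-- The direction at `θ'` computed from the direction `dir` at the previous iterate `θ`. -/
noncomputable def nextDir (γ η : ℝ) {H : ℕ} (θ θ' dir : E d) (τ : Traj p q H) : E d :=
  η • M.gradEst γ τ θ' + (1 - η) • (dir + M.gradDiff γ τ θ θ')

end Definitions

namespace Regular

variable {M : Problem p q d} {lμ Mg Mh R γ : ℝ} (hM : M.Regular lμ Mg Mh)

include hM

lemma measurable_gradDiff {H : ℕ} :
    Measurable fun y : Traj p q H × E d × E d => M.gradDiff γ y.1 y.2.1 y.2.2 := by
  have hnew := (hM.measurable_gradEst (γ := γ) (H := H)).comp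
    (f := fun y : Traj p q H × E d × E d => (y.1, y.2.2)) (by fun_prop)
  have hold := (hM.measurable_gradEst (γ := γ) (H := H)).comp
    (f := fun y : Traj p q H × E d × E d => (y.1, y.2.1)) (by fun_prop)
  exact hnew.sub (hM.measurable_isWeight.smul hold)

lemma measurable_gradDiff_left {H : ℕ} (θ θ' : E d) :
    Measurable fun τ : Traj p q H => M.gradDiff γ τ θ θ' :=
  hM.measurable_gradDiff.comp (f := fun τ => (τ, θ, θ')) (by fun_prop)

variable (hR : M.RewardBound R) (hγ₀ : 0 ≤ γ) (hγ₁ : γ < 1)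

include hR hγ₀ hγ₁

lemma norm_gradDiff_le {H : ℕ} {τ : Traj p q H} (hτ : M.Admissible τ) (θ θ' : E d) :
    ‖M.gradDiff γ τ θ θ'‖ ≤
      constG γ R Mg + Real.exp (H * (Mg * ‖θ - θ'‖)) * constG γ R Mg := by
  refine (norm_sub_le _ _).trans (add_le_add (hM.norm_gradEst_le hR hγ₀ hγ₁ hτ θ') ?_)
  rw [norm_smul, Real.norm_of_nonneg (M.isWeight_pos _ _ _).le]
  exact mul_le_mul (hM.isWeight_le_exp hτ θ θ') (hM.norm_gradEst_le hR hγ₀ hγ₁ hτ θ)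
    (norm_nonneg _) (Real.exp_pos _).le

lemma memLp_gradEst (H : ℕ) (θ θ' : E d) :
    MemLp (fun τ : Traj p q H => M.gradEst γ τ θ) 2 (M.trajLaw H θ') :=
  M.memLp_trajLaw_of_bound (hM.measurable_gradEst_left θ).aestronglyMeasurable
    (fun _ hτ => hM.norm_gradEst_le hR hγ₀ hγ₁ hτ θ) 2

lemma memLp_gradDiff (H : ℕ) (θ θ' : E d) :
    MemLp (fun τ : Traj p q H => M.gradDiff γ τ θ θ') 2 (M.trajLaw H θ') :=
  M.memLp_trajLaw_of_bound (hM.measurable_gradDiff_left θ θ').aestronglyMeasurable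
    (fun _ hτ => hM.norm_gradDiff_le hR hγ₀ hγ₁ hτ θ θ') 2

lemma integral_gradDiff (H : ℕ) (θ θ' : E d) :
    ∫ τ, M.gradDiff γ τ θ θ' ∂M.trajLaw H θ' = M.gradJTrunc γ H θ' - M.gradJTrunc γ H θ := by
  have hnew := (hM.memLp_gradEst hR hγ₀ hγ₁ H θ' θ').integrable one_le_two
  have hold : Integrable (fun τ : Traj p q H => M.isWeight τ θ θ' • M.gradEst γ τ θ)
      (M.trajLaw H θ') := by
    refine (hnew.sub ((hM.memLp_gradDiff hR hγ₀ hγ₁ H θ θ').integrable one_le_two)).congr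
      (.of_forall fun τ => ?_)
    simp only [Pi.sub_apply, gradDiff, sub_sub_cancel]
  unfold gradDiff
  rw [integral_sub hnew hold, hM.integral_gradEst hR,
    ← M.integral_trajLaw_eq_integral_isWeight_smul H θ θ', hM.integral_gradEst hR]

lemma integral_norm_sq_one_sub_isWeight_smul_gradEst_le (H : ℕ) {θ θ' : E d} {α : ℝ}
    (hα : ‖θ - θ'‖ ≤ α) :
    ∫ τ : Traj p q H, ‖(1 - M.isWeight τ θ θ') • M.gradEst γ τ θ‖ ^ 2 ∂M.trajLaw H θ' ≤
      constG γ R Mg ^ 2 * (constCw H Mg Mh α * α ^ 2) := by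
  obtain ⟨hmem, hmean, hvar⟩ := hM.isWeight_moments H hα
  rw [variance_eq_integral (M.measurable_isWeight θ θ').aemeasurable, hmean] at hvar
  have hint := (hmem.sub (memLp_const 1)).integrable_sq.const_mul (constG γ R Mg ^ 2)
  refine (integral_mono_of_nonneg (.of_forall fun _ => sq_nonneg _) hint ?_).trans ?_
  · filter_upwards [M.ae_admissible H θ'] with τ hτ
    have hgrad := hM.norm_gradEst_le hR hγ₀ hγ₁ hτ θ
    rw [norm_smul, norm_sub_rev, mul_pow, Real.norm_eq_abs, sq_abs, mul_comm]
    exact mul_le_mul_of_nonneg_right (pow_le_pow_left₀ (norm_nonneg _) hgrad 2) (sq_nonneg _)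
  · rw [integral_const_mul]
    exact mul_le_mul_of_nonneg_left hvar (sq_nonneg _)

lemma integral_norm_sq_gradDiff_le (H : ℕ) {θ θ' : E d} {α : ℝ} (hα : ‖θ - θ'‖ ≤ α) :
    ∫ τ, ‖M.gradDiff γ τ θ θ'‖ ^ 2 ∂M.trajLaw H θ' ≤
      diffConst γ R Mg Mh (constCw H Mg Mh α) * α ^ 2 := by
  have hR₀ := hR.nonneg
  have hMh := hM.Mh_nonneg
  have hdiff := (hM.memLp_gradEst hR hγ₀ hγ₁ H θ' θ').sub (hM.memLp_gradEst hR hγ₀ hγ₁ H θ θ')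
  have hweight : MemLp (fun τ : Traj p q H => (1 - M.isWeight τ θ θ') • M.gradEst γ τ θ) 2
      (M.trajLaw H θ') := by
    refine ((hM.memLp_gradDiff hR hγ₀ hγ₁ H θ θ').sub hdiff).ae_eq (.of_forall fun τ => ?_)
    simp only [gradDiff_eq_add, Pi.sub_apply, add_sub_cancel_left]
  have hdiff_sq : ∫ τ, ‖M.gradEst γ τ θ' - M.gradEst γ τ θ‖ ^ 2 ∂M.trajLaw H θ' ≤
      (Mh * R / (1 - γ) ^ 2 * α) ^ 2 := by
    refine (integral_mono_of_nonneg (.of_forall fun _ => sq_nonneg _)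
      (integrable_const ((Mh * R / (1 - γ) ^ 2 * α) ^ 2)) ?_).trans_eq (by simp)
    filter_upwards [M.ae_admissible H θ'] with τ hτ
    refine pow_le_pow_left₀ (norm_nonneg _)
      ((hM.norm_gradEst_sub_le hR hγ₀ hγ₁ hτ θ' θ).trans ?_) 2
    rw [norm_sub_rev]
    exact mul_le_mul_of_nonneg_left hα (by positivity)
  have hweight_sq := hM.integral_norm_sq_one_sub_isWeight_smul_gradEst_le hR hγ₀ hγ₁ H hα
  simp only [gradDiff_eq_add]
  calc _ ≤ _ := integral_norm_add_sq_le_two_mul hdiff hweight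
    _ ≤ 2 * (Mh * R / (1 - γ) ^ 2 * α) ^ 2 +
        2 * (constG γ R Mg ^ 2 * (constCw H Mg Mh α * α ^ 2)) :=
      add_le_add (mul_le_mul_of_nonneg_left hdiff_sq zero_le_two)
        (mul_le_mul_of_nonneg_left hweight_sq zero_le_two)
    _ = _ := by
      unfold diffConst
      ring

lemma memLp_dirNoise (η : ℝ) (H : ℕ) (θ θ' : E d) :
    MemLp (fun τ : Traj p q H => M.dirNoise γ η τ θ θ') 2 (M.trajLaw H θ') :=
  ((hM.memLp_gradEst hR hγ₀ hγ₁ H θ' θ').const_smul η).add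
    ((hM.memLp_gradDiff hR hγ₀ hγ₁ H θ θ').const_smul (1 - η))

lemma integral_norm_sq_dirNoise_le {η : ℝ} (hη₀ : 0 ≤ η) (hη₁ : η ≤ 1) (H : ℕ) {θ θ' : E d}
    {α : ℝ} (hα : ‖θ - θ'‖ ≤ α) :
    ∫ τ, ‖M.dirNoise γ η τ θ θ'‖ ^ 2 ∂M.trajLaw H θ' ≤
      2 * η ^ 2 * constV γ R Mg ^ 2 +
        2 * (diffConst γ R Mg Mh (constCw H Mg Mh α) * α ^ 2) := by
  have hest_sq := hM.integral_norm_sq_gradEst_le hR hγ₀ hγ₁ H θ'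
  have hdiff_sq := hM.integral_norm_sq_gradDiff_le hR hγ₀ hγ₁ H hα
  have hbound := integral_norm_add_sq_le_two_mul
    ((hM.memLp_gradEst hR hγ₀ hγ₁ H θ' θ').const_smul η)
    ((hM.memLp_gradDiff hR hγ₀ hγ₁ H θ θ').const_smul (1 - η))
  simp only [Pi.smul_apply, norm_smul, mul_pow, integral_const_mul, Real.norm_eq_abs,
    sq_abs] at hbound
  refine hbound.trans (add_le_add ?_ (mul_le_mul_of_nonneg_left ?_ zero_le_two))
  · rw [mul_assoc]
    gcongr
  · have hη_sq : (1 - η) ^ 2 ≤ 1 := pow_le_one₀ (by linarith) (by linarith)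
    exact (mul_le_of_le_one_left (integral_nonneg fun _ => sq_nonneg _) hη_sq).trans hdiff_sq

lemma nextDir_sub_gradJTrunc_eq {H : ℕ} (η : ℝ) (θ θ' dir : E d) (τ : Traj p q H) :
    M.nextDir γ η θ θ' dir τ - M.gradJTrunc γ H θ' =
      (1 - η) • (dir - M.gradJTrunc γ H θ) +
        (M.dirNoise γ η τ θ θ' - ∫ τ', M.dirNoise γ η τ' θ θ' ∂M.trajLaw H θ') := by
  unfold dirNoise
  rw [integral_add
      (((hM.memLp_gradEst hR hγ₀ hγ₁ H θ' θ').integrable one_le_two).fun_smul η)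
      (((hM.memLp_gradDiff hR hγ₀ hγ₁ H θ θ').integrable one_le_two).fun_smul (1 - η)),
    integral_smul, integral_smul, hM.integral_gradEst hR, hM.integral_gradDiff hR hγ₀ hγ₁, nextDir]
  module

lemma memLp_nextDir_sub_gradJTrunc (η : ℝ) (H : ℕ) (θ θ' dir : E d) :
    MemLp (fun τ : Traj p q H => M.nextDir γ η θ θ' dir τ - M.gradJTrunc γ H θ') 2
      (M.trajLaw H θ') := by
  simp only [hM.nextDir_sub_gradJTrunc_eq hR hγ₀ hγ₁]
  have hcentered := (hM.memLp_dirNoise hR hγ₀ hγ₁ η H θ θ').sub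
    (memLp_const (∫ τ, M.dirNoise γ η τ θ θ' ∂M.trajLaw H θ'))
  have hsum := (memLp_const ((1 - η) • (dir - M.gradJTrunc γ H θ))).add hcentered
  exact hsum

lemma integral_norm_sq_nextDir_sub_gradJTrunc_le {η : ℝ} (hη₀ : 0 ≤ η) (hη₁ : η ≤ 1) (H : ℕ)
    {θ θ' : E d} (dir : E d) {α : ℝ} (hα : ‖θ - θ'‖ ≤ α) :
    ∫ τ, ‖M.nextDir γ η θ θ' dir τ - M.gradJTrunc γ H θ'‖ ^ 2 ∂M.trajLaw H θ' ≤
      (1 - η) * ‖dir - M.gradJTrunc γ H θ‖ ^ 2 + (2 * η ^ 2 * constV γ R Mg ^ 2 +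
        2 * (diffConst γ R Mg Mh (constCw H Mg Mh α) * α ^ 2)) := by
  simp only [hM.nextDir_sub_gradJTrunc_eq hR hγ₀ hγ₁]
  refine (integral_norm_sq_add_sub_integral_le (hM.memLp_dirNoise hR hγ₀ hγ₁ η H θ θ') _).trans
    (add_le_add ?_ (hM.integral_norm_sq_dirNoise_le hR hγ₀ hγ₁ hη₀ hη₁ H hα))
  rw [norm_smul, mul_pow, Real.norm_eq_abs, sq_abs]
  exact mul_le_mul_of_nonneg_right
    (pow_le_of_le_one (by linarith) (by linarith) two_ne_zero) (sq_nonneg _)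

end Regular

end Problem

/-! ### The run as a Markov chain -/

namespace Problem

variable {p q d : ℕ}

/-- One iteration of N-VR-PG, as a map of the current pair `(θ, dir)` and a new trajectory. -/
noncomputable def nvrpgStep (M : Problem p q d) (γ α η : ℝ) {H : ℕ} (x : E d × E d)
    (τ : Traj p q H) : E d × E d :=
  (normalizedStep x.1 α x.2, M.nextDir γ η x.1 (normalizedStep x.1 α x.2) x.2 τ)

lemma nvrpg_succ (M : Problem p q d) (γ : ℝ) {H : ℕ} (α η : ℕ → ℝ) (θ₀ : E d)
    (τ : ℕ → Traj p q H) (t : ℕ) : M.nvrpg γ α η θ₀ τ (t + 1) =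
      M.nvrpgStep γ (α t) (η (t + 1)) (M.nvrpg γ α η θ₀ τ t) (τ (t + 1)) := rfl

lemma measurable_normalizedStep (α : ℝ) :
    Measurable fun x : E d × E d => normalizedStep x.1 α x.2 := by
  unfold normalizedStep
  fun_prop

lemma norm_sub_normalizedStep_le {α : ℝ} (hα : 0 ≤ α) (θ dir : E d) :
    ‖θ - normalizedStep θ α dir‖ ≤ α := by
  unfold normalizedStep
  rw [sub_add_cancel_left, norm_neg, norm_smul, Real.norm_of_nonneg hα, norm_smul, norm_inv,
    norm_norm]
  exact mul_le_of_le_one_right hα inv_mul_le_one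

variable {M : Problem p q d} {lμ Mg Mh R γ : ℝ}

namespace Regular

variable (hM : M.Regular lμ Mg Mh)

include hM

lemma measurable_nvrpgStep {H : ℕ} (α η : ℝ) :
    Measurable fun y : (E d × E d) × Traj p q H => M.nvrpgStep γ α η y.1 y.2 := by
  have hiterate : Measurable fun y : (E d × E d) × Traj p q H => normalizedStep y.1.1 α y.1.2 :=
    (measurable_normalizedStep α).comp measurable_fst
  have hest := (hM.measurable_gradEst (γ := γ) (H := H)).comp (measurable_snd.prodMk hiterate)
  have hdiff := (hM.measurable_gradDiff (γ := γ) (H := H)).comp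
    (measurable_snd.prodMk (measurable_fst.fst.prodMk hiterate))
  exact hiterate.prodMk
    ((hest.const_smul η).add ((measurable_fst.snd.add hdiff).const_smul (1 - η)))

lemma exists_measurable_nvrpg_eq {H : ℕ} (α η : ℕ → ℝ) (θ₀ : E d) (t : ℕ) :
    ∃ Φ : (Fin (t + 1) → Traj p q H) → E d × E d, Measurable Φ ∧
      ∀ τ : ℕ → Traj p q H, M.nvrpg γ α η θ₀ τ t = Φ fun i => τ i := by
  induction t with
  | zero =>
    exact ⟨fun h => (θ₀, M.gradEst γ (h 0) θ₀), measurable_const.prodMk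
      ((hM.measurable_gradEst_left θ₀).comp (measurable_pi_apply 0)), fun _ => rfl⟩
  | succ t ih =>
    obtain ⟨Φ, hΦ, hΦ_eq⟩ := ih
    refine ⟨fun h => M.nvrpgStep γ (α t) (η (t + 1)) (Φ (Fin.init h)) (h (Fin.last _)), ?_,
      fun τ => ?_⟩
    · have hinit : Measurable fun h : Fin (t + 2) → Traj p q H => Fin.init h :=
        measurable_pi_lambda _ fun i => measurable_pi_apply i.castSucc
      exact (hM.measurable_nvrpgStep (α t) (η (t + 1))).comp
        ((hΦ.comp hinit).prodMk (measurable_pi_apply _))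
    · rw [nvrpg_succ, hΦ_eq]
      rfl

end Regular

/-- The law of a trajectory as a kernel in the policy parameter. -/
noncomputable def trajKernel (hM : M.Regular lμ Mg Mh) (H : ℕ) : Kernel (E d) (Traj p q H) where
  toFun θ := M.trajLaw H θ
  measurable' := by
    refine Measure.measurable_of_measurable_coe _ fun s hs => ?_
    have hlaw (θ : E d) :
        M.trajLaw H θ s = ∫⁻ τ in s, ENNReal.ofReal (M.isWeight τ θ 0) ∂M.trajLaw H 0 := by
      rw [M.trajLaw_eq_withDensity H θ 0, withDensity_apply _ hs]
    simp only [hlaw]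
    have hweight := hM.measurable_isWeight.comp
      (f := fun y : E d × Traj p q H => (y.2, y.1, 0)) (by fun_prop)
    exact hweight.ennreal_ofReal.lintegral_prod_right'

/-- The law of the next trajectory as a kernel in the current pair `(θ, dir)`. -/
noncomputable def nextTrajKernel (hM : M.Regular lμ Mg Mh) (H : ℕ) (α : ℝ) :
    Kernel (E d × E d) (Traj p q H) :=
  (trajKernel hM H).comap (fun x => normalizedStep x.1 α x.2) (measurable_normalizedStep α)

instance isMarkov_nextTrajKernel (hM : M.Regular lμ Mg Mh) (H : ℕ) (α : ℝ) :
    IsMarkovKernel (nextTrajKernel hM H α) :=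
  ⟨fun x => M.isProbability_trajLaw H (normalizedStep x.1 α x.2)⟩

lemma nextTrajKernel_apply (hM : M.Regular lμ Mg Mh) (H : ℕ) (α : ℝ) (x : E d × E d) :
    nextTrajKernel hM H α x = M.trajLaw H (normalizedStep x.1 α x.2) := rfl

/-- The weight `w(τ_{t+1} | θ_t, θ_{t+1})`, as a function of the pair `(θ_t, d_t)` and of the
trajectory `τ_{t+1}`. -/
noncomputable def stepWeight (M : Problem p q d) (α : ℝ) {H : ℕ}
    (y : (E d × E d) × Traj p q H) : ℝ :=
  M.isWeight y.2 y.1.1 (normalizedStep y.1.1 α y.1.2)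

namespace Regular

variable (hM : M.Regular lμ Mg Mh)

include hM in
lemma measurable_stepWeight (α : ℝ) (H : ℕ) :
    Measurable fun y : (E d × E d) × Traj p q H => M.stepWeight α y := by
  unfold stepWeight
  have hiterate : Measurable fun y : (E d × E d) × Traj p q H => normalizedStep y.1.1 α y.1.2 :=
    (measurable_normalizedStep α).comp measurable_fst
  exact hM.measurable_isWeight.comp
    (f := fun y : (E d × E d) × Traj p q H => (y.2, y.1.1, normalizedStep y.1.1 α y.1.2))
    (measurable_snd.prodMk (measurable_fst.fst.prodMk hiterate))

lemma lintegral_stepWeight (H : ℕ) (α : ℝ) (x : E d × E d) :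
    ∫⁻ τ, ENNReal.ofReal (M.stepWeight α (x, τ)) ∂nextTrajKernel hM H α x = 1 := by
  simp only [stepWeight, nextTrajKernel_apply]
  rw [← ofReal_integral_eq_lintegral_ofReal (M.integrable_isWeight H _ _)
    (.of_forall fun _ => (M.isWeight_pos _ _ _).le), M.integral_isWeight, ENNReal.ofReal_one]

lemma lintegral_sq_stepWeight_le (H : ℕ) {α : ℝ} (hα : 0 ≤ α) (x : E d × E d) :
    ∫⁻ τ, ENNReal.ofReal (M.stepWeight α (x, τ) ^ 2) ∂nextTrajKernel hM H α x ≤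
      ENNReal.ofReal (constW H Mg α) := by
  have hbound := hM.lintegral_sq_isWeight_le H x.1 (normalizedStep x.1 α x.2)
  refine hbound.trans (ENNReal.ofReal_le_ofReal (Real.exp_le_exp.2 ?_))
  gcongr
  exact norm_sub_normalizedStep_le hα _ _

end Regular

namespace IsRun

variable {Ω : Type*} [MeasurableSpace Ω] {P : Measure Ω} {H T : ℕ} {α η : ℕ → ℝ} {θ₀ : E d}
  {τ : ℕ → Ω → Traj p q H} (hτ : M.IsRun P γ T α η θ₀ τ)

include hτ

lemma map_zero [IsProbabilityMeasure P] (hT : 0 < T) : P.map (τ 0) = M.trajLaw H θ₀ := by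
  ext C hC
  have hlaw := hτ.law 0 hT Set.univ C .univ hC
  simp only [Set.mem_univ, true_and, Set.ofPred_true, Measure.restrict_univ, iterate, nvrpg,
    lintegral_const, measure_univ, mul_one] at hlaw
  rw [Measure.map_apply (hτ.measurable 0 hT) hC]
  exact hlaw

variable (hM : M.Regular lμ Mg Mh)

include hM

lemma measurable_nvrpg {t : ℕ} (ht : t < T) :
    Measurable fun ω => M.nvrpg γ α η θ₀ (fun n => τ n ω) t := by
  obtain ⟨Φ, hΦ, hΦ_eq⟩ := hM.exists_measurable_nvrpg_eq (γ := γ) (H := H) α η θ₀ t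
  simp only [hΦ_eq]
  exact hΦ.comp (measurable_pi_lambda _ fun i => hτ.measurable i (by omega))

lemma measurable_iterate {t : ℕ} (ht : t ≤ T) :
    Measurable fun ω => M.iterate γ α η θ₀ (fun n => τ n ω) t := by
  cases t with
  | zero => exact measurable_const
  | succ t => exact (measurable_normalizedStep (α t)).comp (hτ.measurable_nvrpg hM ht)

variable [IsProbabilityMeasure P]

lemma map_nvrpg_prodMk {t : ℕ} (ht : t + 1 < T) :
    P.map (fun ω => (M.nvrpg γ α η θ₀ (fun n => τ n ω) t, τ (t + 1) ω)) =
      (P.map fun ω => M.nvrpg γ α η θ₀ (fun n => τ n ω) t) ⊗ₘ nextTrajKernel hM H (α t) := by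
  have hstate := hτ.measurable_nvrpg hM (t.lt_succ_self.trans ht)
  have hnext := hτ.measurable (t + 1) ht
  have _ := Measure.isProbabilityMeasure_map (μ := P) (hstate.prodMk hnext).aemeasurable
  have _ := Measure.isProbabilityMeasure_map (μ := P) hstate.aemeasurable
  obtain ⟨Φ, hΦ, hΦ_eq⟩ := hM.exists_measurable_nvrpg_eq (γ := γ) (H := H) α η θ₀ t
  have hstate_eq (ω : Ω) :
      Φ (fun i : Fin (t + 1) => τ i ω) = M.nvrpg γ α η θ₀ (fun n => τ n ω) t :=
    (hΦ_eq fun n => τ n ω).symm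
  refine Measure.ext_prod fun {B C} hB hC => ?_
  have hlaw := hτ.law (t + 1) ht (Φ ⁻¹' B) C (hΦ hB) hC
  simp only [Set.mem_preimage, hstate_eq] at hlaw
  rw [Measure.map_apply (hstate.prodMk hnext) (hB.prod hC), Measure.compProd_apply_prod hB hC,
    setLIntegral_map hB (Kernel.measurable_coe _ hC) hstate]
  exact hlaw

lemma lintegral_nvrpg_prodMk {t : ℕ} (ht : t + 1 < T) {F : (E d × E d) × Traj p q H → ℝ≥0∞}
    (hF : Measurable F) :
    ∫⁻ ω, F (M.nvrpg γ α η θ₀ (fun n => τ n ω) t, τ (t + 1) ω) ∂P =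
      ∫⁻ ω, ∫⁻ y, F (M.nvrpg γ α η θ₀ (fun n => τ n ω) t, y)
        ∂nextTrajKernel hM H (α t) (M.nvrpg γ α η θ₀ (fun n => τ n ω) t) ∂P := by
  have hstate := hτ.measurable_nvrpg hM (t.lt_succ_self.trans ht)
  have hnext := hτ.measurable (t + 1) ht
  have _ := Measure.isProbabilityMeasure_map (μ := P) hstate.aemeasurable
  rw [← lintegral_map hF (hstate.prodMk hnext), hτ.map_nvrpg_prodMk hM ht,
    Measure.lintegral_compProd hF, lintegral_map hF.lintegral_kernel_prod_right' hstate]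

lemma integral_stepWeight {t : ℕ} (ht : t + 1 < T) :
    ∫ ω, M.stepWeight (α t) (M.nvrpg γ α η θ₀ (fun n => τ n ω) t, τ (t + 1) ω) ∂P = 1 := by
  have hw := hM.measurable_stepWeight (α t) H
  have hmeas := hw.comp
    ((hτ.measurable_nvrpg hM (t.lt_succ_self.trans ht)).prodMk (hτ.measurable (t + 1) ht))
  have hlintegral := hτ.lintegral_nvrpg_prodMk hM ht hw.ennreal_ofReal
  simp only [hM.lintegral_stepWeight, lintegral_one, measure_univ] at hlintegral
  have hnonneg : 0 ≤ᵐ[P] fun ω =>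
      M.stepWeight (α t) (M.nvrpg γ α η θ₀ (fun n => τ n ω) t, τ (t + 1) ω) :=
    .of_forall fun _ => (M.isWeight_pos _ _ _).le
  rw [integral_eq_lintegral_of_nonneg_ae hnonneg
    hmeas.aestronglyMeasurable]
  exact congrArg ENNReal.toReal hlintegral

lemma lintegral_sq_stepWeight_le {t : ℕ} (ht : t + 1 < T) (hα : 0 ≤ α t) :
    ∫⁻ ω, ENNReal.ofReal
        (M.stepWeight (α t) (M.nvrpg γ α η θ₀ (fun n => τ n ω) t, τ (t + 1) ω) ^ 2) ∂P ≤
      ENNReal.ofReal (constW H Mg (α t)) := by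
  refine (hτ.lintegral_nvrpg_prodMk hM ht
    ((hM.measurable_stepWeight (α t) H).pow_const 2).ennreal_ofReal).trans_le
      ((lintegral_mono fun _ => hM.lintegral_sq_stepWeight_le H hα _).trans_eq ?_)
  rw [lintegral_const, measure_univ, mul_one]

lemma isWeight_moments {t : ℕ} (ht : t + 1 < T) (hα : 0 ≤ α t) :
    MemLp (fun ω => M.isWeight (τ (t + 1) ω) (M.iterate γ α η θ₀ (fun n => τ n ω) t)
        (M.iterate γ α η θ₀ (fun n => τ n ω) (t + 1))) 2 P ∧
      ∫ ω, M.isWeight (τ (t + 1) ω) (M.iterate γ α η θ₀ (fun n => τ n ω) t)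
        (M.iterate γ α η θ₀ (fun n => τ n ω) (t + 1)) ∂P = 1 ∧
      variance (fun ω => M.isWeight (τ (t + 1) ω) (M.iterate γ α η θ₀ (fun n => τ n ω) t)
        (M.iterate γ α η θ₀ (fun n => τ n ω) (t + 1))) P ≤
          constCw H Mg Mh (α t) * α t ^ 2 := by
  have hW := (hM.measurable_stepWeight (α t) H).comp
    ((hτ.measurable_nvrpg hM (t.lt_succ_self.trans ht)).prodMk (hτ.measurable (t + 1) ht))
  have hsq := hτ.lintegral_sq_stepWeight_le hM ht hα
  have hmean := hτ.integral_stepWeight hM ht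
  exact ⟨memLp_two_of_lintegral_sq_le hW.aemeasurable hsq, hmean,
    (variance_le_of_lintegral_sq_le hW.aemeasurable (Real.exp_pos _).le hsq hmean).trans
      (constW_sub_one_le hM.Mh_nonneg _)⟩

end IsRun

end Problem

/-! ### Mean squared error of the direction -/

lemma diffConst_nonneg (γ R Mg : ℝ) {Mh : ℝ} (hMh : 0 ≤ Mh) (H : ℕ) (α : ℝ) :
    0 ≤ diffConst γ R Mg Mh (constCw H Mg Mh α) := by
  have _ := constCw_nonneg H (Mg := Mg) hMh α
  unfold diffConst
  positivity

lemma lintegral_ofReal_norm_sq_le {Ω F : Type*} [MeasurableSpace Ω] {P : Measure Ω}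
    [NormedAddCommGroup F] {X : Ω → F} (hX : MemLp X 2 P) {c : ℝ} (hc : ∫ ω, ‖X ω‖ ^ 2 ∂P ≤ c) :
    ∫⁻ ω, ENNReal.ofReal (‖X ω‖ ^ 2) ∂P ≤ ENNReal.ofReal c := by
  rw [← ofReal_integral_eq_lintegral_ofReal (hX.integrable_norm_pow two_ne_zero)
    (.of_forall fun _ => sq_nonneg _)]
  exact ENNReal.ofReal_le_ofReal hc

namespace Problem

variable {p q d : ℕ} {M : Problem p q d} {lμ Mg Mh R γ : ℝ}

/-- The error `d_t - ∇J_H(θ_t)` of the direction, as a function of the pair `(θ_t, d_t)`. -/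
noncomputable def estError (M : Problem p q d) (γ : ℝ) (H : ℕ) (x : E d × E d) : E d :=
  x.2 - M.gradJTrunc γ H x.1

namespace Regular

variable (hM : M.Regular lμ Mg Mh) (hR : M.RewardBound R)

include hM hR

lemma continuous_stepGrad (h : ℕ) : Continuous (M.stepGrad h) :=
  (LipschitzWith.of_dist_le' fun x y => by
    simpa only [dist_eq_norm] using hM.norm_stepGrad_sub_le hR h x y).continuous

lemma measurable_estError (H : ℕ) : Measurable (M.estError γ H) := by
  have _ := hM.continuous_stepGrad hR
  unfold estError gradJTrunc
  fun_prop

variable (hγ₀ : 0 ≤ γ) (hγ₁ : γ < 1)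

include hγ₀ hγ₁

lemma integral_norm_sq_gradEst_sub_gradJTrunc_le (H : ℕ) (θ : E d) :
    ∫ τ, ‖M.gradEst γ τ θ - M.gradJTrunc γ H θ‖ ^ 2 ∂M.trajLaw H θ ≤ constV γ R Mg ^ 2 := by
  have hvar := integral_norm_sq_add_sub_integral_le (hM.memLp_gradEst hR hγ₀ hγ₁ H θ θ) 0
  simp only [zero_add, hM.integral_gradEst hR, norm_zero, zero_pow two_ne_zero] at hvar
  exact hvar.trans (hM.integral_norm_sq_gradEst_le hR hγ₀ hγ₁ H θ)

lemma lintegral_norm_sq_estError_nvrpgStep_le {α η : ℝ} (hα : 0 ≤ α) (hη₀ : 0 ≤ η) (hη₁ : η ≤ 1)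
    (H : ℕ) (x : E d × E d) :
    ∫⁻ τ, ENNReal.ofReal (‖M.estError γ H (M.nvrpgStep γ α η x τ)‖ ^ 2)
        ∂nextTrajKernel hM H α x ≤
      ENNReal.ofReal (1 - η) * ENNReal.ofReal (‖M.estError γ H x‖ ^ 2) +
        ENNReal.ofReal (2 * η ^ 2 * constV γ R Mg ^ 2 +
          2 * (diffConst γ R Mg Mh (constCw H Mg Mh α) * α ^ 2)) := by
  have _ := diffConst_nonneg γ R Mg hM.Mh_nonneg H α
  have _ : 0 ≤ 1 - η := sub_nonneg.2 hη₁
  rw [← ENNReal.ofReal_mul (by positivity), ← ENNReal.ofReal_add (by positivity) (by positivity)]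
  exact lintegral_ofReal_norm_sq_le (hM.memLp_nextDir_sub_gradJTrunc hR hγ₀ hγ₁ η H _ _ x.2)
    (hM.integral_norm_sq_nextDir_sub_gradJTrunc_le hR hγ₀ hγ₁ hη₀ hη₁ H x.2
      (norm_sub_normalizedStep_le hα x.1 x.2))

end Regular

namespace IsRun

variable {Ω : Type*} [MeasurableSpace Ω] {P : Measure Ω} [IsProbabilityMeasure P] {H T : ℕ}
  {α η : ℕ → ℝ} {θ₀ : E d} {τ : ℕ → Ω → Traj p q H} (hτ : M.IsRun P γ T α η θ₀ τ)
  (hM : M.Regular lμ Mg Mh) (hR : M.RewardBound R) (hγ₀ : 0 ≤ γ) (hγ₁ : γ < 1)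

include hτ hM hR hγ₀ hγ₁

lemma lintegral_norm_sq_estError_zero_le (hT : 0 < T) :
    ∫⁻ ω, ENNReal.ofReal (‖M.estError γ H (M.nvrpg γ α η θ₀ (fun n => τ n ω) 0)‖ ^ 2) ∂P ≤
      ENNReal.ofReal (constV γ R Mg ^ 2) := by
  have herror : Measurable fun y : Traj p q H => M.gradEst γ y θ₀ - M.gradJTrunc γ H θ₀ :=
    (hM.measurable_gradEst_left θ₀).sub_const _
  have hmap := lintegral_map (μ := P) (herror.norm.pow_const 2).ennreal_ofReal (hτ.measurable 0 hT)
  refine hmap.symm.trans_le ?_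
  rw [hτ.map_zero hT]
  exact lintegral_ofReal_norm_sq_le
    ((hM.memLp_gradEst hR hγ₀ hγ₁ H θ₀ θ₀).sub (memLp_const (M.gradJTrunc γ H θ₀)))
    (hM.integral_norm_sq_gradEst_sub_gradJTrunc_le hR hγ₀ hγ₁ H θ₀)

lemma lintegral_norm_sq_estError_succ_le {t : ℕ} (ht : t + 1 < T) (hα : 0 ≤ α t)
    (hη₀ : 0 ≤ η (t + 1)) (hη₁ : η (t + 1) ≤ 1) :
    ∫⁻ ω, ENNReal.ofReal (‖M.estError γ H (M.nvrpg γ α η θ₀ (fun n => τ n ω) (t + 1))‖ ^ 2) ∂P ≤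
      ENNReal.ofReal (1 - η (t + 1)) *
        ∫⁻ ω, ENNReal.ofReal (‖M.estError γ H (M.nvrpg γ α η θ₀ (fun n => τ n ω) t)‖ ^ 2) ∂P +
      ENNReal.ofReal (2 * η (t + 1) ^ 2 * constV γ R Mg ^ 2 +
        2 * (diffConst γ R Mg Mh (constCw H Mg Mh (α t)) * α t ^ 2)) := by
  have herror := hM.measurable_estError (γ := γ) hR H
  have hstep : Measurable fun y : (E d × E d) × Traj p q H =>
      ENNReal.ofReal (‖M.estError γ H (M.nvrpgStep γ (α t) (η (t + 1)) y.1 y.2)‖ ^ 2) :=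
    ((herror.comp (hM.measurable_nvrpgStep _ _)).norm.pow_const 2).ennreal_ofReal
  have hcurrent := ((herror.comp
    (hτ.measurable_nvrpg hM (t.lt_succ_self.trans ht))).norm.pow_const 2).ennreal_ofReal
  refine (hτ.lintegral_nvrpg_prodMk hM ht hstep).trans_le ((lintegral_mono fun ω =>
    hM.lintegral_norm_sq_estError_nvrpgStep_le hR hγ₀ hγ₁ hα hη₀ hη₁ H _).trans_eq ?_)
  rw [lintegral_add_right _ measurable_const, lintegral_const, measure_univ, mul_one]
  exact congrArg (· + _) (lintegral_const_mul _ hcurrent)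

end IsRun

end Problem

/-! ### Momentum and horizon -/

lemma rpow_one_third_pow_three {a : ℝ} (ha : 0 ≤ a) : (a ^ ((1 : ℝ) / 3)) ^ 3 = a := by
  rw [← Real.rpow_natCast, ← Real.rpow_mul ha]
  norm_num

lemma rpow_one_third_sq {a : ℝ} (ha : 0 ≤ a) : (a ^ ((1 : ℝ) / 3)) ^ 2 = a ^ ((2 : ℝ) / 3) := by
  rw [← Real.rpow_natCast, ← Real.rpow_mul ha]
  norm_num

lemma momentum_pos (t : ℕ) : 0 < momentum t := by
  unfold momentum
  positivity

lemma momentum_anti {s t : ℕ} (hst : s ≤ t) : momentum t ≤ momentum s := by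
  unfold momentum
  gcongr

lemma momentum_one : momentum 1 = 1 := by norm_num [momentum]

lemma inv_momentum (t : ℕ) : (momentum t)⁻¹ = (((t : ℝ) + 1) / 2) ^ ((2 : ℝ) / 3) := by
  rw [momentum, ← Real.inv_rpow (by positivity), inv_div]

lemma inv_momentum_succ_le (t : ℕ) : (momentum (t + 1))⁻¹ ≤ (momentum t)⁻¹ + 3 / 4 := by
  have hhalf : ((1 : ℝ) / 2) ^ ((2 : ℝ) / 3) ≤ 3 / 4 := by
    refine le_of_pow_le_pow_left₀ (n := 3) three_ne_zero (by norm_num) ?_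
    rw [← Real.rpow_natCast, ← Real.rpow_mul (by norm_num)]
    norm_num
  have hsplit : (((t + 1 : ℕ) : ℝ) + 1) / 2 = ((t : ℝ) + 1) / 2 + 1 / 2 := by push_cast; ring
  rw [inv_momentum, inv_momentum, hsplit]
  exact (Real.rpow_add_le_add_rpow (by positivity) (by norm_num) (by norm_num)
    (by norm_num)).trans (add_le_add_right hhalf _)

lemma momentum_sub_le (t : ℕ) :
    momentum t - momentum (t + 1) ≤ 3 / 4 * (momentum t * momentum (t + 1)) := by
  have hpos := momentum_pos t
  have hpos' := momentum_pos (t + 1)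
  calc momentum t - momentum (t + 1)
      = momentum t * momentum (t + 1) * ((momentum (t + 1))⁻¹ - (momentum t)⁻¹) := by field_simp
    _ ≤ momentum t * momentum (t + 1) * (3 / 4) := by
        gcongr
        exact sub_le_iff_le_add'.2 (inv_momentum_succ_le t)
    _ = 3 / 4 * (momentum t * momentum (t + 1)) := mul_comm _ _

lemma sqrt_momentum (t : ℕ) : √(momentum t) = (2 / ((t : ℝ) + 1)) ^ ((1 : ℝ) / 3) := by
  rw [momentum, ← rpow_one_third_sq (by positivity), Real.sqrt_sq (by positivity)]

lemma one_div_le_sq_sub_sq {x y : ℝ} (hx : 0 < x) (hy : 0 ≤ y) (hxy : x ^ 3 = y ^ 3 + 1) :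
    1 / x ≤ 3 / 2 * (x ^ 2 - y ^ 2) := by
  rw [div_le_iff₀ hx]
  nlinarith [mul_nonneg (sq_nonneg (x - y)) (add_nonneg hx.le (mul_nonneg zero_le_two hy))]

lemma sqrt_momentum_le (t : ℕ) :
    √(momentum t) ≤ 2 * (((t + 1 : ℕ) : ℝ) ^ ((2 : ℝ) / 3) - (t : ℝ) ^ ((2 : ℝ) / 3)) := by
  have htwo : (2 : ℝ) ^ ((1 : ℝ) / 3) ≤ 4 / 3 := by
    refine le_of_pow_le_pow_left₀ (n := 3) three_ne_zero (by norm_num) ?_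
    rw [rpow_one_third_pow_three zero_le_two]
    norm_num
  have hincrement := one_div_le_sq_sub_sq (x := ((t + 1 : ℕ) : ℝ) ^ ((1 : ℝ) / 3))
    (y := (t : ℝ) ^ ((1 : ℝ) / 3)) (by positivity) (by positivity) (by
      rw [rpow_one_third_pow_three (by positivity), rpow_one_third_pow_three (by positivity),
        Nat.cast_succ])
  rw [rpow_one_third_sq (by positivity), rpow_one_third_sq (by positivity)] at hincrement
  calc √(momentum t)
      = (2 : ℝ) ^ ((1 : ℝ) / 3) * (1 / ((t + 1 : ℕ) : ℝ) ^ ((1 : ℝ) / 3)) := by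
        rw [sqrt_momentum, Real.div_rpow zero_le_two (by positivity), Nat.cast_succ, mul_one_div]
    _ ≤ 4 / 3 * (3 / 2 * (((t + 1 : ℕ) : ℝ) ^ ((2 : ℝ) / 3) - (t : ℝ) ^ ((2 : ℝ) / 3))) := by
        gcongr
    _ = 2 * (((t + 1 : ℕ) : ℝ) ^ ((2 : ℝ) / 3) - (t : ℝ) ^ ((2 : ℝ) / 3)) := by ring

lemma sum_sqrt_momentum_le (n : ℕ) :
    ∑ t ∈ Finset.range n, √(momentum t) ≤ 2 * (n : ℝ) ^ ((2 : ℝ) / 3) := by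
  refine (Finset.sum_le_sum fun t _ => sqrt_momentum_le t).trans_eq ?_
  rw [← Finset.mul_sum, Finset.sum_range_sub fun t : ℕ => (t : ℝ) ^ ((2 : ℝ) / 3), Nat.cast_zero,
    Real.zero_rpow (by norm_num), sub_zero]

section Horizon

variable {γ : ℝ} (hγ₁ : γ < 1)

include hγ₁

lemma log_le_one_sub_mul_horizon (T : ℕ) : Real.log (T + 1) ≤ (1 - γ) * horizon γ T :=
  (inv_mul_le_iff₀ (sub_pos.2 hγ₁)).1 (Nat.le_ceil _)

variable (hγ₀ : 0 ≤ γ)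

include hγ₀

lemma one_sub_mul_horizon_le (T : ℕ) : (1 - γ) * horizon γ T ≤ Real.log (T + 1) + 1 := by
  have hγ := sub_pos.2 hγ₁
  have hlog : 0 ≤ Real.log ((T : ℝ) + 1) :=
    Real.log_nonneg (le_add_of_nonneg_left (Nat.cast_nonneg T))
  calc (1 - γ) * horizon γ T ≤ (1 - γ) * ((1 - γ)⁻¹ * Real.log (T + 1) + 1) := by
        gcongr
        exact (Nat.ceil_lt_add_one (by positivity)).le
    _ = Real.log (T + 1) + (1 - γ) := by field_simp
    _ ≤ Real.log (T + 1) + 1 := by linarith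

lemma one_sub_mul_horizon_le_add_one (T : ℕ) : (1 - γ) * horizon γ T ≤ T + 1 := by
  linarith [one_sub_mul_horizon_le hγ₁ hγ₀ T,
    Real.log_le_sub_one_of_pos (show (0 : ℝ) < T + 1 by positivity)]

lemma pow_horizon_le (T : ℕ) : γ ^ horizon γ T ≤ 1 / ((T : ℝ) + 1) :=
  calc γ ^ horizon γ T ≤ Real.exp (-(1 - γ)) ^ horizon γ T := by
        gcongr
        linarith [Real.add_one_le_exp (-(1 - γ))]
    _ = Real.exp (-((1 - γ) * horizon γ T)) := by rw [← Real.exp_nat_mul]; congr 1; ring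
    _ ≤ Real.exp (-Real.log (T + 1)) :=
        Real.exp_le_exp.2 (neg_le_neg (log_le_one_sub_mul_horizon hγ₁ T))
    _ = 1 / ((T : ℝ) + 1) := by rw [Real.exp_neg, Real.exp_log (by positivity), one_div]

lemma pow_horizon_mul_le {T : ℕ} (hT : 1 ≤ T) :
    γ ^ horizon γ T * (√((1 - γ) * horizon γ T) + 1) ≤ 2 / (T : ℝ) ^ ((1 : ℝ) / 3) := by
  have hsqrt : √((1 - γ) * horizon γ T) ≤ √((T : ℝ) + 1) :=
    Real.sqrt_le_sqrt (one_sub_mul_horizon_le_add_one hγ₁ hγ₀ T)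
  have hone : 1 ≤ √((T : ℝ) + 1) := Real.one_le_sqrt.2 (by linarith [T.cast_nonneg (α := ℝ)])
  have hroot : (T : ℝ) ^ ((1 : ℝ) / 3) ≤ √((T : ℝ) + 1) := by
    rw [Real.sqrt_eq_rpow]
    calc (T : ℝ) ^ ((1 : ℝ) / 3) ≤ (T : ℝ) ^ ((1 : ℝ) / 2) :=
          Real.rpow_le_rpow_of_exponent_le (mod_cast hT) (by norm_num)
      _ ≤ ((T : ℝ) + 1) ^ ((1 : ℝ) / 2) := by
          gcongr
          exact (lt_add_one _).le
  calc γ ^ horizon γ T * (√((1 - γ) * horizon γ T) + 1)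
      ≤ 1 / ((T : ℝ) + 1) * (√((T : ℝ) + 1) + √((T : ℝ) + 1)) :=
        mul_le_mul (pow_horizon_le hγ₁ hγ₀ T) (add_le_add hsqrt hone) (by positivity)
          (by positivity)
    _ = 2 * (√((T : ℝ) + 1) / (T + 1)) := by ring
    _ = 2 / √((T : ℝ) + 1) := by rw [Real.sqrt_div_self', mul_one_div]
    _ ≤ 2 / (T : ℝ) ^ ((1 : ℝ) / 3) := by gcongr

end Horizon

/-! ### Mean squared error and ascent -/

lemma mse_recursion (V : ℝ) {B K : ℝ} (t : ℕ) (hK : K ≤ momentum (t + 1) * B) :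
    (1 - momentum (t + 1)) * (8 * V ^ 2 * momentum t + B) +
      (2 * momentum (t + 1) ^ 2 * V ^ 2 + K) ≤ 8 * V ^ 2 * momentum (t + 1) + B := by
  have hmomentum : 8 * (momentum t - momentum (t + 1)) + 2 * momentum (t + 1) ^ 2 ≤
      8 * (momentum t * momentum (t + 1)) := by
    nlinarith [mul_le_mul_of_nonneg_left (momentum_anti t.le_succ) (momentum_pos (t + 1)).le,
      momentum_sub_le t]
  nlinarith [mul_le_mul_of_nonneg_left hmomentum (sq_nonneg V)]

lemma norm_sub_two_mul_le_inner_normalize {F : Type*} [NormedAddCommGroup F]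
    [InnerProductSpace ℝ F] (g v : F) : ‖g‖ - 2 * ‖v - g‖ ≤ inner ℝ g (‖v‖⁻¹ • v) := by
  have htriangle : ‖g‖ ≤ ‖v‖ + ‖v - g‖ := by
    simpa only [sub_sub_cancel] using norm_sub_le v (v - g)
  rcases eq_or_ne v 0 with rfl | hv
  · simp only [smul_zero, inner_zero_right, zero_sub, norm_neg]
    linarith [norm_nonneg g]
  · have hv' : ‖v‖ ≠ 0 := norm_ne_zero_iff.2 hv
    have hself : inner ℝ v (‖v‖⁻¹ • v) = ‖v‖ := by
      rw [inner_smul_right, real_inner_self_eq_norm_sq]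
      field_simp
    have herror : inner ℝ (v - g) (‖v‖⁻¹ • v) ≤ ‖v - g‖ := by
      simpa only [norm_smul, norm_inv, norm_norm, inv_mul_cancel₀ hv', mul_one] using
        real_inner_le_norm (v - g) (‖v‖⁻¹ • v)
    rw [inner_sub_left, hself] at herror
    linarith

namespace Problem

variable {p q d : ℕ} {M : Problem p q d} {lμ Mg Mh R γ : ℝ}

namespace Regular

variable (hM : M.Regular lμ Mg Mh) (hR : M.RewardBound R) (hγ₀ : 0 ≤ γ) (hγ₁ : γ < 1)

include hM hR hγ₀ hγ₁

lemma mul_norm_gradJ_le {α : ℝ} (hα : 0 ≤ α) (H : ℕ) (x : E d × E d) :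
    α * ‖M.gradJ γ x.1‖ ≤ M.J γ (normalizedStep x.1 α x.2) - M.J γ x.1 +
      2 * α * (‖M.estError γ H x‖ + ‖M.gradJ γ x.1 - M.gradJTrunc γ H x.1‖) +
      2 * constLg γ R Mg Mh * α ^ 2 := by
  have hL := constLg_nonneg Mg hR.nonneg hM.Mh_nonneg hγ₁
  have hascent := hM.le_J hR hγ₀ hγ₁ x.1 (normalizedStep x.1 α x.2)
  have hinner : α * (‖M.gradJ γ x.1‖ - 2 * ‖x.2 - M.gradJ γ x.1‖) ≤
      inner ℝ (M.gradJ γ x.1) (normalizedStep x.1 α x.2 - x.1) := by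
    rw [normalizedStep, add_sub_cancel_left, real_inner_smul_right]
    exact mul_le_mul_of_nonneg_left (norm_sub_two_mul_le_inner_normalize _ _) hα
  have hstep : constLg γ R Mg Mh * ‖normalizedStep x.1 α x.2 - x.1‖ ^ 2 ≤
      constLg γ R Mg Mh * α ^ 2 := by
    rw [norm_sub_rev]
    gcongr
    exact norm_sub_normalizedStep_le hα _ _
  have herror : α * ‖x.2 - M.gradJ γ x.1‖ ≤
      α * (‖M.estError γ H x‖ + ‖M.gradJ γ x.1 - M.gradJTrunc γ H x.1‖) := by
    gcongr
    simpa only [estError, sub_sub_sub_cancel_right] using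
      norm_sub_le (M.estError γ H x) (M.gradJ γ x.1 - M.gradJTrunc γ H x.1)
  linarith

lemma continuous_gradJ : Continuous (M.gradJ γ) :=
  (LipschitzWith.of_dist_le' fun x y => by
    simpa only [dist_eq_norm] using hM.norm_gradJ_sub_le hR hγ₀ hγ₁ x y).continuous

lemma differentiable_J : Differentiable ℝ (M.J γ) :=
  fun θ => (hM.hasGradientAt_J hR hγ₀ hγ₁ θ).hasFDerivAt.differentiableAt

variable {Ω : Type*} [MeasurableSpace Ω] {P : Measure Ω} [IsProbabilityMeasure P]
  {X : Ω → E d} (hX : Measurable X)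

include hX

lemma integrable_norm_gradJ : Integrable (fun ω => ‖M.gradJ γ (X ω)‖) P :=
  .of_bound ((hM.continuous_gradJ hR hγ₀ hγ₁).measurable.comp hX).norm.aestronglyMeasurable
    (constV γ R Mg) (.of_forall fun _ => (norm_norm _).trans_le (hM.norm_gradJ_le hR hγ₀ hγ₁ _))

lemma integral_norm_gradJ_le : ∫ ω, ‖M.gradJ γ (X ω)‖ ∂P ≤ constV γ R Mg := by
  simpa only [integral_const, probReal_univ, one_smul] using
    integral_mono (hM.integrable_norm_gradJ hR hγ₀ hγ₁ hX) (integrable_const (μ := P) _)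
      fun ω => hM.norm_gradJ_le hR hγ₀ hγ₁ (X ω)

lemma integrable_J : Integrable (fun ω => M.J γ (X ω)) P :=
  .of_bound ((hM.differentiable_J hR hγ₀ hγ₁).continuous.measurable.comp hX).aestronglyMeasurable
    ((1 - γ)⁻¹ * R) (.of_forall fun _ => hR.abs_J_le hγ₀ hγ₁ _)

lemma integral_J_le_Jstar : ∫ ω, M.J γ (X ω) ∂P ≤ M.Jstar γ := by
  rw [Jstar]
  simpa only [integral_const, probReal_univ, one_smul] using
    integral_mono (hM.integrable_J hR hγ₀ hγ₁ hX) (integrable_const (μ := P) _)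
      fun ω => le_ciSup (hR.bddAbove_range_J hγ₀ hγ₁) (X ω)

end Regular

namespace IsRun

variable {Ω : Type*} [MeasurableSpace Ω] {P : Measure Ω} [IsProbabilityMeasure P] {H T : ℕ}
  {α : ℕ → ℝ} {θ₀ : E d} {τ : ℕ → Ω → Traj p q H}
  (hM : M.Regular lμ Mg Mh) (hR : M.RewardBound R) (hγ₀ : 0 ≤ γ) (hγ₁ : γ < 1)

section MeanSquaredError

variable (hτ : M.IsRun P γ T α momentum θ₀ τ) (hα : ∀ t, 0 ≤ α t)

include hτ hM hR hγ₀ hγ₁ hα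

lemma lintegral_norm_sq_estError_le {B : ℝ} (hB₀ : 0 ≤ B)
    (hB : ∀ t, t + 1 < T →
      2 * (diffConst γ R Mg Mh (constCw H Mg Mh (α t)) * α t ^ 2) ≤ momentum (t + 1) * B)
    {t : ℕ} (ht : t < T) :
    ∫⁻ ω, ENNReal.ofReal (‖M.estError γ H (M.nvrpg γ α momentum θ₀ (fun n => τ n ω) t)‖ ^ 2) ∂P ≤
      ENNReal.ofReal (8 * constV γ R Mg ^ 2 * momentum t + B) := by
  induction t with
  | zero =>
    refine (hτ.lintegral_norm_sq_estError_zero_le hM hR hγ₀ hγ₁ ht).trans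
      (ENNReal.ofReal_le_ofReal ?_)
    have hone : 1 ≤ momentum 0 := momentum_one ▸ momentum_anti zero_le_one
    nlinarith [sq_nonneg (constV γ R Mg)]
  | succ t ih =>
    have hmomentum := momentum_pos t
    have hmomentum' := momentum_pos (t + 1)
    have hle_one : momentum (t + 1) ≤ 1 := momentum_one ▸ momentum_anti t.succ_pos
    have _ : 0 ≤ 1 - momentum (t + 1) := sub_nonneg.2 hle_one
    have _ := diffConst_nonneg γ R Mg hM.Mh_nonneg H (α t)
    calc _ ≤ ENNReal.ofReal (1 - momentum (t + 1)) *
            ENNReal.ofReal (8 * constV γ R Mg ^ 2 * momentum t + B) +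
          ENNReal.ofReal (2 * momentum (t + 1) ^ 2 * constV γ R Mg ^ 2 +
            2 * (diffConst γ R Mg Mh (constCw H Mg Mh (α t)) * α t ^ 2)) := by
          refine (hτ.lintegral_norm_sq_estError_succ_le hM hR hγ₀ hγ₁ ht (hα t) hmomentum'.le
            hle_one).trans ?_
          gcongr
          exact ih (t.lt_succ_self.trans ht)
      _ ≤ ENNReal.ofReal (8 * constV γ R Mg ^ 2 * momentum (t + 1) + B) := by
          rw [← ENNReal.ofReal_mul (by positivity), ← ENNReal.ofReal_add (by positivity)
            (by positivity)]
          exact ENNReal.ofReal_le_ofReal (mse_recursion _ t (hB t ht))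

variable {S : ℝ} (hS₀ : 0 ≤ S)
  (hS : ∀ t, t + 1 < T →
    2 * (diffConst γ R Mg Mh (constCw H Mg Mh (α t)) * α t ^ 2) ≤ momentum (t + 1) * S ^ 2)
  {t : ℕ} (ht : t < T)

include hS ht

lemma memLp_norm_estError :
    MemLp (fun ω => ‖M.estError γ H (M.nvrpg γ α momentum θ₀ (fun n => τ n ω) t)‖) 2 P :=
  memLp_two_of_lintegral_sq_le
    ((hM.measurable_estError hR H).comp (hτ.measurable_nvrpg hM ht)).norm.aemeasurable
    (hτ.lintegral_norm_sq_estError_le hM hR hγ₀ hγ₁ hα (sq_nonneg S) hS ht)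

include hS₀

lemma integral_norm_estError_le :
    ∫ ω, ‖M.estError γ H (M.nvrpg γ α momentum θ₀ (fun n => τ n ω) t)‖ ∂P ≤
      3 * constV γ R Mg * √(momentum t) + S := by
  have hV := constV_nonneg hR.nonneg hM.Mg_nonneg hγ₁
  have hmomentum := (momentum_pos t).le
  have hsq := integral_sq_le_of_lintegral_sq_le
    ((hM.measurable_estError hR H).comp (hτ.measurable_nvrpg hM ht)).norm.aemeasurable
    (by positivity) (hτ.lintegral_norm_sq_estError_le hM hR hγ₀ hγ₁ hα (sq_nonneg S) hS ht)
  refine (integral_le_sqrt_integral_sq (hτ.memLp_norm_estError hM hR hγ₀ hγ₁ hα hS ht)).trans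
    (Real.sqrt_le_iff.2 ⟨by positivity, hsq.trans ?_⟩)
  have hcross : 0 ≤ constV γ R Mg * √(momentum t) * S := by positivity
  nlinarith [mul_nonneg (sq_nonneg (constV γ R Mg)) hmomentum, Real.sq_sqrt hmomentum]

end MeanSquaredError

variable {η : ℕ → ℝ} (hτ : M.IsRun P γ T α η θ₀ τ)

include hτ hM hR hγ₀ hγ₁

lemma mul_integral_norm_gradJ_le {b : ℝ}
    (hb : ∀ θ : E d, ‖M.gradJ γ θ - M.gradJTrunc γ H θ‖ ≤ b) {t : ℕ} (ht : t < T) (hα : 0 ≤ α t)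
    (herror : Integrable (fun ω => ‖M.estError γ H (M.nvrpg γ α η θ₀ (fun n => τ n ω) t)‖) P) :
    α t * ∫ ω, ‖M.gradJ γ (M.iterate γ α η θ₀ (fun n => τ n ω) t)‖ ∂P ≤
      ∫ ω, M.J γ (M.iterate γ α η θ₀ (fun n => τ n ω) (t + 1)) ∂P -
        ∫ ω, M.J γ (M.iterate γ α η θ₀ (fun n => τ n ω) t) ∂P +
        2 * α t * (∫ ω, ‖M.estError γ H (M.nvrpg γ α η θ₀ (fun n => τ n ω) t)‖ ∂P + b) +
        2 * constLg γ R Mg Mh * α t ^ 2 := by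
  have hθ := hτ.measurable_iterate hM ht.le
  have hgrad := (hM.integrable_norm_gradJ (P := P) hR hγ₀ hγ₁ hθ).const_mul (α t)
  have hJ := hM.integrable_J (P := P) hR hγ₀ hγ₁ hθ
  have hJ' := hM.integrable_J (P := P) hR hγ₀ hγ₁
    (hτ.measurable_iterate hM (Nat.succ_le_of_lt ht))
  have herror' := (herror.fun_add (integrable_const b)).const_mul (2 * α t)
  have hbound := integral_mono hgrad (((hJ'.sub hJ).add herror').add
    (integrable_const (2 * constLg γ R Mg Mh * α t ^ 2))) fun ω =>
      (hM.mul_norm_gradJ_le hR hγ₀ hγ₁ hα H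
        (M.nvrpg γ α η θ₀ (fun n => τ n ω) t)).trans <|
          add_le_add_left (add_le_add_right (mul_le_mul_of_nonneg_left
            (add_le_add_right (hb _) _) (mul_nonneg zero_le_two hα)) _) _
  rw [integral_const_mul, integral_add' ((hJ'.sub hJ).add herror') (integrable_const _),
    integral_add' (hJ'.sub hJ) herror', integral_sub' hJ' hJ, integral_const_mul,
    integral_add herror (integrable_const b)] at hbound
  simpa only [integral_const, probReal_univ, one_smul] using hbound

end IsRun

end Problem

/-! ### The law of the output -/

lemma uniformOn_coe_finset {α : Type*} [MeasurableSpace α] [MeasurableSingletonClass α]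
    (s : Finset α) :
    uniformOn (s : Set α) = (s.card : ℝ≥0∞)⁻¹ • ∑ a ∈ s, Measure.dirac a := by
  have hrestrict : Measure.count.restrict (s : Set α) = ∑ a ∈ s, Measure.dirac a := by
    have hdisjoint : (s : Set α).Pairwise (Function.onFun Disjoint fun a => ({a} : Set α)) :=
      fun _ _ _ _ hne => Set.disjoint_singleton.2 hne
    rw [← Set.biUnion_of_singleton (s : Set α)]
    refine (Measure.restrict_biUnion_finset hdisjoint fun a => measurableSet_singleton a).trans ?_
    rw [Measure.sum_coe_finset s fun a => Measure.count.restrict {a}]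
    simp only [Measure.restrict_singleton, Measure.count_singleton, one_smul]
  rw [uniformOn, ProbabilityTheory.cond, hrestrict, Measure.count_apply_finset]

section Output

variable {Ω : Type*} [MeasurableSpace Ω]

lemma outputLaw_eq_smul_sum (P : Measure Ω) [IsProbabilityMeasure P] (T : ℕ) :
    outputLaw P T =
      (T : ℝ≥0∞)⁻¹ • ∑ t ∈ Finset.Icc 1 T, P.map (fun ω => (ω, t)) := by
  rw [outputLaw, ← Finset.coe_Icc, uniformOn_coe_finset, Measure.prod_smul_right,
    ← Measure.sum_coe_finset, Measure.prod_sum_right, Nat.card_Icc, Nat.add_sub_cancel]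
  simp only [Measure.prod_dirac]
  rw [Measure.sum_coe_finset (Finset.Icc 1 T) fun t => P.map (fun ω => (ω, t))]

variable {P : Measure Ω} [IsProbabilityMeasure P] {T : ℕ} {f : Ω × ℕ → ℝ}
  (hf : ∀ t ∈ Finset.Icc 1 T, Integrable (fun ω => f (ω, t)) P)

include hf

lemma integrable_outputLaw (hT : 1 ≤ T) : Integrable f (outputLaw P T) := by
  rw [outputLaw_eq_smul_sum]
  exact (integrable_finsetSum_measure.2 fun t ht =>
    (measurableEmbedding_prod_mk_right t).integrable_map_iff.2 (hf t ht)).smul_measure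
    (ENNReal.inv_ne_top.2 (Nat.cast_ne_zero.2 (Nat.one_le_iff_ne_zero.1 hT)))

lemma integral_outputLaw :
    ∫ x, f x ∂outputLaw P T = (T : ℝ)⁻¹ * ∑ t ∈ Finset.Icc 1 T, ∫ ω, f (ω, t) ∂P := by
  rw [outputLaw_eq_smul_sum, integral_smul_measure,
    integral_finsetSum_measure fun t ht =>
      (measurableEmbedding_prod_mk_right t).integrable_map_iff.2 (hf t ht),
    ENNReal.toReal_inv, ENNReal.toReal_natCast, smul_eq_mul]
  simp only [(measurableEmbedding_prod_mk_right _).integral_map]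

end Output

/-! ### Convergence rate -/

/-- The constant `L_g + G √C_w` of the convergence rate, as a function of `C_w`. -/
noncomputable def rateLgConst (γ R Mg Mh Cw : ℝ) : ℝ := constLg γ R Mg Mh + constG γ R Mg * √Cw

lemma div_one_sub_sq_le_constLg {γ R Mg Mh : ℝ} (hR : 0 ≤ R) (hγ₁ : γ < 1) :
    Mh * R / (1 - γ) ^ 2 ≤ constLg γ R Mg Mh := by
  have _ := sub_pos.2 hγ₁
  exact le_add_of_nonneg_left (by positivity)

section RateLgConst

variable {γ R Mg Mh Cw : ℝ} (hR : 0 ≤ R) (hMg : 0 ≤ Mg)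

include hR hMg

lemma constLg_le_rateLgConst : constLg γ R Mg Mh ≤ rateLgConst γ R Mg Mh Cw :=
  le_add_of_nonneg_right (mul_nonneg (constG_nonneg γ hR hMg) (Real.sqrt_nonneg _))

variable (hMh : 0 ≤ Mh) (hγ₁ : γ < 1)

include hMh hγ₁

lemma rateLgConst_nonneg : 0 ≤ rateLgConst γ R Mg Mh Cw :=
  (constLg_nonneg Mg hR hMh hγ₁).trans (constLg_le_rateLgConst hR hMg)

lemma diffConst_le (hCw : 0 ≤ Cw) :
    diffConst γ R Mg Mh Cw ≤ 2 * rateLgConst γ R Mg Mh Cw ^ 2 := by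
  have hL := constLg_nonneg Mg hR hMh hγ₁
  have hG := constG_nonneg γ hR hMg
  have hsq : (Mh * R / (1 - γ) ^ 2) ^ 2 ≤ constLg γ R Mg Mh ^ 2 := by
    gcongr
    exact div_one_sub_sq_le_constLg hR hγ₁
  have hcross : 0 ≤ constLg γ R Mg Mh * (constG γ R Mg * √Cw) := by positivity
  calc diffConst γ R Mg Mh Cw
      = 2 * (Mh * R / (1 - γ) ^ 2) ^ 2 + 2 * (constG γ R Mg * √Cw) ^ 2 := by
        rw [diffConst, mul_pow, Real.sq_sqrt hCw]
    _ ≤ 2 * rateLgConst γ R Mg Mh Cw ^ 2 := by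
        unfold rateLgConst
        linarith [add_sq (constLg γ R Mg Mh) (constG γ R Mg * √Cw)]

end RateLgConst

lemma inv_rpow_two_thirds_le_momentum {t T : ℕ} (ht : t + 1 < T) :
    ((T : ℝ) ^ ((2 : ℝ) / 3))⁻¹ ≤ momentum (t + 1) := by
  have hT : (0 : ℝ) < T := mod_cast Nat.zero_lt_of_lt ht
  have ht' : (t : ℝ) + 1 + 1 ≤ T := mod_cast ht
  rw [← Real.inv_rpow hT.le, momentum]
  refine Real.rpow_le_rpow (by positivity) ?_ (by norm_num)
  rw [inv_eq_one_div, div_le_div_iff₀ hT (by positivity)]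
  push_cast
  linarith

lemma two_mul_mul_stepsize_sq_le {D K : ℝ} (α₀ : ℝ) (hD : D ≤ 2 * K ^ 2) {t T : ℕ}
    (ht : t + 1 < T) :
    2 * (D * stepsize α₀ T ^ 2) ≤
      momentum (t + 1) * (2 * K * α₀ / (T : ℝ) ^ ((1 : ℝ) / 3)) ^ 2 :=
  calc 2 * (D * stepsize α₀ T ^ 2) ≤ 2 * (2 * K ^ 2 * stepsize α₀ T ^ 2) := by gcongr
    _ = ((T : ℝ) ^ ((2 : ℝ) / 3))⁻¹ * (2 * K * α₀ / (T : ℝ) ^ ((1 : ℝ) / 3)) ^ 2 := by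
        rw [stepsize, div_pow _ ((T : ℝ) ^ ((1 : ℝ) / 3)), rpow_one_third_sq T.cast_nonneg]
        ring
    _ ≤ momentum (t + 1) * (2 * K * α₀ / (T : ℝ) ^ ((1 : ℝ) / 3)) ^ 2 := by
        gcongr
        exact inv_rpow_two_thirds_le_momentum ht

lemma mul_sum_le_of_ascent {a j s : ℕ → ℝ} {α c κ : ℝ} {n : ℕ}
    (hstep : ∀ t < n, α * a t ≤ j (t + 1) - j t + c * s t + κ) :
    α * ∑ t ∈ Finset.range n, a t ≤ j n - j 0 + c * ∑ t ∈ Finset.range n, s t + n * κ :=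
  calc α * ∑ t ∈ Finset.range n, a t
      ≤ ∑ t ∈ Finset.range n, (j (t + 1) - j t + c * s t + κ) := by
        rw [Finset.mul_sum]
        exact Finset.sum_le_sum fun t ht => hstep t (Finset.mem_range.1 ht)
    _ = j n - j 0 + c * ∑ t ∈ Finset.range n, s t + n * κ := by
        rw [Finset.sum_add_distrib, Finset.sum_add_distrib, Finset.sum_range_sub, Finset.mul_sum,
          Finset.sum_const, Finset.card_range, nsmul_eq_mul]

lemma sum_Icc_one_succ {A : Type*} [AddCommMonoid A] (f : ℕ → A) (n : ℕ) :
    ∑ t ∈ Finset.Icc 1 (n + 1), f t = ∑ t ∈ Finset.range n, f (t + 1) + f (n + 1) := by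
  rw [Finset.sum_Icc_succ_top (Nat.le_add_left 1 n), Finset.range_eq_Ico,
    Finset.sum_Ico_add' f 0 n 1, zero_add, Finset.Ico_add_one_right_eq_Icc]

lemma rate_arithmetic {x α₀ A D V L K N : ℝ} (hx : 1 ≤ x) (hα₀ : 0 < α₀) (hD : 0 ≤ D)
    (hV : 0 ≤ V) (hL : 0 ≤ L) (hLK : L ≤ K) (hN : N ≤ x ^ 3)
    (hA : α₀ / x ^ 2 * A ≤ D + 6 * (α₀ / x ^ 2) * V * (2 * x ^ 2) +
      N * (2 * (α₀ / x ^ 2) * (2 * K * α₀ / x + V * (2 / x)) + 2 * L * (α₀ / x ^ 2) ^ 2)) :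
    (x ^ 3)⁻¹ * (A + V) ≤ 17 * (D / (α₀ * x) + (V + K * α₀) / x) := by
  have _ : 0 < x := zero_lt_one.trans_le hx
  have hK : 0 ≤ K := hL.trans hLK
  have hscaled : A ≤ x ^ 2 * (D / α₀ + 16 * V + 4 * (K * α₀)) + x * (2 * (L * α₀)) := by
    calc A = x ^ 2 / α₀ * (α₀ / x ^ 2 * A) := by field_simp
      _ ≤ x ^ 2 / α₀ * (D + 6 * (α₀ / x ^ 2) * V * (2 * x ^ 2) + x ^ 3 *
          (2 * (α₀ / x ^ 2) * (2 * K * α₀ / x + V * (2 / x)) + 2 * L * (α₀ / x ^ 2) ^ 2)) := by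
        gcongr
        exact hA.trans (by gcongr)
      _ = _ := by field_simp; ring
  have hlinear : x * (2 * (L * α₀)) ≤ x ^ 2 * (2 * (K * α₀)) := by
    gcongr
    exact le_self_pow₀ hx two_ne_zero
  have hlast : V ≤ x ^ 2 * V := le_mul_of_one_le_left hV (one_le_pow₀ hx)
  calc (x ^ 3)⁻¹ * (A + V) ≤ (x ^ 3)⁻¹ * (x ^ 2 * (D / α₀ + 17 * V + 6 * (K * α₀))) := by
        gcongr
        linarith
    _ ≤ (x ^ 3)⁻¹ * (x ^ 2 * (17 * (D / α₀) + 17 * V + 17 * (K * α₀))) := by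
        gcongr
        · linarith [div_nonneg hD hα₀.le]
        · norm_num
    _ = 17 * (D / (α₀ * x) + (V + K * α₀) / x) := by field_simp; ring

namespace Problem

variable {p q d : ℕ} {M : Problem p q d} {lμ Mg Mh R γ α₀ : ℝ}
  {Ω : Type*} [MeasurableSpace Ω] {P : Measure Ω} {T : ℕ} {θ₀ : E d}
  {τ : ℕ → Ω → Traj p q (horizon γ T)}

namespace IsStandardRun

variable (hτ : M.IsStandardRun γ α₀ T θ₀ P τ) (hM : M.Regular lμ Mg Mh)

include hτ hM

lemma measurable_θ {t : ℕ} (ht : t ≤ T) : Measurable (M.θ γ α₀ T θ₀ τ t) :=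
  IsRun.measurable_iterate hτ hM ht

variable [IsProbabilityMeasure P] (hR : M.RewardBound R) (hγ₀ : 0 ≤ γ) (hγ₁ : γ < 1)

include hR hγ₀ hγ₁

lemma integrable_norm_gradient {t : ℕ} (ht : t ∈ Finset.Icc 1 T) :
    Integrable (fun ω => ‖gradient (M.J γ) (M.θ γ α₀ T θ₀ τ t ω)‖) P := by
  simp only [hM.gradient_J hR hγ₀ hγ₁]
  exact hM.integrable_norm_gradJ hR hγ₀ hγ₁ (hτ.measurable_θ hM (Finset.mem_Icc.1 ht).2)

lemma outputGradNorm_eq :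
    M.outputGradNorm γ α₀ T θ₀ P τ =
      (T : ℝ)⁻¹ * ∑ t ∈ Finset.Icc 1 T, ∫ ω, ‖M.gradJ γ (M.θ γ α₀ T θ₀ τ t ω)‖ ∂P := by
  rw [outputGradNorm,
    integral_outputLaw fun t ht => hτ.integrable_norm_gradient hM hR hγ₀ hγ₁ ht]
  simp only [hM.gradient_J hR hγ₀ hγ₁]

variable (hα₀ : 0 ≤ α₀)

include hα₀

lemma stepsize_mul_integral_norm_gradJ_le {t : ℕ} (ht : t < T) :
    stepsize α₀ T * ∫ ω, ‖M.gradJ γ (M.θ γ α₀ T θ₀ τ t ω)‖ ∂P ≤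
      ∫ ω, M.J γ (M.θ γ α₀ T θ₀ τ (t + 1) ω) ∂P - ∫ ω, M.J γ (M.θ γ α₀ T θ₀ τ t ω) ∂P +
        6 * stepsize α₀ T * constV γ R Mg * √(momentum t) +
        (2 * stepsize α₀ T *
          (2 * rateLgConst γ R Mg Mh (constCw (horizon γ T) Mg Mh (stepsize α₀ T)) * α₀ /
              (T : ℝ) ^ ((1 : ℝ) / 3) +
            constV γ R Mg * (2 / (T : ℝ) ^ ((1 : ℝ) / 3))) +
          2 * constLg γ R Mg Mh * stepsize α₀ T ^ 2) := by
  have hV := constV_nonneg hR.nonneg hM.Mg_nonneg hγ₁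
  have hK := rateLgConst_nonneg (Cw := constCw (horizon γ T) Mg Mh (stepsize α₀ T)) hR.nonneg
    hM.Mg_nonneg hM.Mh_nonneg hγ₁
  have hα : 0 ≤ stepsize α₀ T := by unfold stepsize; positivity
  have hrun : M.IsRun P γ T (fun _ => stepsize α₀ T) momentum θ₀ τ := hτ
  have hnoise := fun s (hs : s + 1 < T) => two_mul_mul_stepsize_sq_le α₀
    (diffConst_le hR.nonneg hM.Mg_nonneg hM.Mh_nonneg hγ₁
      (constCw_nonneg (horizon γ T) (Mg := Mg) hM.Mh_nonneg (stepsize α₀ T))) hs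
  have hbias : ∀ θ : E d, ‖M.gradJ γ θ - M.gradJTrunc γ (horizon γ T) θ‖ ≤
      constV γ R Mg * (2 / (T : ℝ) ^ ((1 : ℝ) / 3)) := fun θ =>
    (hM.norm_gradJ_sub_gradJTrunc_le hR hγ₀ hγ₁ _ θ).trans
      (mul_le_mul_of_nonneg_left (pow_horizon_mul_le hγ₁ hγ₀ (Nat.one_le_of_lt ht)) hV)
  have herror := mul_le_mul_of_nonneg_left
    (hrun.integral_norm_estError_le hM hR hγ₀ hγ₁ (fun _ => hα) (by positivity) hnoise ht) hα
  have hascent := hrun.mul_integral_norm_gradJ_le hM hR hγ₀ hγ₁ hbias ht hα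
    ((hrun.memLp_norm_estError hM hR hγ₀ hγ₁ (fun _ => hα) hnoise ht).integrable one_le_two)
  unfold Problem.θ
  linarith

lemma stepsize_mul_sum_integral_norm_gradJ_le {n : ℕ} (hn : T = n + 1) :
    stepsize α₀ T * ∑ t ∈ Finset.range n, ∫ ω, ‖M.gradJ γ (M.θ γ α₀ T θ₀ τ (t + 1) ω)‖ ∂P ≤
      M.Jstar γ - ∫ ω, M.J γ (M.θ γ α₀ T θ₀ τ 1 ω) ∂P +
        6 * stepsize α₀ T * constV γ R Mg * (2 * (T : ℝ) ^ ((2 : ℝ) / 3)) +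
        n * (2 * stepsize α₀ T *
          (2 * rateLgConst γ R Mg Mh (constCw (horizon γ T) Mg Mh (stepsize α₀ T)) * α₀ /
              (T : ℝ) ^ ((1 : ℝ) / 3) +
            constV γ R Mg * (2 / (T : ℝ) ^ ((1 : ℝ) / 3))) +
          2 * constLg γ R Mg Mh * stepsize α₀ T ^ 2) := by
  have hV := constV_nonneg hR.nonneg hM.Mg_nonneg hγ₁
  have hα : 0 ≤ stepsize α₀ T := by unfold stepsize; positivity
  have hlast := hM.integral_J_le_Jstar (P := P) hR hγ₀ hγ₁ (hτ.measurable_θ hM hn.ge)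
  have hmomentum : ∑ t ∈ Finset.range n, √(momentum (t + 1)) ≤ 2 * (T : ℝ) ^ ((2 : ℝ) / 3) := by
    have hsum := sum_sqrt_momentum_le T
    rw [hn, Finset.sum_range_succ', ← hn] at hsum
    exact (le_add_of_nonneg_right (Real.sqrt_nonneg _)).trans hsum
  refine (mul_sum_le_of_ascent (j := fun t => ∫ ω, M.J γ (M.θ γ α₀ T θ₀ τ (t + 1) ω) ∂P)
    fun t ht => hτ.stepsize_mul_integral_norm_gradJ_le hM hR hγ₀ hγ₁ hα₀
      (t := t + 1) (by lia)).trans ?_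
  gcongr

end IsStandardRun

lemma IsStandardRun.outputGradNorm_le [IsProbabilityMeasure P]
    (hτ : M.IsStandardRun γ α₀ T θ₀ P τ) (hM : M.Regular lμ Mg Mh) (hR : M.RewardBound R)
    (hγ₀ : 0 ≤ γ) (hγ₁ : γ < 1) (hα₀ : 0 < α₀) (hT : 1 ≤ T) :
    M.outputGradNorm γ α₀ T θ₀ P τ ≤
      17 * ((M.Jstar γ - ∫ ω, M.J γ (M.θ γ α₀ T θ₀ τ 1 ω) ∂P) / (α₀ * (T : ℝ) ^ ((1 : ℝ) / 3)) +
        (constV γ R Mg +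
          rateLgConst γ R Mg Mh (constCw (horizon γ T) Mg Mh (stepsize α₀ T)) * α₀) /
          (T : ℝ) ^ ((1 : ℝ) / 3)) := by
  obtain ⟨n, hn⟩ := Nat.exists_eq_add_of_le' hT
  have hMg := hM.Mg_nonneg
  have hinitial := hM.integral_J_le_Jstar (P := P) hR hγ₀ hγ₁ (hτ.measurable_θ hM hT)
  have hlast := hM.integral_norm_gradJ_le (P := P) hR hγ₀ hγ₁ (hτ.measurable_θ hM le_rfl)
  have hsum : ∑ t ∈ Finset.Icc 1 T, ∫ ω, ‖M.gradJ γ (M.θ γ α₀ T θ₀ τ t ω)‖ ∂P ≤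
      ∑ t ∈ Finset.range n, ∫ ω, ‖M.gradJ γ (M.θ γ α₀ T θ₀ τ (t + 1) ω)‖ ∂P +
        constV γ R Mg := by
    nth_rw 1 [hn]
    rw [sum_Icc_one_succ, ← hn]
    gcongr
  have hascent := hτ.stepsize_mul_sum_integral_norm_gradJ_le hM hR hγ₀ hγ₁ hα₀.le hn
  have hstepsize : stepsize α₀ T = α₀ / ((T : ℝ) ^ ((1 : ℝ) / 3)) ^ 2 := by
    rw [stepsize, rpow_one_third_sq T.cast_nonneg]
  rw [hstepsize, ← rpow_one_third_sq T.cast_nonneg] at hascent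
  have hnT : (n : ℝ) ≤ ((T : ℝ) ^ ((1 : ℝ) / 3)) ^ 3 := by
    rw [rpow_one_third_pow_three T.cast_nonneg, hn]
    exact mod_cast n.le_succ
  have hrate := rate_arithmetic (Real.one_le_rpow (mod_cast hT) (by norm_num)) hα₀
    (sub_nonneg.2 hinitial) (constV_nonneg hR.nonneg hMg hγ₁)
    (constLg_nonneg Mg hR.nonneg hM.Mh_nonneg hγ₁) (constLg_le_rateLgConst hR.nonneg hMg) hnT
    hascent
  rw [rpow_one_third_pow_three T.cast_nonneg] at hrate
  rw [hτ.outputGradNorm_eq hM hR hγ₀ hγ₁, hstepsize]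
  exact (mul_le_mul_of_nonneg_left hsum (by positivity)).trans hrate

end Problem

/-! ### Sample complexity -/

lemma one_le_two_mul_log {y : ℝ} (hy : 2 ≤ y) : 1 ≤ 2 * Real.log y := by
  linarith [Real.log_two_gt_d9, Real.log_le_log two_pos hy]

section ConstantsAtStepsize

variable {γ : ℝ} (hγ₀ : 0 ≤ γ) (hγ₁ : γ < 1) {T : ℕ} (hT : 1 ≤ T)

include hγ₀ hγ₁ hT

lemma one_sub_mul_horizon_le_three_mul_log :
    (1 - γ) * horizon γ T ≤ 3 * Real.log ((T : ℝ) + 1) := by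
  have hT' : (1 : ℝ) ≤ T := mod_cast hT
  linarith [one_sub_mul_horizon_le hγ₁ hγ₀ T, one_le_two_mul_log (show 2 ≤ (T : ℝ) + 1 by linarith)]

lemma horizon_mul_stepsize_sq_le : horizon γ T * stepsize (1 - γ) T ^ 2 ≤ 2 := by
  have hT' : (1 : ℝ) ≤ T := mod_cast hT
  have hpow : (T : ℝ) ≤ ((T : ℝ) ^ ((2 : ℝ) / 3)) ^ 2 := by
    rw [← Real.rpow_natCast, ← Real.rpow_mul T.cast_nonneg]
    exact Real.self_le_rpow_of_one_le hT' (by norm_num)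
  rw [stepsize, div_pow, ← mul_div_assoc, div_le_iff₀ (by positivity)]
  calc (horizon γ T : ℝ) * (1 - γ) ^ 2 = (1 - γ) * ((1 - γ) * horizon γ T) := by ring
    _ ≤ 1 * (T + 1) := by
        gcongr
        · exact sub_le_self _ hγ₀
        · exact one_sub_mul_horizon_le_add_one hγ₁ hγ₀ T
    _ ≤ 2 * ((T : ℝ) ^ ((2 : ℝ) / 3)) ^ 2 := by linarith

variable {Mg Mh R : ℝ} (hMh : 0 ≤ Mh)

include hMh

lemma sqrt_constCw_horizon_le :
    √(constCw (horizon γ T) Mg Mh (stepsize (1 - γ) T)) ≤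
      √((2 * Mg ^ 2 + Mh) * (Real.exp (2 * Mg ^ 2) + 1)) * horizon γ T := by
  have hW : constW (horizon γ T) Mg (stepsize (1 - γ) T) ≤ Real.exp (2 * Mg ^ 2) := by
    rw [constW, mul_right_comm]
    gcongr
    exact horizon_mul_stepsize_sq_le hγ₀ hγ₁ hT
  have hW₀ : 0 ≤ constW (horizon γ T) Mg (stepsize (1 - γ) T) := (Real.exp_pos _).le
  have hsq : (horizon γ T : ℝ) ≤ (horizon γ T : ℝ) ^ 2 :=
    mod_cast Nat.le_self_pow two_ne_zero (horizon γ T)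
  rw [← Real.sqrt_sq (Nat.cast_nonneg (α := ℝ) (horizon γ T)), ← Real.sqrt_mul (by positivity)]
  refine Real.sqrt_le_sqrt ?_
  calc constCw (horizon γ T) Mg Mh (stepsize (1 - γ) T)
      ≤ (2 * (horizon γ T : ℝ) ^ 2 * Mg ^ 2 + (horizon γ T : ℝ) ^ 2 * Mh) *
          (Real.exp (2 * Mg ^ 2) + 1) := by unfold constCw; gcongr
    _ = (2 * Mg ^ 2 + Mh) * (Real.exp (2 * Mg ^ 2) + 1) * (horizon γ T : ℝ) ^ 2 := by ring

variable (hMg : 0 ≤ Mg) (hR : 0 ≤ R)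

include hMg hR

lemma rateLgConst_mul_one_sub_le :
    rateLgConst γ R Mg Mh (constCw (horizon γ T) Mg Mh (stepsize (1 - γ) T)) * (1 - γ) ≤
      R * (2 * Mg ^ 2 + Mh + Mg * √((2 * Mg ^ 2 + Mh) * (Real.exp (2 * Mg ^ 2) + 1)) *
        (3 * Real.log ((T : ℝ) + 1))) / (1 - γ) ^ 2 := by
  have hγ := sub_pos.2 hγ₁
  have hLg : constLg γ R Mg Mh * (1 - γ) ≤ R * (2 * Mg ^ 2 + Mh) / (1 - γ) ^ 2 := by
    calc constLg γ R Mg Mh * (1 - γ) = R * (2 * Mg ^ 2 + Mh * (1 - γ)) / (1 - γ) ^ 2 := by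
          unfold constLg; field_simp
      _ ≤ R * (2 * Mg ^ 2 + Mh) / (1 - γ) ^ 2 := by
          gcongr
          exact mul_le_of_le_one_right hMh (sub_le_self _ hγ₀)
  set c := √((2 * Mg ^ 2 + Mh) * (Real.exp (2 * Mg ^ 2) + 1))
  have hGCw : constG γ R Mg * √(constCw (horizon γ T) Mg Mh (stepsize (1 - γ) T)) * (1 - γ) ≤
      R * (Mg * c * (3 * Real.log ((T : ℝ) + 1))) / (1 - γ) ^ 2 := by
    calc constG γ R Mg * √(constCw (horizon γ T) Mg Mh (stepsize (1 - γ) T)) * (1 - γ)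
        ≤ constG γ R Mg * (c * horizon γ T) * (1 - γ) := by
          have _ := constG_nonneg γ hR hMg
          gcongr
          exact sqrt_constCw_horizon_le hγ₀ hγ₁ hT hMh
      _ = R * (Mg * c * ((1 - γ) * horizon γ T)) / (1 - γ) ^ 2 := by unfold constG; ring
      _ ≤ R * (Mg * c * (3 * Real.log ((T : ℝ) + 1))) / (1 - γ) ^ 2 := by
          gcongr R * (Mg * c * ?_) / _
          exact one_sub_mul_horizon_le_three_mul_log hγ₀ hγ₁ hT
  rw [rateLgConst, add_mul, mul_add R, add_div]
  exact add_le_add hLg hGCw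

end ConstantsAtStepsize

lemma constV_le_constG {γ R Mg : ℝ} (hR : 0 ≤ R) (hMg : 0 ≤ Mg) (hγ₀ : 0 ≤ γ) (hγ₁ : γ < 1) :
    constV γ R Mg ≤ constG γ R Mg := by
  have hγ := sub_pos.2 hγ₁
  have hpow : (1 - γ) ^ 2 ≤ (1 - γ) ^ ((3 : ℝ) / 2) := by
    rw [← Real.rpow_two]
    exact Real.rpow_le_rpow_of_exponent_ge hγ (sub_le_self _ hγ₀) (by norm_num)
  unfold constV constG
  gcongr

/-- The constant of the convergence rate for the initial stepsize `1 - γ`. The absolute value only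
matters if `R` is negative and hence bounds no reward. -/
noncomputable def rateConst (Mg Mh R : ℝ) : ℝ :=
  17 * (|R| * (4 + 2 * Mg + 2 * (2 * Mg ^ 2 + Mh) +
    3 * Mg * √((2 * Mg ^ 2 + Mh) * (Real.exp (2 * Mg ^ 2) + 1))))

lemma rateConst_nonneg {Mg Mh : ℝ} (hMg : 0 ≤ Mg) (hMh : 0 ≤ Mh) (R : ℝ) :
    0 ≤ rateConst Mg Mh R := by
  unfold rateConst; positivity

lemma rate_le_log {γ Mg Mh R D : ℝ} (hγ₀ : 0 ≤ γ) (hγ₁ : γ < 1) (hMg : 0 ≤ Mg) (hMh : 0 ≤ Mh)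
    (hR : 0 ≤ R) {T : ℕ} (hT : 1 ≤ T) (hD : D ≤ 2 * R / (1 - γ)) :
    17 * (D / ((1 - γ) * (T : ℝ) ^ ((1 : ℝ) / 3)) +
        (constV γ R Mg + rateLgConst γ R Mg Mh (constCw (horizon γ T) Mg Mh (stepsize (1 - γ) T)) *
          (1 - γ)) / (T : ℝ) ^ ((1 : ℝ) / 3)) ≤
      rateConst Mg Mh R * Real.log (T + 1) / ((1 - γ) ^ 2 * (T : ℝ) ^ ((1 : ℝ) / 3)) := by
  have hT' : (1 : ℝ) ≤ T := mod_cast hT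
  have hγ := sub_pos.2 hγ₁
  have hLg := rateLgConst_mul_one_sub_le hγ₀ hγ₁ hT hMh hMg hR
  have hV := constV_le_constG hR hMg hγ₀ hγ₁
  set c := √((2 * Mg ^ 2 + Mh) * (Real.exp (2 * Mg ^ 2) + 1)) with hc
  set l := Real.log ((T : ℝ) + 1)
  set x := (T : ℝ) ^ ((1 : ℝ) / 3)
  have hl : 1 ≤ 2 * l := one_le_two_mul_log (by linarith)
  have hlog := le_mul_of_one_le_right (show 0 ≤ 2 + Mg + (2 * Mg ^ 2 + Mh) by positivity) hl
  calc 17 * (D / ((1 - γ) * x) + (constV γ R Mg + rateLgConst γ R Mg Mh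
          (constCw (horizon γ T) Mg Mh (stepsize (1 - γ) T)) * (1 - γ)) / x)
      ≤ 17 * (2 * R / (1 - γ) / ((1 - γ) * x) + (constG γ R Mg +
          R * (2 * Mg ^ 2 + Mh + Mg * c * (3 * l)) / (1 - γ) ^ 2) / x) := by gcongr
    _ = 17 * (R * (2 + Mg + (2 * Mg ^ 2 + Mh) + Mg * c * (3 * l))) / ((1 - γ) ^ 2 * x) := by
        unfold constG; field_simp; ring
    _ ≤ 17 * (R * ((2 + Mg + (2 * Mg ^ 2 + Mh)) * (2 * l) + Mg * c * (3 * l))) /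
          ((1 - γ) ^ 2 * x) := by gcongr
    _ = rateConst Mg Mh R * l / ((1 - γ) ^ 2 * x) := by
        rw [rateConst, abs_of_nonneg hR, ← hc]; ring

lemma exists_one_le_mul_log_le (C : ℝ) : ∃ A : ℝ, 1 ≤ A ∧ C * (13 + 6 * Real.log A) ≤ A := by
  have hlittleO : (fun A => C * (13 + 6 * Real.log A)) =o[Filter.atTop] (id : ℝ → ℝ) :=
    ((Asymptotics.isLittleO_const_id_atTop (13 : ℝ)).add
      (Real.isLittleO_log_id_atTop.const_mul_left 6)).const_mul_left C
  obtain ⟨A, hA, hbound⟩ :=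
    ((Filter.eventually_ge_atTop 1).and (hlittleO.bound one_pos)).exists
  refine ⟨A, hA, (Real.le_norm_self _).trans ?_⟩
  simpa only [id, one_mul, Real.norm_of_nonneg (zero_le_one.trans hA)] using hbound

/-- The number `T` of iterations that guarantees accuracy `ε`: the smallest one for which `T^(1/3)`
is at least `A (1-γ)⁻² ε⁻¹ log (2 / ((1-γ) ε))`. -/
noncomputable def iterationCount (A γ ε : ℝ) : ℕ :=
  ⌈(A * ((1 - γ) ^ 2 * ε)⁻¹ * Real.log (2 / ((1 - γ) * ε))) ^ 3⌉₊

section IterationCount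

variable {A γ ε : ℝ} (hγ₀ : 0 ≤ γ) (hγ₁ : γ < 1) (hε : 0 < ε) (hε₁ : ε ≤ 1)

include hγ₀ hγ₁ hε hε₁

lemma one_le_two_mul_log_two_div : 1 ≤ 2 * Real.log (2 / ((1 - γ) * ε)) := by
  have hγε : 0 < (1 - γ) * ε := mul_pos (sub_pos.2 hγ₁) hε
  refine one_le_two_mul_log ((le_div_iff₀ hγε).2 ?_)
  exact mul_le_of_le_one_right two_pos.le (mul_le_one₀ (sub_le_self _ hγ₀) hε.le hε₁)

lemma log_two_div_pos : 0 < Real.log (2 / ((1 - γ) * ε)) := by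
  linarith [one_le_two_mul_log_two_div hγ₀ hγ₁ hε hε₁]

lemma one_le_inv_sq_mul : 1 ≤ ((1 - γ) ^ 2 * ε)⁻¹ := by
  have _ := sub_pos.2 hγ₁
  refine (one_le_inv₀ (by positivity)).2 (mul_le_one₀ ?_ hε.le hε₁)
  exact pow_le_one₀ (sub_pos.2 hγ₁).le (sub_le_self _ hγ₀)

lemma inv_sq_mul_log_le_exp :
    ((1 - γ) ^ 2 * ε)⁻¹ * Real.log (2 / ((1 - γ) * ε)) ≤
      Real.exp (3 * Real.log (2 / ((1 - γ) * ε))) := by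
  have _ := sub_pos.2 hγ₁
  have hx : ((1 - γ) ^ 2 * ε)⁻¹ ≤ (2 / ((1 - γ) * ε)) ^ 2 := by
    rw [div_pow, mul_pow, inv_eq_one_div]
    gcongr
    · norm_num
    · exact pow_le_of_le_one hε.le hε₁ two_ne_zero
  have hexp : Real.exp (Real.log (2 / ((1 - γ) * ε))) = 2 / ((1 - γ) * ε) :=
    Real.exp_log (by positivity)
  calc ((1 - γ) ^ 2 * ε)⁻¹ * Real.log (2 / ((1 - γ) * ε))
      ≤ (2 / ((1 - γ) * ε)) ^ 2 * (2 / ((1 - γ) * ε)) :=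
        mul_le_mul hx (Real.log_le_self (by positivity))
          (log_two_div_pos hγ₀ hγ₁ hε hε₁).le (by positivity)
    _ = Real.exp (3 * Real.log (2 / ((1 - γ) * ε))) := by
        rw [← pow_succ, ← hexp, ← Real.exp_nat_mul, hexp]
        norm_num

variable (hA : 1 ≤ A)

include hA

lemma one_le_iterationCount : 1 ≤ iterationCount A γ ε := by
  have _ := log_two_div_pos hγ₀ hγ₁ hε hε₁
  have _ := sub_pos.2 hγ₁
  exact Nat.one_le_ceil_iff.2 (by positivity)

lemma iterationCount_le :
    (iterationCount A γ ε : ℝ) ≤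
      (A ^ 3 + 8) * (((1 - γ) ^ 6 * ε ^ 3)⁻¹ * Real.log (2 / ((1 - γ) * ε)) ^ 3) := by
  have hl := log_two_div_pos hγ₀ hγ₁ hε hε₁
  have hx := one_le_inv_sq_mul hγ₀ hγ₁ hε hε₁
  set l := Real.log (2 / ((1 - γ) * ε))
  have hx3 : (((1 - γ) ^ 2 * ε)⁻¹) ^ 3 = ((1 - γ) ^ 6 * ε ^ 3)⁻¹ := by
    rw [inv_pow, mul_pow, ← pow_mul]
  have hone : 1 ≤ (((1 - γ) ^ 2 * ε)⁻¹ * (2 * l)) ^ 3 :=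
    one_le_pow₀ (one_le_mul_of_one_le_of_one_le hx (one_le_two_mul_log_two_div hγ₀ hγ₁ hε hε₁))
  calc (iterationCount A γ ε : ℝ)
      ≤ (A * ((1 - γ) ^ 2 * ε)⁻¹ * l) ^ 3 + 1 := (Nat.ceil_lt_add_one (by positivity)).le
    _ ≤ (A * ((1 - γ) ^ 2 * ε)⁻¹ * l) ^ 3 + (((1 - γ) ^ 2 * ε)⁻¹ * (2 * l)) ^ 3 := by gcongr
    _ = (A ^ 3 + 8) * (((1 - γ) ^ 6 * ε ^ 3)⁻¹ * l ^ 3) := by rw [← hx3]; ring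

lemma log_iterationCount_add_one_le :
    Real.log (iterationCount A γ ε + 1) ≤ (13 + 6 * Real.log A) * Real.log (2 / ((1 - γ) * ε)) := by
  have hl₀ := log_two_div_pos hγ₀ hγ₁ hε hε₁
  have hl := one_le_two_mul_log_two_div hγ₀ hγ₁ hε hε₁
  have hx := one_le_inv_sq_mul hγ₀ hγ₁ hε hε₁
  have hexp := inv_sq_mul_log_le_exp hγ₀ hγ₁ hε hε₁
  rw [iterationCount, mul_assoc]
  set l := Real.log (2 / ((1 - γ) * ε))
  set x := ((1 - γ) ^ 2 * ε)⁻¹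
  have hone : 1 ≤ (A * Real.exp (3 * l)) ^ 3 :=
    one_le_pow₀ (one_le_mul_of_one_le_of_one_le hA (Real.one_le_exp (by positivity)))
  have hle : (⌈(A * (x * l)) ^ 3⌉₊ : ℝ) + 1 ≤ 3 * (A * Real.exp (3 * l)) ^ 3 :=
    calc (⌈(A * (x * l)) ^ 3⌉₊ : ℝ) + 1 ≤ (A * (x * l)) ^ 3 + 1 + 1 := by
          gcongr
          exact (Nat.ceil_lt_add_one (by positivity)).le
      _ ≤ (A * Real.exp (3 * l)) ^ 3 + 1 + 1 := by gcongr
      _ ≤ 3 * (A * Real.exp (3 * l)) ^ 3 := by linarith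
  calc Real.log (⌈(A * (x * l)) ^ 3⌉₊ + 1) ≤ Real.log (3 * (A * Real.exp (3 * l)) ^ 3) :=
        Real.log_le_log (by positivity) hle
    _ = Real.log 3 + 3 * Real.log A + 9 * l := by
        rw [Real.log_mul three_ne_zero (by positivity), Real.log_pow,
          Real.log_mul (by positivity) (Real.exp_pos _).ne', Real.log_exp]
        push_cast
        ring
    _ ≤ (13 + 6 * Real.log A) * l := by
        linarith [Real.log_le_sub_one_of_pos (three_pos (α := ℝ)),
          mul_le_mul_of_nonneg_right hl (Real.log_nonneg hA)]

lemma iterationCount_mul_horizon_le :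
    (iterationCount A γ ε : ℝ) * horizon γ (iterationCount A γ ε) ≤
      (A ^ 3 + 8) * (15 + 6 * Real.log A) *
        (((1 - γ) ^ 7 * ε ^ 3)⁻¹ * Real.log (2 / ((1 - γ) * ε)) ^ 4) := by
  have hγ := sub_pos.2 hγ₁
  have hl := one_le_two_mul_log_two_div hγ₀ hγ₁ hε hε₁
  have _ := log_two_div_pos hγ₀ hγ₁ hε hε₁
  have hlog := log_iterationCount_add_one_le hγ₀ hγ₁ hε hε₁ hA
  have hcount := iterationCount_le hγ₀ hγ₁ hε hε₁ hA
  have hhorizon := one_sub_mul_horizon_le hγ₁ hγ₀ (iterationCount A γ ε)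
  have _ : 0 < A := zero_lt_one.trans_le hA
  set l := Real.log (2 / ((1 - γ) * ε))
  calc (iterationCount A γ ε : ℝ) * horizon γ (iterationCount A γ ε)
      = iterationCount A γ ε * ((1 - γ) * horizon γ (iterationCount A γ ε)) / (1 - γ) := by
        field_simp
    _ ≤ (A ^ 3 + 8) * (((1 - γ) ^ 6 * ε ^ 3)⁻¹ * l ^ 3) * ((15 + 6 * Real.log A) * l) /
          (1 - γ) := by
        gcongr ?_ * ?_ / _
        linarith
    _ = (A ^ 3 + 8) * (15 + 6 * Real.log A) * (((1 - γ) ^ 7 * ε ^ 3)⁻¹ * l ^ 4) := by field_simp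

lemma log_iterationCount_div_le {C : ℝ} (hC : 0 ≤ C) (hCA : C * (13 + 6 * Real.log A) ≤ A) :
    C * Real.log (iterationCount A γ ε + 1) /
      ((1 - γ) ^ 2 * (iterationCount A γ ε : ℝ) ^ ((1 : ℝ) / 3)) ≤ ε := by
  have hγ := sub_pos.2 hγ₁
  have hl := log_two_div_pos hγ₀ hγ₁ hε hε₁
  have hlog := log_iterationCount_add_one_le hγ₀ hγ₁ hε hε₁ hA
  have hroot : A * ((1 - γ) ^ 2 * ε)⁻¹ * Real.log (2 / ((1 - γ) * ε)) ≤
      (iterationCount A γ ε : ℝ) ^ ((1 : ℝ) / 3) := by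
    refine le_of_pow_le_pow_left₀ three_ne_zero (by positivity) ?_
    rw [rpow_one_third_pow_three (Nat.cast_nonneg _)]
    exact Nat.le_ceil _
  set l := Real.log (2 / ((1 - γ) * ε))
  have hA₀ : 0 < A := zero_lt_one.trans_le hA
  have hlogA := Real.log_nonneg hA
  calc C * Real.log (iterationCount A γ ε + 1) /
        ((1 - γ) ^ 2 * (iterationCount A γ ε : ℝ) ^ ((1 : ℝ) / 3))
      ≤ C * ((13 + 6 * Real.log A) * l) / ((1 - γ) ^ 2 * (A * ((1 - γ) ^ 2 * ε)⁻¹ * l)) := by gcongr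
    _ = C * (13 + 6 * Real.log A) / A * ε := by field_simp
    _ ≤ ε := mul_le_of_le_one_left hε.le ((div_le_one hA₀).2 hCA)

end IterationCount

lemma exists_sample_size {C₁ : ℝ} (hC₁ : 0 ≤ C₁) : ∃ C : ℝ, 0 < C ∧ C₁ ≤ C ∧
    ∀ γ : ℝ, 0 ≤ γ → γ < 1 → ∀ ε : ℝ, 0 < ε → ε ≤ 1 → ∃ T : ℕ, 1 ≤ T ∧
      (T : ℝ) ≤ C * ((1 - γ) ^ 6 * ε ^ 3)⁻¹ * Real.log (2 / ((1 - γ) * ε)) ^ 3 ∧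
      (T : ℝ) * horizon γ T ≤ C * ((1 - γ) ^ 7 * ε ^ 3)⁻¹ * Real.log (2 / ((1 - γ) * ε)) ^ 4 ∧
      C₁ * Real.log (T + 1) / ((1 - γ) ^ 2 * (T : ℝ) ^ ((1 : ℝ) / 3)) ≤ ε := by
  obtain ⟨A, hA, hCA⟩ := exists_one_le_mul_log_le C₁
  have hlogA := Real.log_nonneg hA
  have _ : 0 < A := zero_lt_one.trans_le hA
  refine ⟨C₁ + (A ^ 3 + 8) * (15 + 6 * Real.log A), by positivity,
    le_add_of_nonneg_right (by positivity), fun γ hγ₀ hγ₁ ε hε hε₁ =>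
      ⟨iterationCount A γ ε, one_le_iterationCount hγ₀ hγ₁ hε hε₁ hA, ?_, ?_,
        log_iterationCount_div_le hγ₀ hγ₁ hε hε₁ hA hC₁ hCA⟩⟩
  all_goals
    have _ := sub_pos.2 hγ₁
    have _ := log_two_div_pos hγ₀ hγ₁ hε hε₁
    rw [mul_assoc _ _⁻¹]
  · refine (iterationCount_le hγ₀ hγ₁ hε hε₁ hA).trans ?_
    gcongr ?_ * _
    exact le_add_of_nonneg_of_le hC₁ (le_mul_of_one_le_right (by positivity) (by linarith))
  · refine (iterationCount_mul_horizon_le hγ₀ hγ₁ hε hε₁ hA).trans ?_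
    gcongr
    exact le_add_of_nonneg_left hC₁

namespace Problem

variable {p q d : ℕ} {M : Problem p q d} {lμ Mg Mh R γ α₀ : ℝ}

lemma normalizedStep_eq (θ : E d) (α : ℝ) (dir : E d) :
    normalizedStep θ α dir = θ + (α / ‖dir‖) • dir := by
  rw [normalizedStep, smul_smul, div_eq_mul_inv]

lemma RewardBound.Jstar_le (hR : M.RewardBound R) (hγ₀ : 0 ≤ γ) (hγ₁ : γ < 1) :
    M.Jstar γ ≤ (1 - γ)⁻¹ * R :=
  ciSup_le fun θ => (le_abs_self _).trans (hR.abs_J_le hγ₀ hγ₁ θ)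

namespace IsStandardRun

variable {Ω : Type*} [MeasurableSpace Ω] {P : Measure Ω} [IsProbabilityMeasure P] {T : ℕ}
  {θ₀ : E d} {τ : ℕ → Ω → Traj p q (horizon γ T)}

lemma isWeight_moments (hτ : M.IsStandardRun γ α₀ T θ₀ P τ) (hM : M.Regular lμ Mg Mh)
    (hα₀ : 0 ≤ α₀) {t : ℕ} (ht₀ : 1 ≤ t) (ht : t < T) :
    MemLp (fun ω => M.isWeight (τ t ω) (M.θ γ α₀ T θ₀ τ (t - 1) ω) (M.θ γ α₀ T θ₀ τ t ω)) 2 P ∧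
      ∫ ω, M.isWeight (τ t ω) (M.θ γ α₀ T θ₀ τ (t - 1) ω) (M.θ γ α₀ T θ₀ τ t ω) ∂P = 1 ∧
      variance (fun ω => M.isWeight (τ t ω) (M.θ γ α₀ T θ₀ τ (t - 1) ω)
        (M.θ γ α₀ T θ₀ τ t ω)) P ≤
          constCw (horizon γ T) Mg Mh (stepsize α₀ T) * stepsize α₀ T ^ 2 := by
  obtain ⟨t, rfl⟩ := Nat.exists_eq_add_of_le' ht₀
  exact IsRun.isWeight_moments hτ hM ht (by unfold stepsize; positivity)

lemma outputGradNorm_le_log (hτ : M.IsStandardRun γ (1 - γ) T θ₀ P τ) (hM : M.Regular lμ Mg Mh)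
    (hR : M.RewardBound R) (hγ₀ : 0 ≤ γ) (hγ₁ : γ < 1) (hT : 1 ≤ T) {C : ℝ}
    (hC : rateConst Mg Mh R ≤ C) :
    M.outputGradNorm γ (1 - γ) T θ₀ P τ ≤
      C * Real.log (T + 1) / ((1 - γ) ^ 2 * (T : ℝ) ^ ((1 : ℝ) / 3)) := by
  have hJ : -((1 - γ)⁻¹ * R) ≤ ∫ ω, M.J γ (M.θ γ (1 - γ) T θ₀ τ 1 ω) ∂P := by
    have hmono := integral_mono (μ := P) (integrable_const (-((1 - γ)⁻¹ * R)))
      (hM.integrable_J hR hγ₀ hγ₁ (hτ.measurable_θ hM hT))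
      fun ω => (abs_le.1 (hR.abs_J_le hγ₀ hγ₁ _)).1
    rwa [integral_const, probReal_univ, one_smul] at hmono
  have hgap : M.Jstar γ - ∫ ω, M.J γ (M.θ γ (1 - γ) T θ₀ τ 1 ω) ∂P ≤ 2 * R / (1 - γ) :=
    calc M.Jstar γ - ∫ ω, M.J γ (M.θ γ (1 - γ) T θ₀ τ 1 ω) ∂P
        ≤ (1 - γ)⁻¹ * R - -((1 - γ)⁻¹ * R) := sub_le_sub (hR.Jstar_le hγ₀ hγ₁) hJ
      _ = 2 * R / (1 - γ) := by ring
  have hlog : 0 ≤ Real.log ((T : ℝ) + 1) :=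
    Real.log_nonneg (le_add_of_nonneg_left T.cast_nonneg)
  refine ((hτ.outputGradNorm_le hM hR hγ₀ hγ₁ (sub_pos.2 hγ₁) hT).trans
    (rate_le_log hγ₀ hγ₁ hM.Mg_nonneg hM.Mh_nonneg hR.nonneg hT hgap)).trans ?_
  gcongr

end IsStandardRun

end Problem

end GaussianPG

theorem mainTheorem8 :
    -- importance sampling weights after a normalized update
    (∀ {p q d : ℕ} (M : GaussianPG.Problem p q d) (lμ Mg Mh : ℝ), 0 < Mg → 0 < Mh →
      M.Regular lμ Mg Mh → ∀ (H : ℕ), 1 ≤ H → ∀ (α : ℝ), 0 < α →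
      ∀ (θ dir θ' : GaussianPG.E d), dir ≠ 0 → θ' = θ + (α / ‖dir‖) • dir →
        MeasureTheory.MemLp (fun τ => M.isWeight τ θ θ') 2 (M.trajLaw H θ') ∧
        ∫ τ, M.isWeight τ θ θ' ∂(M.trajLaw H θ') = 1 ∧
        ProbabilityTheory.variance (fun τ => M.isWeight τ θ θ') (M.trajLaw H θ') ≤
          GaussianPG.constCw H Mg Mh α * α ^ 2) ∧
    -- general rate, with an absolute constant; weights along the algorithm
    (∃ C : ℝ, 0 < C ∧
      ∀ {p q d : ℕ} (M : GaussianPG.Problem p q d) (lμ Mg Mh R γ α₀ : ℝ), 0 < Mg → 0 < Mh →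
      M.Regular lμ Mg Mh → M.RewardBound R → 0 < γ → γ < 1 → 0 < α₀ →
      ∀ (T : ℕ), 1 ≤ T → ∀ (θ₀ : GaussianPG.E d)
        {Ω : Type*} [MeasurableSpace Ω] (P : MeasureTheory.Measure Ω)
        [MeasureTheory.IsProbabilityMeasure P]
        (τ : ℕ → Ω → GaussianPG.Traj p q (GaussianPG.horizon γ T)),
      M.IsStandardRun γ α₀ T θ₀ P τ →
        (∀ t, 1 ≤ t → t < T →
          MeasureTheory.MemLp (fun ω => M.isWeight (τ t ω) (M.θ γ α₀ T θ₀ τ (t - 1) ω)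
            (M.θ γ α₀ T θ₀ τ t ω)) 2 P ∧
          ∫ ω, M.isWeight (τ t ω) (M.θ γ α₀ T θ₀ τ (t - 1) ω) (M.θ γ α₀ T θ₀ τ t ω) ∂P = 1 ∧
          ProbabilityTheory.variance (fun ω => M.isWeight (τ t ω) (M.θ γ α₀ T θ₀ τ (t - 1) ω)
            (M.θ γ α₀ T θ₀ τ t ω)) P ≤
              GaussianPG.constCw (GaussianPG.horizon γ T) Mg Mh (GaussianPG.stepsize α₀ T) *
                GaussianPG.stepsize α₀ T ^ 2) ∧
        Differentiable ℝ (M.J γ) ∧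
        BddAbove (Set.range (M.J γ)) ∧
        MeasureTheory.Integrable (fun ω => M.J γ (M.θ γ α₀ T θ₀ τ 1 ω)) P ∧
        MeasureTheory.Integrable
          (fun x : Ω × ℕ => ‖gradient (M.J γ) (M.θ γ α₀ T θ₀ τ x.2 x.1)‖)
          (GaussianPG.outputLaw P T) ∧
        M.outputGradNorm γ α₀ T θ₀ P τ ≤
          C * ((M.Jstar γ - ∫ ω, M.J γ (M.θ γ α₀ T θ₀ τ 1 ω) ∂P) /
                (α₀ * (T : ℝ) ^ ((1 : ℝ) / 3)) +
              (GaussianPG.constV γ R Mg +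
                (GaussianPG.constLg γ R Mg Mh + GaussianPG.constG γ R Mg *
                  Real.sqrt (GaussianPG.constCw (GaussianPG.horizon γ T) Mg Mh
                    (GaussianPG.stepsize α₀ T))) * α₀) /
                (T : ℝ) ^ ((1 : ℝ) / 3))) ∧
    -- rate for `α₀ = 1 - γ`, and the number of samples needed for accuracy `ε`
    (∀ (Mg Mh R : ℝ), 0 < Mg → 0 < Mh → ∃ C : ℝ, 0 < C ∧ ∀ (γ : ℝ), 0 < γ → γ < 1 →
      (∀ {p q d : ℕ} (M : GaussianPG.Problem p q d) (lμ : ℝ),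
        M.Regular lμ Mg Mh → M.RewardBound R →
        ∀ (T : ℕ), 1 ≤ T → ∀ (θ₀ : GaussianPG.E d)
          {Ω : Type*} [MeasurableSpace Ω] (P : MeasureTheory.Measure Ω)
          [MeasureTheory.IsProbabilityMeasure P]
          (τ : ℕ → Ω → GaussianPG.Traj p q (GaussianPG.horizon γ T)),
        M.IsStandardRun γ (1 - γ) T θ₀ P τ →
          M.outputGradNorm γ (1 - γ) T θ₀ P τ ≤
            C * Real.log (T + 1) / ((1 - γ) ^ 2 * (T : ℝ) ^ ((1 : ℝ) / 3))) ∧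
      (∀ ε : ℝ, 0 < ε → ε < 1 → ∃ T : ℕ, 1 ≤ T ∧
        (T : ℝ) ≤ C * ((1 - γ) ^ 6 * ε ^ 3)⁻¹ * Real.log (2 / ((1 - γ) * ε)) ^ 3 ∧
        (T : ℝ) * GaussianPG.horizon γ T ≤
          C * ((1 - γ) ^ 7 * ε ^ 3)⁻¹ * Real.log (2 / ((1 - γ) * ε)) ^ 4 ∧
        ∀ {p q d : ℕ} (M : GaussianPG.Problem p q d) (lμ : ℝ),
          M.Regular lμ Mg Mh → M.RewardBound R →
          ∀ (θ₀ : GaussianPG.E d)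
            {Ω : Type*} [MeasurableSpace Ω] (P : MeasureTheory.Measure Ω)
            [MeasureTheory.IsProbabilityMeasure P]
            (τ : ℕ → Ω → GaussianPG.Traj p q (GaussianPG.horizon γ T)),
          M.IsStandardRun γ (1 - γ) T θ₀ P τ →
            M.outputGradNorm γ (1 - γ) T θ₀ P τ ≤ ε)) := by
  refine ⟨?_, ⟨17, by norm_num, ?_⟩, ?_⟩
  · rintro p q d M lμ Mg Mh - - hM H - α hα θ dir _ - rfl
    rw [← GaussianPG.Problem.normalizedStep_eq]
    exact hM.isWeight_moments H (GaussianPG.Problem.norm_sub_normalizedStep_le hα.le θ dir)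
  · intro p q d M lμ Mg Mh R γ α₀ _ _ hM hR hγ₀ hγ₁ hα₀ T hT θ₀ Ω _ P _ τ hτ
    exact ⟨fun t => hτ.isWeight_moments hM hα₀.le, hM.differentiable_J hR hγ₀.le hγ₁,
      hR.bddAbove_range_J hγ₀.le hγ₁,
      hM.integrable_J hR hγ₀.le hγ₁ (hτ.measurable_θ hM hT),
      GaussianPG.integrable_outputLaw
        (fun t ht => hτ.integrable_norm_gradient hM hR hγ₀.le hγ₁ ht) hT,
      hτ.outputGradNorm_le hM hR hγ₀.le hγ₁ hα₀ hT⟩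
  · intro Mg Mh R hMg hMh
    obtain ⟨C, hC, hrate, hsize⟩ :=
      GaussianPG.exists_sample_size (GaussianPG.rateConst_nonneg hMg.le hMh.le R)
    refine ⟨C, hC, fun γ hγ₀ hγ₁ => ⟨?_, fun ε hε hε₁ => ?_⟩⟩
    · intro p q d M lμ hM hR T hT θ₀ Ω _ P _ τ hτ
      exact hτ.outputGradNorm_le_log hM hR hγ₀.le hγ₁ hT hrate
    · obtain ⟨T, hT, hcount, hsamples, haccuracy⟩ := hsize γ hγ₀.le hγ₁ ε hε hε₁.le
      refine ⟨T, hT, hcount, hsamples, fun M lμ hM hR θ₀ Ω _ P _ τ hτ => ?_⟩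
      exact (hτ.outputGradNorm_le_log hM hR hγ₀.le hγ₁ hT le_rfl).trans haccuracy
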